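/- **Setting.** Fix the number $K$ of arms. A single index bandit with Gaussian design in dimension $d$ over $T$ rounds is given by a continuously differentiable link $f:\mathbb R\to\mathbb R$, a vector $\theta_*\in\mathbb R^d$, a mean $\mu_X\in\mathbb R^d$ and a positive definite covariance matrix $\Sigma_X$, with $\|\Sigma_X^{1/2}\theta_*\|_1=1$ and $\mu_*:=\mathbb E f'(X^\top\theta_*)>0$ for $X\sim N(\mu_X,\Sigma_X)$. In round $t\in\{1,\dots,T\}$ the arms $x_{t,1},\dots,x_{t,K}$ are drawn i.i.d. from $N(\mu_X,\Sigma_X)$, independently of the past; the agent plays one of them, $x_t$, and observes $y_t=f(x_t^\top\theta_*)+\eta_t$, where, given the past, the arms of round $t$ and the arm played, $\eta_t$ has mean $0$ and variance at most $\sigma^2$. The regret is $$R_T=\sum_{t=1}^T\Big(\max_{1\le k\le K}f(x_{t,k}^\top\theta_*)-f(x_t^\top\theta_*)\Big).$$ **Algorithm (GSTOR) with parameters $T_1,\tau,W,h$ and $\lambda=0$.** Let $S=-\nabla\log p$, with $p$ the density of $N(\mu_X,\Sigma_X)$, and let $\phi_\tau(v)=(\operatorname{sign}(v_j)\min(|v_j|,\tau))_j$.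 (1) In rounds $t\le 2T_1$ (and $t \le T$), play an arm uniformly at random, independently of everything so far. (2) Let $\hat\theta$ minimize $\|\theta\|_2^2-\frac{2}{T_1}\sum_{i=1}^{T_1}\phi_\tau(y_iS(x_i))^\top\theta$ over $\theta\in\mathbb R^d$, and set $\hat\theta_0=\hat\theta/\|\Sigma_X^{1/2}\hat\theta\|_1$ (with $\hat\theta_0=0$ if $\hat\theta=0$). (3) With $K_h(v)=h^{-1}\mathbf 1_{\{|v|\le h\}}$ and $0/0=0$, let $$\hat f(z)=\frac{\sum_{i=T_1+1}^{2T_1}y_iK_h(z-x_i^\top\hat\theta_0)}{\sum_{i=T_1+1}^{2T_1}K_h(z-x_i^\top\hat\theta_0)}\ \text{ if } |z-\mu_X^\top\hat\theta_0|\le W,\qquad \hat f(z)=0\ \text{ otherwise.}$$ (4) In rounds $2T_1<t\le T$ play an arm that maximizes $\hat f(x_{t,k}^\top\hat\theta_0)$ over $k$, breaking ties arbitrarily. **Theorem.** Let $K$, $L_f,L_{f'},\sigma,c,p\in\mathbb R$ and $m,c_{\min},c_{\max},\delta_0>0$ be given. There is a constant $C$, depending only on these, such that the following holds for all $d$, $T$,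 all $\delta\in(0,1)$ with $\delta\ge\delta_0T^{-p}$ (for instance a fixed $\delta=\delta_0$, with $p=0$), and every bandit as above with $|f|\le L_f$, $|f'|\le L_{f'}$ on $\mathbb R$, $\mu_*\ge m$, all eigenvalues of $\Sigma_X$ in $[c_{\min},c_{\max}]$, and $d^{15}\le cT^2$. If GSTOR is run with $$T_1=\lceil d^{3/8}T^{3/4}\rceil,\quad \tau=\sqrt{3T_1/\log(2d/\delta)},\quad W=2\log T_1,\quad h=T_1^{-1/3},\quad\lambda=0,$$ then $R_T$ is integrable and $\mathbb E(R_T)\le C\,d^{3/8}T^{3/4}$. -/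

import Mathlib

open MeasureTheory ProbabilityTheory
open scoped MatrixOrder

noncomputable section

namespace SingleIndexBandit

/-- `ℝ^d` with the Euclidean inner product. -/
abbrev Vec (d : ℕ) : Type := EuclideanSpace ℝ (Fin d)

/-- The `ℓ¹` norm of a vector. -/
def l1Norm {d : ℕ} (v : Vec d) : ℝ := ∑ j, |v j|

/-- `Σ^{1/2} v`, with the positive semidefinite square root of `Σ`. -/
def sqrtMul {d : ℕ} (S : Matrix (Fin d) (Fin d) ℝ) (v : Vec d) : Vec d :=
  Matrix.toEuclideanCLM (𝕜 := ℝ) (CFC.sqrt S) v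

/-- The Lebesgue density of `N(μ, Σ)` for positive definite `Σ`. -/
def gaussianDensity {d : ℕ} (μ : Vec d) (S : Matrix (Fin d) (Fin d) ℝ) (x : Vec d) : ℝ :=
  (Real.sqrt ((2 * Real.pi) ^ d * S.det))⁻¹ *
    Real.exp (-(inner ℝ (x - μ) (Matrix.toEuclideanCLM (𝕜 := ℝ) S⁻¹ (x - μ))) / 2)

/-- The score function `-∇ log p` of a density `p`. -/
def score {d : ℕ} (p : Vec d → ℝ) (x : Vec d) : Vec d :=
  -gradient (fun z => Real.log (p z)) x

/-- Elementwise truncation `φ_τ`. -/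
def truncate {d : ℕ} (τ : ℝ) (v : Vec d) : Vec d :=
  WithLp.toLp 2 fun j => Real.sign (v j) * min |v j| τ

/-- The (regularized) objective of the Stein estimator, for the score function `S` and the
samples `(xs i, ys i)`. -/
def steinObjective {d n : ℕ} (S : Vec d → Vec d) (τ lam : ℝ) (xs : Fin n → Vec d)
    (ys : Fin n → ℝ) (θ : Vec d) : ℝ :=
  ‖θ‖ ^ 2 - 2 / (n : ℝ) * ∑ i, inner ℝ (truncate τ (ys i • S (xs i))) θ + lam * l1Norm θ

/-- The uniform kernel `K_h(v) = h⁻¹ 1_{|v| ≤ h}`. -/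
def uniformKernel (h v : ℝ) : ℝ := Set.indicator {u : ℝ | |u| ≤ h} (fun _ => 1 / h) v

/-- The truncated uniform-kernel regression estimate of the link function along the
direction `θ₀`. The convention `0 / 0 = 0` is in force. -/
def kernelRegression {d n : ℕ} (μ : Vec d) (W h : ℝ) (θ₀ : Vec d) (xs : Fin n → Vec d)
    (ys : Fin n → ℝ) (z : ℝ) : ℝ :=
  open Classical in
  if |z - inner ℝ μ θ₀| ≤ W then
    (∑ i, ys i * uniformKernel h (z - inner ℝ (xs i) θ₀)) /
      ∑ i, uniformKernel h (z - inner ℝ (xs i) θ₀)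
  else 0

/-- The unknown parameters of a single index bandit with Gaussian design. -/
structure Problem (d : ℕ) where
  /-- the link (reward) function -/
  f : ℝ → ℝ
  /-- the index vector `θ_*` -/
  θ : Vec d
  /-- the mean of a feature vector -/
  μX : Vec d
  /-- the covariance matrix of a feature vector -/
  SX : Matrix (Fin d) (Fin d) ℝ

namespace Problem

variable {d : ℕ} (I : Problem d)

/-- The law `N(μ_X, Σ_X)` of a feature vector. -/
def law : Measure (Vec d) := multivariateGaussian I.μX I.SX

/-- `μ_* = E f'(Xᵀ θ_*)` for `X ∼ N(μ_X, Σ_X)`. -/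
def meanSlope : ℝ := ∫ x, deriv I.f (inner ℝ x I.θ) ∂I.law

/-- The assumptions on the problem, with the constants on which a bound may depend: bounds
`Lf`, `Lf'` for `|f|`, `|f'|`, a lower bound `m` for `μ_*`, and bounds `cmin`, `cmax` for the
eigenvalues of `Σ_X` (stated through its quadratic form). -/
structure Admissible (Lf Lf' m cmin cmax : ℝ) : Prop where
  smooth : ContDiff ℝ 1 I.f
  f_bdd : ∀ z, |I.f z| ≤ Lf
  deriv_bdd : ∀ z, |deriv I.f z| ≤ Lf'
  posDef : I.SX.PosDef
  eig_lower : ∀ v : Fin d → ℝ, cmin * (v ⬝ᵥ v) ≤ v ⬝ᵥ I.SX.mulVec v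
  eig_upper : ∀ v : Fin d → ℝ, v ⬝ᵥ I.SX.mulVec v ≤ cmax * (v ⬝ᵥ v)
  normalized : l1Norm (sqrtMul I.SX I.θ) = 1
  slope : m ≤ I.meanSlope

end Problem

section Interaction

/- Rounds are numbered `0, …, T - 1`. In round `t` the arms are `x t k`, `k : Fin K`; the agent
plays the arm with index `a t`, and `η t` is the noise of the observed reward. -/
variable {Ω : Type*} {d K : ℕ}

/-- The feature vector of the arm played in round `t`. -/
def played (x : ℕ → Fin K → Ω → Vec d) (a : ℕ → Ω → Fin K) (t : ℕ) (ω : Ω) : Vec d :=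
  x t (a t ω) ω

/-- The reward `f(x_tᵀ θ_*) + η_t` observed in round `t`. -/
def reward (I : Problem d) (x : ℕ → Fin K → Ω → Vec d) (a : ℕ → Ω → Fin K) (η : ℕ → Ω → ℝ)
    (t : ℕ) (ω : Ω) : ℝ :=
  I.f (inner ℝ (played x a t ω) I.θ) + η t ω

/-- The arm set of round `t`. -/
def arms (x : ℕ → Fin K → Ω → Vec d) (t : ℕ) (ω : Ω) : Fin K → Vec d := fun k => x t k ω

/-- All that happened before round `t`: arm sets, played arms, noises. -/
def history (x : ℕ → Fin K → Ω → Vec d) (a : ℕ → Ω → Fin K) (η : ℕ → Ω → ℝ) (t : ℕ) (ω : Ω) :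
    Fin t → (Fin K → Vec d) × Fin K × ℝ :=
  fun s => (arms x s ω, a s ω, η s ω)

/-- The information available just before the reward of round `t` is drawn: the history, the
arm set of round `t` and the arm that is played. -/
abbrev preReward (x : ℕ → Fin K → Ω → Vec d) (a : ℕ → Ω → Fin K) (η : ℕ → Ω → ℝ) (t : ℕ) :
    MeasurableSpace Ω :=
  MeasurableSpace.comap (fun ω => (history x a η t ω, arms x t ω, a t ω)) inferInstance

/-- The cumulative regret over `T` rounds, against the arm of largest expected reward. -/
def regret (I : Problem d) (x : ℕ → Fin K → Ω → Vec d) (a : ℕ → Ω → Fin K) (T : ℕ) (ω : Ω) : ℝ :=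
  ∑ t ∈ Finset.range T,
    ((⨆ k, I.f (inner ℝ (x t k ω) I.θ)) - I.f (inner ℝ (played x a t ω) I.θ))

variable [MeasurableSpace Ω]

/-- The stochastic environment over `T` rounds: in each round the `K` arms are i.i.d. from
`N(μ_X, Σ_X)` and independent of the past, and the noise has, given the past and the present
arms, mean zero and variance at most `σ²`. -/
structure IsEnvironment (I : Problem d) (σ : ℝ) (T : ℕ) (P : Measure Ω)
    (x : ℕ → Fin K → Ω → Vec d) (a : ℕ → Ω → Fin K) (η : ℕ → Ω → ℝ) : Prop where
  measurable_arm : ∀ t < T, ∀ k, Measurable (x t k)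
  measurable_action : ∀ t < T, Measurable (a t)
  measurable_noise : ∀ t < T, Measurable (η t)
  arms_law : ∀ t < T, P.map (arms x t) = Measure.pi fun _ : Fin K => I.law
  arms_indep : ∀ t < T, IndepFun (arms x t) (history x a η t) P
  noise_memLp : ∀ t < T, MemLp (η t) 2 P
  noise_mean : ∀ t < T, P[η t | preReward x a η t] =ᵐ[P] 0
  noise_var : ∀ t < T, ∀ᵐ ω ∂P, (P[fun ω' => η t ω' ^ 2 | preReward x a η t]) ω ≤ σ ^ 2

/-- The normalized estimator `θ̂₀ = θ̂ / ‖Σ_X^{1/2} θ̂‖₁`. -/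
def normalizedEstimator (I : Problem d) (θhat : Vec d) : Vec d :=
  (l1Norm (sqrtMul I.SX θhat))⁻¹ • θhat

/-- The link function estimated from the samples of the second exploration phase. -/
def linkEstimate (I : Problem d) (T₁ : ℕ) (W h : ℝ) (x : ℕ → Fin K → Ω → Vec d)
    (a : ℕ → Ω → Fin K) (η : ℕ → Ω → ℝ) (θhat : Ω → Vec d) (ω : Ω) : ℝ → ℝ :=
  kernelRegression (n := T₁) I.μX W h (normalizedEstimator I (θhat ω))
    (fun i => played x a (T₁ + i) ω) (fun i => reward I x a η (T₁ + i) ω)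

/-- The actions `a` are those of GSTOR with horizon `T` and parameters `T₁, lam, τ, W, h`:
in the rounds `t < 2 T₁` an arm is played uniformly at random; `θ̂` minimizes the Stein objective
on the first `T₁` samples; the link is estimated from the next `T₁` samples; afterwards an arm
that maximizes the estimated reward is played, with arbitrary tie-breaking. -/
structure IsGSTOR (I : Problem d) (T T₁ : ℕ) (lam τ W h : ℝ) (P : Measure Ω)
    (x : ℕ → Fin K → Ω → Vec d) (a : ℕ → Ω → Fin K) (η : ℕ → Ω → ℝ)
    (θhat : Ω → Vec d) : Prop where
  explore_uniform : ∀ t < T, t < 2 * T₁ → ∀ k, P {ω | a t ω = k} = (K : ENNReal)⁻¹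
  explore_indep : ∀ t < T, t < 2 * T₁ →
    IndepFun (a t) (fun ω => (history x a η t ω, arms x t ω)) P
  estimator : ∀ ω, IsMinOn
    (steinObjective (n := T₁) (score (gaussianDensity I.μX I.SX)) τ lam
      (fun i => played x a i ω) (fun i => reward I x a η i ω)) Set.univ (θhat ω)
  greedy : ∀ t < T, 2 * T₁ ≤ t → ∀ ω k,
    linkEstimate I T₁ W h x a η θhat ω (inner ℝ (x t k ω) (normalizedEstimator I (θhat ω))) ≤
      linkEstimate I T₁ W h x a η θhat ω
        (inner ℝ (played x a t ω) (normalizedEstimator I (θhat ω)))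

end Interaction

end SingleIndexBandit

end

/-! The exploration phases last at most `2 T₁` rounds and cost at most `2 Lf` each. In a later round
the greedy choice loses at most twice the sum over the `K` arms of the errors of the estimated
reward, so it suffices to show that the expected error at a fresh arm is of order `√d T₁^(-1/3)`.
The length `T₁ ≈ d^(3/8) T^(3/4)` is the one for which `T √d T₁^(-1/3)` and `T₁` agree.

Direction. Stein's identity (`integral_mul_score`) says that the response times the score has mean
`μ_* θ_*`. With `λ = 0` the estimator is a coordinatewise average of truncated responses. Truncation
at `τ` biases a variable with second moment `C₀` by at most `C₀/τ`, and the centered parts are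
orthogonal up to this bias, so each coordinate has root mean square error at most `C₀/τ + √(4
C₀/T₁)` (`integral_sq_sum_truncated_le`). Passing to the Euclidean norm costs `√d`, and normalizing
in `ℓ¹` costs another `√d` (`lintegral_normalizedEstimator_error_le`). The condition on `d^15` makes
the resulting `d √(log(2d/δ)/T₁)` at most of order `√d T₁^(-1/3)`. Everything is done in
expectation; `δ` enters only through `τ`.

Link. The direction `v = θ̂₀` depends on the first `T₁` samples only, so the next `T₁` samples are
fresh with respect to it. The number of samples in a window of mass `q` is unlikely to be below half
its mean `r = T₁ q` (`lintegral_mul_exp_neg_hits_le`); apart from this event the local average has a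
Lipschitz bias of order `h`, a term for the error of the direction, and noise with second moment of
order `1/r` (`lintegral_local_average_sub_le`).

Averaging over the evaluation point (`lintegral_local_risk_le`) must cope with windows of tiny mass,
and the index `xᵀv` may have very small or zero variance, so no bound on its density is available.
Two facts that hold for any measure on the line replace it. The reciprocal window mass integrates to
at most `2` over a window, which controls the direction term after exchanging the two points.
Against the weight `1/(1+z²)` it integrates to at most `2π/h` over the whole line
(`lintegral_inv_one_add_sq_mul_inv_window_le`). The noise is therefore split by an
arithmetic-geometric mean inequality with a balance `ρ` proportional to `1/(1+z²)`; the price `1/ρ`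
is paid by the second moment of the index, which the `ℓ¹` normalization bounds by `1`. Hence no
logarithm is lost, and the cutoff `W` only adds a term of order `1/T₁`. -/

namespace SingleIndexBandit

/-! ### Conditioning, independence and streams of samples. -/

section Probability

variable {Ω E E' : Type*} {m mΩ : MeasurableSpace Ω} [MeasurableSpace E] [MeasurableSpace E']
  {P : Measure Ω}

/-- An inequality between integrals over all sets of a sub-σ-algebra extends to weights that are
measurable with respect to it. -/
lemma lintegral_mul_le_of_setLIntegral_le (hm : m ≤ mΩ) {f g k : Ω → ENNReal}
    (hf : Measurable f) (hg : Measurable g)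
    (h : ∀ A, MeasurableSet[m] A → ∫⁻ ω in A, f ω ∂P ≤ ∫⁻ ω in A, g ω ∂P)
    (hk : Measurable[m] k) :
    ∫⁻ ω, f ω * k ω ∂P ≤ ∫⁻ ω, g ω * k ω ∂P := by
  have hk' : Measurable k := hk.mono hm le_rfl
  -- The hypothesis is domination of one density measure by the other on `m`; monotonicity of the
  -- integral in the measure then treats every `m`-measurable weight at once.
  have hle : (P.withDensity f).trim hm ≤ (P.withDensity g).trim hm := by
    refine Measure.le_iff.2 fun A hA => ?_
    rw [trim_measurableSet_eq hm hA, trim_measurableSet_eq hm hA,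
      withDensity_apply _ (hm A hA), withDensity_apply _ (hm A hA)]
    exact h A hA
  have := lintegral_mono' hle (le_refl k)
  rw [lintegral_trim hm hk, lintegral_trim hm hk,
    lintegral_withDensity_eq_lintegral_mul _ hf hk',
    lintegral_withDensity_eq_lintegral_mul _ hg hk'] at this
  exact this

/-- The conditional expectation gives the bound on each set of `m`. Weights in `[0, ∞]` need no
integrability, which matters because the weights used later contain reciprocals of window masses. -/
lemma lintegral_sq_mul_le_of_condExp_le [IsProbabilityMeasure P] (hm : m ≤ mΩ) {η : Ω → ℝ} {σ : ℝ}
    (hmeas : Measurable η) (hη : MemLp η 2 P)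
    (hvar : ∀ᵐ ω ∂P, (P[fun ω' => η ω' ^ 2 | m]) ω ≤ σ ^ 2) {k : Ω → ENNReal}
    (hk : Measurable[m] k) :
    ∫⁻ ω, ENNReal.ofReal (η ω ^ 2) * k ω ∂P ≤ ENNReal.ofReal (σ ^ 2) * ∫⁻ ω, k ω ∂P := by
  rw [← lintegral_const_mul _ (hk.mono hm le_rfl)]
  refine lintegral_mul_le_of_setLIntegral_le hm (by fun_prop) measurable_const ?_ hk
  intro A hA
  have hint : Integrable (fun ω => η ω ^ 2) P := hη.integrable_sq
  rw [← ofReal_integral_eq_lintegral_ofReal hint.integrableOn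
    (Filter.Eventually.of_forall fun ω => sq_nonneg _), ← setIntegral_condExp hm hint hA,
    lintegral_const, Measure.restrict_apply_univ]
  calc ENNReal.ofReal (∫ ω in A, (P[fun ω' => η ω' ^ 2 | m]) ω ∂P)
      ≤ ENNReal.ofReal (∫ _ω in A, σ ^ 2 ∂P) := by
        refine ENNReal.ofReal_le_ofReal (integral_mono_ae integrable_condExp.integrableOn
          (integrable_const _) (ae_restrict_of_ae hvar))
    _ = ENNReal.ofReal (σ ^ 2) * P A := by
        rw [setIntegral_const, smul_eq_mul, mul_comm, ENNReal.ofReal_mul (sq_nonneg _),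
          ofReal_measureReal]

/-- The pull-out property. A signed weight, unlike a nonnegative one, requires an integrable
product. -/
lemma integral_mul_eq_zero_of_condExp_eq_zero [IsProbabilityMeasure P] (hm : m ≤ mΩ)
    {η G : Ω → ℝ} (hη : Integrable η P) (hmean : P[η | m] =ᵐ[P] 0) (hG : Measurable[m] G)
    (hint : Integrable (fun ω => η ω * G ω) P) : ∫ ω, η ω * G ω ∂P = 0 := by
  have h := condExp_mul_of_stronglyMeasurable_right (μ := P) (m := m) hG.stronglyMeasurable hint hη
  change ∫ ω, (η * G) ω ∂P = 0
  rw [← integral_condExp hm, integral_eq_zero_of_ae]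
  filter_upwards [h, hmean] with ω h1 h2
  rw [h1, Pi.mul_apply, h2]
  simp

/-- Integrating out a variable that is independent of a sub-σ-algebra. -/
lemma lintegral_comp_of_indep [IsProbabilityMeasure P] (hm : m ≤ mΩ) {X : Ω → E} {Z : Ω → E'}
    (hX : Measurable X)
    (hind : Indep (MeasurableSpace.comap X inferInstance) m P) (hZ : Measurable[m] Z)
    {Φ : E' × E → ENNReal} (hΦ : Measurable Φ) :
    ∫⁻ ω, Φ (Z ω, X ω) ∂P = ∫⁻ ω, ∫⁻ x, Φ (Z ω, x) ∂(P.map X) ∂P := by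
  have hZ' : Measurable Z := hZ.mono hm le_rfl
  have hi : IndepFun Z X P :=
    (indep_of_indep_of_le_left hind.symm hZ.comap_le)
  have := (indepFun_iff_map_prod_eq_prod_map_map hZ'.aemeasurable hX.aemeasurable).1 hi
  have hp : IsProbabilityMeasure (P.map X) := Measure.isProbabilityMeasure_map hX.aemeasurable
  rw [← lintegral_map (f := Φ) (g := fun ω => (Z ω, X ω)) hΦ (hZ'.prodMk hX), this,
    lintegral_prod _ hΦ.aemeasurable, lintegral_map hΦ.lintegral_prod_right' hZ']

lemma integral_mul_of_indep {X : Ω → E} {Z : Ω → ℝ} [IsProbabilityMeasure P] (hm : m ≤ mΩ)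
    (hX : Measurable X)
    (hind : Indep (MeasurableSpace.comap X inferInstance) m P) (hZ : Measurable[m] Z)
    {φ : E → ℝ} (hφ : Measurable φ) :
    ∫ ω, Z ω * φ (X ω) ∂P = (∫ ω, Z ω ∂P) * ∫ x, φ x ∂(P.map X) := by
  have hZ' : Measurable Z := hZ.mono hm le_rfl
  have hi : IndepFun Z (fun ω => φ (X ω)) P :=
    (show IndepFun Z X P from indep_of_indep_of_le_left hind.symm hZ.comap_le).comp
      measurable_id hφ
  rw [hi.integral_fun_mul_eq_mul_integral hZ'.aestronglyMeasurable
    (hφ.comp hX).aestronglyMeasurable, integral_map hX.aemeasurable hφ.aestronglyMeasurable]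

/-- A stream of samples: the designs `X i` are drawn from `ν` independently of the past `F i`, and
the noise `η i` is, given the past and `X i`, centered with variance at most `σ²`. -/
structure IsSampling (P : Measure Ω) (ν : Measure E) (σ : ℝ) (F : ℕ → MeasurableSpace Ω) (N : ℕ)
    (X : ℕ → Ω → E) (η : ℕ → Ω → ℝ) : Prop where
  le : ∀ i ≤ N, F i ≤ mΩ
  mono : ∀ i < N, F i ≤ F (i + 1)
  measurable_design : ∀ i < N, Measurable[F (i + 1)] (X i)
  measurable_noise : ∀ i < N, Measurable[F (i + 1)] (η i)
  law : ∀ i < N, P.map (X i) = ν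
  indep : ∀ i < N, Indep (MeasurableSpace.comap (X i) inferInstance) (F i) P
  noise_memLp : ∀ i < N, MemLp (η i) 2 P
  noise_mean : ∀ i < N, ∀ G : Ω → ℝ, Measurable[F i ⊔ MeasurableSpace.comap (X i) inferInstance] G →
    Integrable (fun ω => η i ω * G ω) P → ∫ ω, η i ω * G ω ∂P = 0
  noise_var : ∀ i < N, ∀ G : Ω → ENNReal,
    Measurable[F i ⊔ MeasurableSpace.comap (X i) inferInstance] G →
    ∫⁻ ω, ENNReal.ofReal (η i ω ^ 2) * G ω ∂P ≤ ENNReal.ofReal (σ ^ 2) * ∫⁻ ω, G ω ∂P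

namespace IsSampling

variable {ν : Measure E} {σ : ℝ} {F : ℕ → MeasurableSpace Ω} {N : ℕ} {X : ℕ → Ω → E}
  {η : ℕ → Ω → ℝ}

lemma le_of_le (hs : IsSampling P ν σ F N X η) {i j : ℕ} (hij : i ≤ j) (hj : j ≤ N) :
    F i ≤ F j := by
  induction j, hij using Nat.le_induction with
  | base => exact le_rfl
  | succ k hk ih => exact (ih (by omega)).trans (hs.mono k (by omega))

lemma lintegral_comp [IsProbabilityMeasure P] (hs : IsSampling P ν σ F N X η) {i : ℕ} (hi : i < N)
    {Z : Ω → E'} (hZ : Measurable[F i] Z) {Φ : E' × E → ENNReal} (hΦ : Measurable Φ) :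
    ∫⁻ ω, Φ (Z ω, X i ω) ∂P = ∫⁻ ω, ∫⁻ x, Φ (Z ω, x) ∂ν ∂P := by
  rw [lintegral_comp_of_indep (hs.le i hi.le)
    ((hs.measurable_design i hi).mono (hs.le (i + 1) hi) le_rfl) (hs.indep i hi) hZ hΦ, hs.law i hi]

lemma integral_mul [IsProbabilityMeasure P] (hs : IsSampling P ν σ F N X η) {i : ℕ} (hi : i < N)
    {Z : Ω → ℝ} (hZ : Measurable[F i] Z) {φ : E → ℝ} (hφ : Measurable φ) :
    ∫ ω, Z ω * φ (X i ω) ∂P = (∫ ω, Z ω ∂P) * ∫ x, φ x ∂ν := by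
  rw [integral_mul_of_indep (hs.le i hi.le)
    ((hs.measurable_design i hi).mono (hs.le (i + 1) hi) le_rfl) (hs.indep i hi) hZ hφ, hs.law i hi]

end IsSampling

end Probability

/-! ### Stein's identity for standard Gaussian vectors. -/

section Stein

/-- Stein's identity for a centered Gaussian variable. -/
lemma integral_mul_id_gaussianReal {f : ℝ → ℝ} (hf : ContDiff ℝ 1 f) {M M' : ℝ}
    (hM : ∀ z, |f z| ≤ M) (hM' : ∀ z, |deriv f z| ≤ M') (c : ℝ) (v : NNReal) :
    ∫ z, f (c + z) * z ∂(gaussianReal 0 v) = v * ∫ z, deriv f (c + z) ∂(gaussianReal 0 v) := by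
  rcases eq_or_ne v 0 with rfl | hv
  · simp
  have hv' : (v : ℝ) ≠ 0 := by exact_mod_cast hv
  have hfc : Continuous f := hf.continuous
  have hf'c : Continuous (deriv f) := hf.continuous_deriv le_rfl
  -- The density solves `p' = -(z/v) p`, so the identity is an integration by parts; the bounds on
  -- `f` and `f'` make all products integrable.
  have hp : ∀ z, HasDerivAt (gaussianPDFReal 0 v) (-(z / v) * gaussianPDFReal 0 v z) z := by
    intro z
    have h1 : HasDerivAt (fun x : ℝ => -(x - 0) ^ 2 / (2 * v)) (-(z / v)) z := by
      have := (((hasDerivAt_id z).sub_const 0).pow 2).neg.div_const (2 * (v : ℝ))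
      convert! this using 1
      simp
      field_simp
    have := (h1.exp).const_mul (Real.sqrt (2 * Real.pi * v))⁻¹
    convert! this using 1
    rw [gaussianPDFReal]
    ring
  have hu : ∀ z, HasDerivAt (fun z => f (c + z)) (deriv f (c + z)) z := by
    intro z
    have := ((hf.differentiable one_ne_zero) (c + z)).hasDerivAt.comp_const_add c z
    exact this
  have hpint := integrable_gaussianPDFReal 0 v
  have hxint : Integrable (fun z => gaussianPDFReal 0 v z * z) := by
    have : Integrable (fun z : ℝ => z) (gaussianReal 0 v) :=
      (memLp_id_gaussianReal 1).integrable le_rfl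
    rw [gaussianReal_of_var_ne_zero _ hv, integrable_withDensity_iff_integrable_smul'
      (measurable_gaussianPDF 0 v) (by simp [gaussianPDF])] at this
    simpa [toReal_gaussianPDF] using this
  have h1 : Integrable ((fun z => f (c + z)) * fun z => -(z / v) * gaussianPDFReal 0 v z) := by
    refine Integrable.bdd_mul (c := M) (g := fun z => -(z / v) * gaussianPDFReal 0 v z) ?_
      (by fun_prop) (Filter.Eventually.of_forall fun z => hM _)
    convert! hxint.const_mul (-(1 / (v : ℝ))) using 2
    ring
  have h2 : Integrable ((fun z => deriv f (c + z)) * gaussianPDFReal 0 v) :=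
    hpint.bdd_mul (c := M') (by fun_prop) (Filter.Eventually.of_forall fun z => hM' _)
  have h3 : Integrable ((fun z => f (c + z)) * gaussianPDFReal 0 v) :=
    hpint.bdd_mul (c := M) (by fun_prop) (Filter.Eventually.of_forall fun z => hM _)
  have key := integral_mul_deriv_eq_deriv_mul_of_integrable (fun x _ => hu x) (fun x _ => hp x)
    h1 h2 h3
  rw [integral_gaussianReal_eq_integral_smul hv, integral_gaussianReal_eq_integral_smul hv]
  simp only [smul_eq_mul]
  have e1 : ∫ z, f (c + z) * (-(z / v) * gaussianPDFReal 0 v z) =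
      -(v : ℝ)⁻¹ * ∫ z, gaussianPDFReal 0 v z * (f (c + z) * z) := by
    rw [← integral_const_mul]
    congr 1 with z
    field_simp
  have e2 : ∫ z, deriv f (c + z) * gaussianPDFReal 0 v z =
      ∫ z, gaussianPDFReal 0 v z * deriv f (c + z) := by
    congr 1 with z
    ring
  rw [e1, e2] at key
  rw [neg_mul, neg_inj] at key
  rw [← key, mul_inv_cancel_left₀ hv']

variable {E : Type*} [NormedAddCommGroup E] [InnerProductSpace ℝ E] [FiniteDimensional ℝ E]
  [MeasurableSpace E] [BorelSpace E]

lemma map_inner_stdGaussian (u : E) :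
    (stdGaussian E).map (fun g => inner ℝ u g) = gaussianReal 0 (‖u‖ ^ 2).toNNReal := by
  have h := IsGaussian.map_eq_gaussianReal (μ := stdGaussian E) (innerSL ℝ u)
  rw [variance_dual_stdGaussian, integral_strongDual_stdGaussian] at h
  simpa using h

lemma covariance_inner_stdGaussian (u w : E) :
    cov[fun g => inner ℝ u g, fun g => inner ℝ w g; stdGaussian E] = inner ℝ u w := by
  rw [← covarianceBilin_apply_eq_cov IsGaussian.memLp_two_id, covarianceBilin_stdGaussian,
    innerSL_apply_apply]

/-- Stein's identity for linear functionals of a standard Gaussian vector. -/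
lemma integral_mul_inner_stdGaussian {f : ℝ → ℝ} (hf : ContDiff ℝ 1 f) {M M' : ℝ}
    (hM : ∀ z, |f z| ≤ M) (hM' : ∀ z, |deriv f z| ≤ M') (c : ℝ) {u : E} (hu : u ≠ 0) (w : E) :
    ∫ g, f (c + inner ℝ u g) * inner ℝ w g ∂(stdGaussian E) =
      inner ℝ u w * ∫ g, deriv f (c + inner ℝ u g) ∂(stdGaussian E) := by
  have hfc : Continuous f := hf.continuous
  have hf'c : Continuous (deriv f) := hf.continuous_deriv le_rfl
  -- With this `β` the vector `w - β u` is orthogonal to `u`, so the two functionals are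
  -- uncorrelated, hence independent by joint Gaussianity. Only the component along `u` contributes.
  set β : ℝ := inner ℝ u w / ‖u‖ ^ 2 with hβ
  have hu' : ‖u‖ ^ 2 ≠ 0 := by simpa using hu
  have hint : ∀ a : E, Integrable (fun g => inner ℝ a g) (stdGaussian E) := fun a =>
    (innerSL ℝ a).integrable_comp IsGaussian.integrable_id
  have hfint : ∀ a : E, Integrable (fun g => f (c + inner ℝ u g) * inner ℝ a g) (stdGaussian E) :=
    fun a => (hint a).bdd_mul (c := M) (Measurable.aestronglyMeasurable (by fun_prop))
      (Filter.Eventually.of_forall fun z => hM _)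
  have hind : IndepFun (fun g => inner ℝ u g) (fun g => inner ℝ (w - β • u) g)
      (stdGaussian E) := by
    refine HasGaussianLaw.indepFun_of_covariance_eq_zero ?_ ?_
    · constructor
      have : IsGaussian ((stdGaussian E).map
        ((innerSL ℝ u).prod (innerSL ℝ (w - β • u)))) := inferInstance
      exact this
    · rw [covariance_inner_stdGaussian, inner_sub_right, inner_smul_right,
        real_inner_self_eq_norm_sq, hβ]
      field_simp
      ring
  have h0 : ∫ g, f (c + inner ℝ u g) * inner ℝ (w - β • u) g ∂(stdGaussian E) = 0 := by
    have h := (hind.comp (φ := fun z => f (c + z)) (ψ := id) (by fun_prop)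
      measurable_id).integral_fun_mul_eq_mul_integral
      (Measurable.aestronglyMeasurable (by simp only [Function.comp_def]; fun_prop))
      (Measurable.aestronglyMeasurable (by simp only [Function.comp_def, id]; fun_prop))
    simp only [Function.comp_def, id] at h
    rw [h]
    have := integral_strongDual_stdGaussian (innerSL ℝ (w - β • u))
    simp only [innerSL_apply_apply] at this
    rw [this, mul_zero]
  have h1 : ∫ g, f (c + inner ℝ u g) * inner ℝ u g ∂(stdGaussian E) =
      ‖u‖ ^ 2 * ∫ g, deriv f (c + inner ℝ u g) ∂(stdGaussian E) := by
    have h := integral_mul_id_gaussianReal hf hM hM' c (‖u‖ ^ 2).toNNReal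
    rw [← map_inner_stdGaussian, integral_map (by fun_prop)
      (Measurable.aestronglyMeasurable (by fun_prop)), integral_map (by fun_prop)
      (Measurable.aestronglyMeasurable (by fun_prop)), Real.coe_toNNReal _ (sq_nonneg _)] at h
    exact h
  have h2 : ∀ g : E, f (c + inner ℝ u g) * inner ℝ w g =
      f (c + inner ℝ u g) * inner ℝ (w - β • u) g + β * (f (c + inner ℝ u g) * inner ℝ u g) := by
    intro g
    rw [inner_sub_left, real_inner_smul_left]
    ring
  simp_rw [h2]
  rw [integral_add (hfint _) ((hfint _).const_mul _), h0, integral_const_mul, h1, hβ]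
  field_simp
  ring

end Stein

/-! ### The score of a multivariate Gaussian. -/

section Gaussian

variable {d : ℕ} {S : Matrix (Fin d) (Fin d) ℝ}

lemma inner_sqrtMul_left (S : Matrix (Fin d) (Fin d) ℝ) (v w : Vec d) :
    inner ℝ (sqrtMul S v) w = inner ℝ v (sqrtMul S w) := by
  have h : IsSelfAdjoint (Matrix.toEuclideanCLM (𝕜 := ℝ) (n := Fin d) (CFC.sqrt S)) :=
    (CFC.sqrt_nonneg S).isSelfAdjoint.map _
  unfold sqrtMul
  conv_lhs => rw [← h.adjoint_eq]
  rw [ContinuousLinearMap.adjoint_inner_left]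

lemma sqrtMul_sqrtMul (hS : S.PosSemidef) (v : Vec d) :
    sqrtMul S (sqrtMul S v) = Matrix.toEuclideanCLM (𝕜 := ℝ) S v := by
  unfold sqrtMul
  rw [← ContinuousLinearMap.comp_apply, ← ContinuousLinearMap.mul_def, ← map_mul,
    CFC.sqrt_mul_sqrt_self _ hS.nonneg]

lemma norm_sqrtMul_sq (hS : S.PosSemidef) (v : Vec d) :
    ‖sqrtMul S v‖ ^ 2 = v.ofLp ⬝ᵥ S.mulVec v.ofLp := by
  rw [← real_inner_self_eq_norm_sq, inner_sqrtMul_left, sqrtMul_sqrtMul hS,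
    Matrix.inner_toEuclideanCLM]

@[fun_prop]
lemma continuous_sqrtMul (S : Matrix (Fin d) (Fin d) ℝ) : Continuous (sqrtMul S) :=
  (Matrix.toEuclideanCLM (𝕜 := ℝ) (CFC.sqrt S)).continuous

lemma multivariateGaussian_eq_map_sqrtMul (μ : Vec d) (S : Matrix (Fin d) (Fin d) ℝ) :
    multivariateGaussian μ S = (stdGaussian (Vec d)).map (fun g => μ + sqrtMul S g) := rfl

lemma map_inner_multivariateGaussian (μ : Vec d) (S : Matrix (Fin d) (Fin d) ℝ) (v : Vec d) :
    (multivariateGaussian μ S).map (fun x => inner ℝ (x - μ) v) =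
      gaussianReal 0 (‖sqrtMul S v‖ ^ 2).toNNReal := by
  rw [multivariateGaussian_eq_map_sqrtMul, Measure.map_map (by fun_prop) (by fun_prop),
    ← map_inner_stdGaussian]
  congr 1 with g
  simp only [Function.comp, add_sub_cancel_left, inner_sqrtMul_left]
  rw [real_inner_comm, inner_sqrtMul_left]

/-- The log-density is a constant minus half a quadratic form, and the symmetry of `S⁻¹` merges the
two terms of its derivative. -/
lemma score_gaussianDensity (hS : S.PosDef) (μ x : Vec d) :
    score (gaussianDensity μ S) x = Matrix.toEuclideanCLM (𝕜 := ℝ) S⁻¹ (x - μ) := by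
  set A := Matrix.toEuclideanCLM (𝕜 := ℝ) (n := Fin d) S⁻¹ with hA
  have hsa : IsSelfAdjoint A := by
    have : IsSelfAdjoint S⁻¹ := hS.inv.isHermitian
    exact this.map _
  have hc : 0 < (Real.sqrt ((2 * Real.pi) ^ d * S.det))⁻¹ := by
    have := hS.det_pos
    positivity
  have hlog : (fun z => Real.log (gaussianDensity μ S z)) = fun z =>
      Real.log (Real.sqrt ((2 * Real.pi) ^ d * S.det))⁻¹ + -(inner ℝ (z - μ) (A (z - μ))) / 2 := by
    funext z
    rw [gaussianDensity, Real.log_mul hc.ne' (Real.exp_pos _).ne', Real.log_exp]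
  have hsub : HasFDerivAt (fun z : Vec d => z - μ) (ContinuousLinearMap.id ℝ (Vec d)) x :=
    (hasFDerivAt_id x).sub_const μ
  have hd := (((hsub.inner ℝ (A.hasFDerivAt.comp x hsub)).neg.mul_const (1 / 2 : ℝ)).const_add
    (Real.log (Real.sqrt ((2 * Real.pi) ^ d * S.det))⁻¹))
  have hg : HasGradientAt (fun z => Real.log (gaussianDensity μ S z)) (-(A (x - μ))) x := by
    rw [hasGradientAt_iff_hasFDerivAt, hlog]
    convert! hd using 1
    · funext z
      simp only [Pi.neg_apply, Function.comp_def]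
      ring
    · ext w
      have : inner ℝ (x - μ) (A w) = inner ℝ (A (x - μ)) w := by
        conv_rhs => rw [← hsa.adjoint_eq]
        rw [ContinuousLinearMap.adjoint_inner_left]
      simp only [fderivInnerCLM_apply, InnerProductSpace.toDual_apply_apply, one_div,
        ContinuousLinearMap.comp_id, smul_neg, neg_apply,
        smul_apply, ContinuousLinearMap.comp_apply,
        ContinuousLinearMap.prod_apply, ContinuousLinearMap.id_apply, Function.comp_apply, this,
        smul_eq_mul, inner_neg_left, real_inner_comm (A (x - μ)) w]
      ring
  rw [score, hg.gradient, neg_neg]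

/-- The direction whose inner product with a standard Gaussian vector is the `j`-th coordinate of
the score of `N(μ, S)`. -/
noncomputable def scoreDirection (S : Matrix (Fin d) (Fin d) ℝ) (j : Fin d) : Vec d :=
  Matrix.toEuclideanCLM (𝕜 := ℝ) S⁻¹ (EuclideanSpace.single j 1)

lemma score_apply (hS : S.PosDef) (μ x : Vec d) (j : Fin d) :
    score (gaussianDensity μ S) x j = inner ℝ (x - μ) (scoreDirection S j) := by
  have hsa : IsSelfAdjoint (Matrix.toEuclideanCLM (𝕜 := ℝ) (n := Fin d) S⁻¹) := by
    have : IsSelfAdjoint S⁻¹ := hS.inv.isHermitian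
    exact this.map _
  rw [score_gaussianDensity hS, scoreDirection, ← ContinuousLinearMap.adjoint_inner_left,
    hsa.adjoint_eq, EuclideanSpace.inner_single_right]
  simp

lemma toEuclideanCLM_scoreDirection (hS : S.PosDef) (j : Fin d) :
    Matrix.toEuclideanCLM (𝕜 := ℝ) S (scoreDirection S j) = EuclideanSpace.single j 1 := by
  rw [scoreDirection, ← ContinuousLinearMap.comp_apply, ← ContinuousLinearMap.mul_def, ← map_mul,
    Matrix.mul_nonsing_inv _ hS.det_pos.ne'.isUnit, map_one]
  rfl

/-- This is the variance of a coordinate of the score. For `w = S⁻¹ e_j` it equals `w j`, and `cmin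
‖w‖² ≤ w j ≤ ‖w‖` forces `w j ≤ 1 / cmin`. -/
lemma norm_sqrtMul_scoreDirection_sq_le (hS : S.PosDef) {cmin : ℝ} (hc : 0 < cmin)
    (hlow : ∀ v : Fin d → ℝ, cmin * (v ⬝ᵥ v) ≤ v ⬝ᵥ S.mulVec v) (j : Fin d) :
    ‖sqrtMul S (scoreDirection S j)‖ ^ 2 ≤ 1 / cmin := by
  set w := scoreDirection S j with hw
  have h1 : ‖sqrtMul S w‖ ^ 2 = w j := by
    rw [← real_inner_self_eq_norm_sq, inner_sqrtMul_left, sqrtMul_sqrtMul hS.posSemidef,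
      toEuclideanCLM_scoreDirection hS, EuclideanSpace.inner_single_right]
    simp
  have h2 := hlow w.ofLp
  rw [← norm_sqrtMul_sq hS.posSemidef] at h2
  have h3 : w.ofLp ⬝ᵥ w.ofLp = ‖w‖ ^ 2 := by
    rw [EuclideanSpace.real_norm_sq_eq, dotProduct]
    simp [sq]
  have h4 : |w j| ≤ ‖w‖ := by simpa using PiLp.norm_apply_le w j
  rw [h3, h1] at h2
  rw [h1, le_div_iff₀ hc]
  have h5 := le_abs_self (w j)
  nlinarith [sq_abs (w j), sq_nonneg (cmin * w j - 1), norm_nonneg w, abs_nonneg (w j),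
    sq_nonneg (cmin * ‖w‖ - 1), mul_nonneg hc.le (norm_nonneg w)]

/-- Stein's identity for the index model: the score correlates with the link along `θ`. -/
lemma integral_mul_score {f : ℝ → ℝ} (hf : ContDiff ℝ 1 f) {M M' : ℝ}
    (hM : ∀ z, |f z| ≤ M) (hM' : ∀ z, |deriv f z| ≤ M') (hS : S.PosDef) (μ θ : Vec d)
    (hθ : sqrtMul S θ ≠ 0) (j : Fin d) :
    ∫ x, f (inner ℝ x θ) * inner ℝ (x - μ) (scoreDirection S j) ∂(multivariateGaussian μ S) =
      θ j * ∫ x, deriv f (inner ℝ x θ) ∂(multivariateGaussian μ S) := by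
  have hfc : Continuous f := hf.continuous
  have hf'c : Continuous (deriv f) := hf.continuous_deriv le_rfl
  have h := integral_mul_inner_stdGaussian hf hM hM' (inner ℝ μ θ) hθ
    (sqrtMul S (scoreDirection S j))
  -- The two square roots combine to `S`, which cancels the `S⁻¹` in the score direction and leaves
  -- `e_j`.
  have hj : inner ℝ (sqrtMul S θ) (sqrtMul S (scoreDirection S j)) = θ j := by
    rw [inner_sqrtMul_left, sqrtMul_sqrtMul hS.posSemidef, toEuclideanCLM_scoreDirection hS,
      EuclideanSpace.inner_single_right]
    simp
  rw [hj] at h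
  rw [multivariateGaussian_eq_map_sqrtMul, integral_map (by fun_prop)
    (Measurable.aestronglyMeasurable (by fun_prop)), integral_map (by fun_prop)
    (Measurable.aestronglyMeasurable (by fun_prop))]
  have hc : ∀ a g : Vec d, inner ℝ (sqrtMul S g) a = inner ℝ (sqrtMul S a) g := fun a g => by
    rw [inner_sqrtMul_left, real_inner_comm]
  simp only [inner_add_left, add_sub_cancel_left, hc θ, hc (scoreDirection S j)]
  exact h

end Gaussian

/-! ### Truncation of real numbers. -/

section Truncation

lemma sign_mul_min_of_abs_le {τ y : ℝ} (h : |y| ≤ τ) : Real.sign y * min |y| τ = y := by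
  rw [min_eq_left h]
  rcases lt_trichotomy y 0 with hy | hy | hy
  · rw [Real.sign_of_neg hy, abs_of_neg hy]; ring
  · simp [hy]
  · rw [Real.sign_of_pos hy, abs_of_pos hy]; ring

lemma abs_sign_mul_min_le_abs {τ : ℝ} (hτ : 0 < τ) (y : ℝ) :
    |Real.sign y * min |y| τ| ≤ |y| := by
  rw [abs_mul, abs_of_nonneg (le_min (abs_nonneg y) hτ.le)]
  rcases Real.sign_apply_eq y with h | h | h <;> simp [h]

lemma abs_sign_mul_min_le {τ : ℝ} (hτ : 0 < τ) (y : ℝ) :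
    |Real.sign y * min |y| τ| ≤ τ := by
  rw [abs_mul, abs_of_nonneg (le_min (abs_nonneg y) hτ.le)]
  rcases Real.sign_apply_eq y with h | h | h <;> simp [h, hτ.le]

/-- Below the threshold nothing changes; above it the change is at most `|y|`, and `|y| ≤ y² / τ`
there. A second moment thus suffices to bound the truncation bias. -/
lemma abs_sign_mul_min_sub_le {τ : ℝ} (hτ : 0 < τ) (y : ℝ) :
    |Real.sign y * min |y| τ - y| ≤ y ^ 2 / τ := by
  rcases le_or_gt |y| τ with h | h
  · rw [sign_mul_min_of_abs_le h, sub_self, abs_zero]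
    positivity
  · have h1 : |Real.sign y * min |y| τ - y| ≤ |y| := by
      rw [min_eq_right h.le]
      rcases lt_trichotomy y 0 with hy | hy | hy
      · rw [Real.sign_of_neg hy, abs_of_neg hy] at *
        rw [abs_le]; constructor <;> linarith
      · simp [hy]
      · rw [Real.sign_of_pos hy, abs_of_pos hy] at *
        rw [abs_le]; constructor <;> linarith
    refine h1.trans ?_
    rw [le_div_iff₀ hτ, ← sq_abs y, sq]
    exact mul_le_mul_of_nonneg_left h.le (abs_nonneg y)

lemma measurable_real_sign : Measurable Real.sign := by
  unfold Real.sign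
  exact Measurable.ite measurableSet_Iio measurable_const
    (Measurable.ite measurableSet_Ioi measurable_const measurable_const)

lemma measurable_sign_mul_min (τ : ℝ) : Measurable fun y : ℝ => Real.sign y * min |y| τ :=
  measurable_real_sign.mul (by fun_prop)

end Truncation

/-! ### Mean square error of truncated averages. -/

section MeanEstimation

lemma sq_integral_le_integral_sq {Ω : Type*} {mΩ : MeasurableSpace Ω} {P : Measure Ω}
    [IsProbabilityMeasure P] {Z : Ω → ℝ} (hZ : Integrable Z P)
    (hZ2 : Integrable (fun ω => Z ω ^ 2) P) : (∫ ω, Z ω ∂P) ^ 2 ≤ ∫ ω, Z ω ^ 2 ∂P := by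
  have h := variance_nonneg Z P
  rw [variance_eq_sub ((memLp_two_iff_integrable_sq hZ.1).2 hZ2)] at h
  simpa using h

variable {Ω E : Type*} {mΩ : MeasurableSpace Ω} [MeasurableSpace E] {P : Measure Ω}
  {ν : Measure E} {σ : ℝ} {F : ℕ → MeasurableSpace Ω} {N : ℕ}
  {X : ℕ → Ω → E} {η : ℕ → Ω → ℝ}

namespace IsSampling

lemma measurable_design' (hs : IsSampling P ν σ F N X η) {i : ℕ} (hi : i < N) :
    Measurable (X i) := (hs.measurable_design i hi).mono (hs.le _ hi) le_rfl

lemma measurable_noise' (hs : IsSampling P ν σ F N X η) {i : ℕ} (hi : i < N) :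
    Measurable (η i) := (hs.measurable_noise i hi).mono (hs.le _ hi) le_rfl

lemma measurable_sup_left {β : Type*} [MeasurableSpace β] {i : ℕ}
    {G : Ω → β} (hG : Measurable[F i] G) :
    Measurable[F i ⊔ MeasurableSpace.comap (X i) inferInstance] G :=
  hG.mono le_sup_left le_rfl

lemma measurable_sup_right {β : Type*} [MeasurableSpace β] {i : ℕ} {φ : E → β}
    (hφ : Measurable φ) :
    Measurable[F i ⊔ MeasurableSpace.comap (X i) inferInstance] fun ω => φ (X i ω) :=
  hφ.comp ((comap_measurable (X i)).mono le_sup_right le_rfl)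

/-- Bounds the second moment of the response times `s`, given the past. The noise is handled with
weight `s² G`, and the design is then integrated out. The weight `G` is needed because the
truncation bias is multiplied by the partial sum so far. -/
lemma lintegral_sq_response_mul_le [IsProbabilityMeasure P] (hs : IsSampling P ν σ F N X η) {i : ℕ}
    (hi : i < N)
    {g s : E → ℝ} (hsm : Measurable s) {L V : ℝ} (hL : ∀ x, |g x| ≤ L)
    (hV : ∫⁻ x, ENNReal.ofReal (s x ^ 2) ∂ν ≤ ENNReal.ofReal V)
    {G : Ω → ENNReal} (hG : Measurable[F i] G) :
    ∫⁻ ω, ENNReal.ofReal (((g (X i ω) + η i ω) * s (X i ω)) ^ 2) * G ω ∂P ≤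
      ENNReal.ofReal (2 * (L ^ 2 + σ ^ 2) * V) * ∫⁻ ω, G ω ∂P := by
  have hX := hs.measurable_design' hi
  have hη := hs.measurable_noise' hi
  have hG' : Measurable G := hG.mono (hs.le i hi.le) le_rfl
  set H : Ω → ENNReal := fun ω => ENNReal.ofReal (s (X i ω) ^ 2) * G ω with hH
  have hHm : Measurable H := by fun_prop
  have hHsup : Measurable[F i ⊔ MeasurableSpace.comap (X i) inferInstance] H :=
    Measurable.mul (measurable_sup_right (φ := fun x => ENNReal.ofReal (s x ^ 2)) (by fun_prop))
      (measurable_sup_left hG)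
  have hHle : ∫⁻ ω, H ω ∂P ≤ ENNReal.ofReal V * ∫⁻ ω, G ω ∂P := by
    have := hs.lintegral_comp hi hG (Φ := fun p => ENNReal.ofReal (s p.2 ^ 2) * p.1) (by fun_prop)
    simp only at this
    rw [hH, this]
    calc ∫⁻ ω, ∫⁻ x, ENNReal.ofReal (s x ^ 2) * G ω ∂ν ∂P
        = ∫⁻ ω, (∫⁻ x, ENNReal.ofReal (s x ^ 2) ∂ν) * G ω ∂P := by
          refine lintegral_congr fun ω => ?_
          rw [lintegral_mul_const _ (by fun_prop)]
      _ ≤ ∫⁻ ω, ENNReal.ofReal V * G ω ∂P := lintegral_mono fun ω => by gcongr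
      _ = _ := lintegral_const_mul _ hG'
  calc ∫⁻ ω, ENNReal.ofReal (((g (X i ω) + η i ω) * s (X i ω)) ^ 2) * G ω ∂P
      ≤ ∫⁻ ω, (ENNReal.ofReal (2 * L ^ 2) * H ω +
          ENNReal.ofReal 2 * (ENNReal.ofReal (η i ω ^ 2) * H ω)) ∂P := by
        refine lintegral_mono fun ω => ?_
        simp only [hH]
        rw [← mul_assoc, ← mul_assoc, ← mul_assoc, ← add_mul,
          ← ENNReal.ofReal_mul (by positivity), ← ENNReal.ofReal_mul (by positivity),
          ← ENNReal.ofReal_mul (by positivity),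
          ← ENNReal.ofReal_add (by positivity) (by positivity)]
        gcongr
        have h1 : g (X i ω) ^ 2 ≤ L ^ 2 := sq_le_sq' (abs_le.1 (hL _)).1 (abs_le.1 (hL _)).2
        rw [mul_pow, ← add_mul]
        refine mul_le_mul_of_nonneg_right ?_ (sq_nonneg _)
        nlinarith [sq_nonneg (g (X i ω) - η i ω)]
    _ = ENNReal.ofReal (2 * L ^ 2) * ∫⁻ ω, H ω ∂P +
          ENNReal.ofReal 2 * ∫⁻ ω, ENNReal.ofReal (η i ω ^ 2) * H ω ∂P := by
        rw [lintegral_add_left (by fun_prop), lintegral_const_mul _ hHm,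
          lintegral_const_mul _ (by fun_prop)]
    _ ≤ ENNReal.ofReal (2 * L ^ 2) * ∫⁻ ω, H ω ∂P +
          ENNReal.ofReal 2 * (ENNReal.ofReal (σ ^ 2) * ∫⁻ ω, H ω ∂P) := by
        gcongr
        exact hs.noise_var i hi H hHsup
    _ = ENNReal.ofReal (2 * (L ^ 2 + σ ^ 2)) * ∫⁻ ω, H ω ∂P := by
        rw [← mul_assoc, ← add_mul, ← ENNReal.ofReal_mul (by positivity),
          ← ENNReal.ofReal_add (by positivity) (by positivity)]
        ring_nf
    _ ≤ ENNReal.ofReal (2 * (L ^ 2 + σ ^ 2)) * (ENNReal.ofReal V * ∫⁻ ω, G ω ∂P) := by gcongr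
    _ = _ := by rw [← mul_assoc, ← ENNReal.ofReal_mul (by positivity)]

/-- Mean square error of the sum of truncated responses. -/
lemma integral_sq_sum_truncated_le [IsProbabilityMeasure P] (hs : IsSampling P ν σ F N X η)
    {g s : E → ℝ} (hg : Measurable g) (hsm : Measurable s) {L V τ : ℝ} (hL : ∀ x, |g x| ≤ L)
    (hV0 : 0 ≤ V) (hV : ∫⁻ x, ENNReal.ofReal (s x ^ 2) ∂ν ≤ ENNReal.ofReal V) (hτ : 0 < τ)
    {k : ℕ} (hk : k ≤ N) :
    ∫ ω, (∑ i ∈ Finset.range k, (Real.sign ((g (X i ω) + η i ω) * s (X i ω)) *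
        min |(g (X i ω) + η i ω) * s (X i ω)| τ - ∫ x, g x * s x ∂ν)) ^ 2 ∂P ≤
      (k * (2 * (L ^ 2 + σ ^ 2) * V / τ) + Real.sqrt (4 * (2 * (L ^ 2 + σ ^ 2) * V) * k)) ^ 2 := by
  set C₀ := 2 * (L ^ 2 + σ ^ 2) * V with hC₀
  have hC₀0 : 0 ≤ C₀ := by positivity
  set b := ∫ x, g x * s x ∂ν with hb
  set v : ℕ → Ω → ℝ := fun i ω => (g (X i ω) + η i ω) * s (X i ω) with hv
  set ψ : ℕ → Ω → ℝ := fun i ω => Real.sign (v i ω) * min |v i ω| τ with hψ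
  set D : ℕ → Ω → ℝ := fun k ω => ∑ i ∈ Finset.range k, (ψ i ω - b) with hD
  change ∫ ω, D k ω ^ 2 ∂P ≤ _
  have hψm : ∀ i < N, Measurable[F (i + 1)] (ψ i) := fun i hi => by
    have h1 := hs.measurable_design i hi
    have h2 := hs.measurable_noise i hi
    exact (measurable_sign_mul_min τ).comp (((hg.comp h1).add h2).mul (hsm.comp h1))
  have hDm : ∀ k ≤ N, Measurable[F k] (D k) := fun k hk => by
    refine Finset.measurable_sum _ fun i hi => ?_
    have hik : i < k := Finset.mem_range.1 hi
    exact ((hψm i (by omega)).mono (hs.le_of_le (by omega) hk) le_rfl).sub_const b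
  have hDbd : ∀ k ω, |D k ω| ≤ k * (τ + |b|) := fun k ω => by
    refine (Finset.abs_sum_le_sum_abs _ _).trans ?_
    refine (Finset.sum_le_card_nsmul _ _ (τ + |b|) fun i _ => ?_).trans
      (by rw [Finset.card_range, nsmul_eq_mul])
    exact (abs_sub _ _).trans (add_le_add (abs_sign_mul_min_le hτ _) le_rfl)
  have hbint : ∀ {Z : Ω → ℝ} {M : ℝ}, Measurable Z → (∀ ω, |Z ω| ≤ M) → Integrable Z P :=
    fun hZ hM => Integrable.of_bound hZ.aestronglyMeasurable _ (Filter.Eventually.of_forall hM)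
  have hvm : ∀ i < N, Measurable (v i) := fun i hi => by
    have h1 := hs.measurable_design' hi
    have h2 := hs.measurable_noise' hi
    fun_prop
  have hψm' : ∀ i < N, Measurable (ψ i) := fun i hi => (hψm i hi).mono (hs.le _ hi) le_rfl
  have hDm' : ∀ k ≤ N, Measurable (D k) := fun k hk => (hDm k hk).mono (hs.le _ hk) le_rfl
  have hDabs_int : ∀ k ≤ N, Integrable (fun ω => |D k ω|) P := fun k hk =>
    (hbint (hDm' k hk) (hDbd k)).abs
  -- weighted second moment of a response
  have hv2 : ∀ i < N, ∀ G : Ω → ℝ, Measurable[F i] G → (∀ ω, 0 ≤ G ω) → Integrable G P →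
      Integrable (fun ω => v i ω ^ 2 * G ω) P ∧
        ∫ ω, v i ω ^ 2 * G ω ∂P ≤ C₀ * ∫ ω, G ω ∂P := by
    intro i hi G hG hG0 hGint
    have hGm : Measurable G := hG.mono (hs.le i hi.le) le_rfl
    have h := hs.lintegral_sq_response_mul_le hi hsm hL hV (G := fun ω => ENNReal.ofReal (G ω))
      (ENNReal.measurable_ofReal.comp hG)
    simp only [← ENNReal.ofReal_mul (sq_nonneg _)] at h
    rw [← ofReal_integral_eq_lintegral_ofReal hGint (Filter.Eventually.of_forall hG0),
      ← ENNReal.ofReal_mul hC₀0] at h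
    have hnn : 0 ≤ᵐ[P] fun ω => v i ω ^ 2 * G ω :=
      Filter.Eventually.of_forall fun ω => mul_nonneg (sq_nonneg _) (hG0 ω)
    have hmeas : AEStronglyMeasurable (fun ω => v i ω ^ 2 * G ω) P :=
      (((hvm i hi).pow_const 2).mul hGm).aestronglyMeasurable
    have hint : Integrable (fun ω => v i ω ^ 2 * G ω) P :=
      ⟨hmeas, (hasFiniteIntegral_iff_ofReal hnn).2 (h.trans_lt ENNReal.ofReal_lt_top)⟩
    refine ⟨hint, ?_⟩
    rw [← ofReal_integral_eq_lintegral_ofReal hint hnn] at h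
    exact (ENNReal.ofReal_le_ofReal_iff
      (mul_nonneg hC₀0 (integral_nonneg hG0))).1 h
  have hsX : ∀ i < N, MemLp (fun ω => s (X i ω)) 2 P := fun i hi => by
    have hX := hs.measurable_design' hi
    refine (memLp_two_iff_integrable_sq (hsm.comp hX).aestronglyMeasurable).2
      ⟨((hsm.comp hX).pow_const 2).aestronglyMeasurable,
      (hasFiniteIntegral_iff_ofReal (Filter.Eventually.of_forall fun ω => sq_nonneg _)).2 ?_⟩
    have : ∫⁻ ω, ENNReal.ofReal (s (X i ω) ^ 2) ∂P = ∫⁻ x, ENNReal.ofReal (s x ^ 2) ∂ν := by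
      rw [← hs.law i hi, lintegral_map (by fun_prop) hX]
    exact this.trans_lt (hV.trans_lt ENNReal.ofReal_lt_top)
  have hgs : ∀ i < N, Integrable (fun ω => g (X i ω) * s (X i ω)) P := fun i hi =>
    ((hsX i hi).integrable one_le_two).bdd_mul (c := L)
      (hg.comp (hs.measurable_design' hi)).aestronglyMeasurable
      (Filter.Eventually.of_forall fun ω => hL _)
  have hηs : ∀ i < N, Integrable (fun ω => η i ω * s (X i ω)) P := fun i hi =>
    (hs.noise_memLp i hi).integrable_mul (hsX i hi)
  have hvint : ∀ i < N, Integrable (v i) P := fun i hi => by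
    have := (hgs i hi).add (hηs i hi)
    refine this.congr (Filter.Eventually.of_forall fun ω => ?_)
    simp only [hv, Pi.add_apply]
    ring
  -- orthogonality
  have horth : ∀ i < N, ∀ G : Ω → ℝ, Measurable[F i] G → (∃ M, ∀ ω, |G ω| ≤ M) →
      ∫ ω, G ω * (v i ω - b) ∂P = 0 := by
    rintro i hi G hG ⟨M, hM⟩
    have hGm : Measurable G := hG.mono (hs.le i hi.le) le_rfl
    have hmulint : ∀ {Z : Ω → ℝ}, Integrable Z P → Integrable (fun ω => G ω * Z ω) P :=
      fun hZ => hZ.bdd_mul (c := M) hGm.aestronglyMeasurable (Filter.Eventually.of_forall hM)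
    have h1 : ∫ ω, G ω * (g (X i ω) * s (X i ω)) ∂P = (∫ ω, G ω ∂P) * b :=
      hs.integral_mul hi hG (φ := fun x => g x * s x) (by fun_prop)
    have h2 : ∫ ω, η i ω * (s (X i ω) * G ω) ∂P = 0 := by
      refine hs.noise_mean i hi _ ((measurable_sup_right hsm).mul (measurable_sup_left hG)) ?_
      refine (hmulint (hηs i hi)).congr (Filter.Eventually.of_forall fun ω => ?_)
      simp only
      ring
    have h3 : ∀ ω, G ω * (v i ω - b) = G ω * (g (X i ω) * s (X i ω)) +
        η i ω * (s (X i ω) * G ω) - G ω * b := fun ω => by simp only [hv]; ring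
    have h4 : Integrable (fun ω => η i ω * (s (X i ω) * G ω)) P := by
      refine (hmulint (hηs i hi)).congr (Filter.Eventually.of_forall fun ω => ?_)
      simp only
      ring
    simp_rw [h3]
    rw [integral_sub ((hmulint (hgs i hi)).fun_add h4) ((hbint hGm hM).mul_const b),
      integral_add (hmulint (hgs i hi)) h4, h1, h2, integral_mul_const]
    ring
  -- Orthogonality to the constant `1` says that `v i` has mean `b`; Jensen's inequality does the
  -- rest.
  have hb2 : ∀ i < N, b ^ 2 ≤ C₀ := by
    intro i hi
    have h1 := horth i hi (fun _ => 1) measurable_const ⟨1, by simp⟩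
    have h2 := (hv2 i hi (fun _ => 1) measurable_const (by simp) (integrable_const _))
    simp only [mul_one, one_mul, integral_const, probReal_univ, smul_eq_mul] at h1 h2
    rw [integral_sub (hvint i hi) (integrable_const _), integral_const, probReal_univ,
      one_smul, sub_eq_zero] at h1
    rw [← h1]
    exact (sq_integral_le_integral_sq (hvint i hi) h2.1).trans h2.2
  have hcs : ∀ k ≤ N, ∫ ω, |D k ω| ∂P ≤ Real.sqrt (∫ ω, D k ω ^ 2 ∂P) := by
    intro k hk
    refine Real.le_sqrt_of_sq_le ?_
    have hsq : Integrable (fun ω => D k ω ^ 2) P :=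
      hbint ((hDm' k hk).pow_const 2) (M := (k * (τ + |b|)) ^ 2) fun ω => by
        rw [abs_pow]
        exact pow_le_pow_left₀ (abs_nonneg _) (hDbd k ω) 2
    refine (sq_integral_le_integral_sq (hDabs_int k hk) (by simpa only [sq_abs] using hsq)).trans ?_
    simp only [sq_abs, le_refl]
  induction k with
  | zero => simp [hD]
  | succ k ih =>
    have hkN : k < N := hk
    have ih := ih hkN.le
    set A := ∫ ω, D k ω ^ 2 ∂P with hA
    have hA0 : 0 ≤ A := integral_nonneg fun ω => sq_nonneg _
    have hsq : Integrable (fun ω => D k ω ^ 2) P :=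
      hbint ((hDm' k hkN.le).pow_const 2) (M := (k * (τ + |b|)) ^ 2) fun ω => by
        rw [abs_pow]
        exact pow_le_pow_left₀ (abs_nonneg _) (hDbd k ω) 2
    have hψb : ∀ ω, |ψ k ω - b| ≤ τ + |b| := fun ω =>
      (abs_sub _ _).trans (add_le_add (abs_sign_mul_min_le hτ _) le_rfl)
    have hcross : Integrable (fun ω => D k ω * (ψ k ω - b)) P :=
      hbint ((hDm' k hkN.le).mul ((hψm' k hkN).sub_const b))
        (M := (k * (τ + |b|)) * (τ + |b|)) fun ω => by
        rw [abs_mul]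
        exact mul_le_mul (hDbd k ω) (hψb ω) (abs_nonneg _) (by positivity)
    have hinc : Integrable (fun ω => (ψ k ω - b) ^ 2) P :=
      hbint (((hψm' k hkN).sub_const b).pow_const 2) (M := (τ + |b|) ^ 2) fun ω => by
        rw [abs_pow]
        exact pow_le_pow_left₀ (abs_nonneg _) (hψb ω) 2
    have hexp : ∫ ω, D (k + 1) ω ^ 2 ∂P = A + 2 * ∫ ω, D k ω * (ψ k ω - b) ∂P +
        ∫ ω, (ψ k ω - b) ^ 2 ∂P := by
      have h : ∀ ω, D (k + 1) ω ^ 2 = D k ω ^ 2 + 2 * (D k ω * (ψ k ω - b)) +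
          (ψ k ω - b) ^ 2 := fun ω => by
        simp only [hD, Finset.sum_range_succ]
        ring
      simp_rw [h]
      rw [integral_add (hsq.fun_add (hcross.const_mul 2)) hinc,
        integral_add hsq (hcross.const_mul 2),
        integral_const_mul]
    -- Write `ψ - b = (v - b) + (ψ - v)`. The first part is orthogonal to the past, and the second
    -- is at most `v² / τ`, of conditional mean at most `C₀ / τ`; then `E|D| ≤ √A`.
    have hcross_le : ∫ ω, D k ω * (ψ k ω - b) ∂P ≤ C₀ / τ * Real.sqrt A := by
      have h0 := horth k hkN (D k) (hDm k hkN.le) ⟨_, hDbd k⟩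
      have hi0 : Integrable (fun ω => D k ω * (v k ω - b)) P :=
        ((hvint k hkN).sub (integrable_const b)).bdd_mul (c := k * (τ + |b|))
          (hDm' k hkN.le).aestronglyMeasurable (Filter.Eventually.of_forall (hDbd k))
      obtain ⟨hi1, hle⟩ := hv2 k hkN (fun ω => |D k ω|)
        (continuous_abs.measurable.comp (hDm k hkN.le)) (fun ω => abs_nonneg _) (hDabs_int k hkN.le)
      calc ∫ ω, D k ω * (ψ k ω - b) ∂P
          ≤ ∫ ω, (D k ω * (v k ω - b) + 1 / τ * (v k ω ^ 2 * |D k ω|)) ∂P := by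
            refine integral_mono hcross (hi0.add (hi1.const_mul _)) fun ω => ?_
            have h1 := abs_sign_mul_min_sub_le hτ (v k ω)
            have h2 : D k ω * (ψ k ω - v k ω) ≤ |D k ω| * (v k ω ^ 2 / τ) := by
              refine (le_abs_self _).trans ?_
              rw [abs_mul]
              exact mul_le_mul_of_nonneg_left h1 (abs_nonneg _)
            have h3 : |D k ω| * (v k ω ^ 2 / τ) = 1 / τ * (v k ω ^ 2 * |D k ω|) := by ring
            simp only
            nlinarith
        _ = 1 / τ * ∫ ω, v k ω ^ 2 * |D k ω| ∂P := by
            rw [integral_add hi0 (hi1.const_mul _), h0, zero_add, integral_const_mul]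
        _ ≤ 1 / τ * (C₀ * ∫ ω, |D k ω| ∂P) := by gcongr
        _ ≤ 1 / τ * (C₀ * Real.sqrt A) := by
            gcongr
            exact hcs k hkN.le
        _ = _ := by ring
    have hinc_le : ∫ ω, (ψ k ω - b) ^ 2 ∂P ≤ 4 * C₀ := by
      have h2 := (hv2 k hkN (fun _ => 1) measurable_const (by simp) (integrable_const _))
      simp only [mul_one, integral_const, probReal_univ, smul_eq_mul] at h2
      calc ∫ ω, (ψ k ω - b) ^ 2 ∂P ≤ ∫ ω, (2 * v k ω ^ 2 + 2 * b ^ 2) ∂P := by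
            refine integral_mono hinc ((h2.1.const_mul 2).add (integrable_const _)) fun ω => ?_
            have h1 : ψ k ω ^ 2 ≤ v k ω ^ 2 := sq_le_sq.2 (abs_sign_mul_min_le_abs hτ _)
            simp only
            nlinarith [sq_nonneg (ψ k ω + b)]
        _ = 2 * ∫ ω, v k ω ^ 2 ∂P + 2 * b ^ 2 := by
            rw [integral_add (h2.1.const_mul 2) (integrable_const _), integral_const_mul]
            simp
        _ ≤ 4 * C₀ := by linarith [h2.2, hb2 k hkN]
    have hr : Real.sqrt A ≤ k * (C₀ / τ) + Real.sqrt (4 * C₀ * k) :=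
      Real.sqrt_le_iff.2 ⟨by positivity, ih⟩
    have hr0 := Real.sqrt_nonneg A
    have hrA := Real.sq_sqrt hA0
    have hB0 : 0 ≤ C₀ / τ := by positivity
    have hs1 : Real.sqrt (4 * C₀ * k) ^ 2 = 4 * C₀ * k := Real.sq_sqrt (by positivity)
    have hs2 : Real.sqrt (4 * C₀ * (k + 1 : ℕ)) ^ 2 = 4 * C₀ * (k + 1 : ℕ) :=
      Real.sq_sqrt (by positivity)
    have hs3 : Real.sqrt (4 * C₀ * k) ≤ Real.sqrt (4 * C₀ * (k + 1 : ℕ)) :=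
      Real.sqrt_le_sqrt (by push_cast; nlinarith)
    -- The recursion is `A' ≤ A + 2 (C₀/τ) √A + 4 C₀ ≤ (√A + C₀/τ)² + 4 C₀`: the bias adds up
    -- linearly, the fluctuation in squares, which is the form of the claimed bound.
    have hfin : (Real.sqrt A + C₀ / τ) ^ 2 ≤
        ((k + 1 : ℝ) * (C₀ / τ) + Real.sqrt (4 * C₀ * k)) ^ 2 :=
      pow_le_pow_left₀ (by positivity) (by linarith) 2
    have hfin2 : (k + 1 : ℝ) * (C₀ / τ) * Real.sqrt (4 * C₀ * k) ≤
        (k + 1 : ℝ) * (C₀ / τ) * Real.sqrt (4 * C₀ * (k + 1 : ℕ)) :=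
      mul_le_mul_of_nonneg_left hs3 (by positivity)
    rw [hexp]
    push_cast at *
    nlinarith

end IsSampling

end MeanEstimation

/-! ### Samples in a window chosen from earlier data. -/

section LocalAverages

variable {Ω E Λ : Type*}

/-- The indicator that the `i`-th design after `n₀` lies in the section of `U` at the parameter. -/
noncomputable def hit (U : Set (Λ × E)) (l : Ω → Λ) (X : ℕ → Ω → E) (n₀ i : ℕ) (ω : Ω) : ℝ :=
  U.indicator 1 (l ω, X (n₀ + i) ω)

lemma hit_eq_zero_or_one (U : Set (Λ × E)) (l : Ω → Λ) (X : ℕ → Ω → E) (n₀ i : ℕ) (ω : Ω) :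
    hit U l X n₀ i ω = 0 ∨ hit U l X n₀ i ω = 1 := by
  unfold hit
  by_cases h : (l ω, X (n₀ + i) ω) ∈ U
  · right; simp [h]
  · left; simp [h]

lemma hit_nonneg (U : Set (Λ × E)) (l : Ω → Λ) (X : ℕ → Ω → E) (n₀ i : ℕ) (ω : Ω) :
    0 ≤ hit U l X n₀ i ω := by
  rcases hit_eq_zero_or_one U l X n₀ i ω with h | h <;> simp [h]

lemma abs_hit_le_one (U : Set (Λ × E)) (l : Ω → Λ) (X : ℕ → Ω → E) (n₀ i : ℕ) (ω : Ω) :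
    |hit U l X n₀ i ω| ≤ 1 := by
  rcases hit_eq_zero_or_one U l X n₀ i ω with h | h <;> simp [h]

variable {mΩ : MeasurableSpace Ω} [MeasurableSpace E]
  {P : Measure Ω} {ν : Measure E} {σ : ℝ} {F : ℕ → MeasurableSpace Ω} {N : ℕ}
  {X : ℕ → Ω → E} {η : ℕ → Ω → ℝ} {l : Ω → Λ} {U : Set (Λ × E)} {n₀ : ℕ}

/-- The probability that a design lies in the section of `U` at the parameter. -/
noncomputable def hitProb (ν : Measure E) (U : Set (Λ × E)) (a : Λ) : ℝ :=
  ν.real (Prod.mk a ⁻¹' U)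

lemma hitProb_nonneg (a : Λ) : 0 ≤ hitProb ν U a := measureReal_nonneg

variable [MeasurableSpace Λ]

lemma measurable_hitProb [IsProbabilityMeasure ν] (hU : MeasurableSet U) :
    Measurable (hitProb ν U) :=
  (measurable_measure_prodMk_left hU).ennreal_toReal

namespace IsSampling

lemma measurable_hit_sup (hs : IsSampling P ν σ F N X η) (hl : Measurable[F n₀] l)
    (hU : MeasurableSet U) {i : ℕ} (hi : n₀ + i < N) :
    Measurable[F (n₀ + i) ⊔ MeasurableSpace.comap (X (n₀ + i)) inferInstance]
      (hit U l X n₀ i) := by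
  have h1 : Measurable[F (n₀ + i) ⊔ MeasurableSpace.comap (X (n₀ + i)) inferInstance] l :=
    measurable_sup_left (hl.mono (hs.le_of_le (by omega) hi.le) le_rfl)
  have h2 : Measurable[F (n₀ + i) ⊔ MeasurableSpace.comap (X (n₀ + i)) inferInstance]
      (X (n₀ + i)) := measurable_sup_right measurable_id
  exact (measurable_one.indicator hU).comp (h1.prodMk h2)

lemma sup_le_succ (hs : IsSampling P ν σ F N X η) {i : ℕ} (hi : i < N) :
    F i ⊔ MeasurableSpace.comap (X i) inferInstance ≤ F (i + 1) :=
  sup_le (hs.mono i hi) (hs.measurable_design i hi).comap_le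

lemma measurable_hit (hs : IsSampling P ν σ F N X η) (hl : Measurable[F n₀] l)
    (hU : MeasurableSet U) {i : ℕ} (hi : n₀ + i < N) :
    Measurable[F (n₀ + i + 1)] (hit U l X n₀ i) :=
  (hs.measurable_hit_sup hl hU hi).mono (hs.sup_le_succ hi) le_rfl

lemma measurable_hit' (hs : IsSampling P ν σ F N X η) (hl : Measurable[F n₀] l)
    (hU : MeasurableSet U) {i : ℕ} (hi : n₀ + i < N) :
    Measurable (hit U l X n₀ i) :=
  (hs.measurable_hit hl hU hi).mono (hs.le _ hi) le_rfl

variable [IsProbabilityMeasure P]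

/-- The weight and the parameter are both known before sample `n₀ + i` is drawn, so this sample
alone is integrated out with both frozen. -/
lemma lintegral_mul_comp (hs : IsSampling P ν σ F N X η) (hl : Measurable[F n₀] l)
    {i : ℕ} (hi : n₀ + i < N) {k : Ω → ENNReal} (hk : Measurable[F (n₀ + i)] k)
    {Φ : Λ × E → ENNReal} (hΦ : Measurable Φ) :
    ∫⁻ ω, k ω * Φ (l ω, X (n₀ + i) ω) ∂P = ∫⁻ ω, k ω * ∫⁻ x, Φ (l ω, x) ∂ν ∂P := by
  have h := hs.lintegral_comp hi (Z := fun ω => (k ω, l ω))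
    (hk.prodMk (hl.mono (hs.le_of_le (by omega) hi.le) le_rfl))
    (Φ := fun p => p.1.1 * Φ (p.1.2, p.2)) (by fun_prop)
  simp only at h
  rw [h]
  refine lintegral_congr fun ω => ?_
  rw [lintegral_const_mul _ (by fun_prop)]

variable [IsProbabilityMeasure ν]

lemma lintegral_mul_hit (hs : IsSampling P ν σ F N X η) (hl : Measurable[F n₀] l)
    (hU : MeasurableSet U) {i : ℕ} (hi : n₀ + i < N) {k : Ω → ENNReal}
    (hk : Measurable[F (n₀ + i)] k) :
    ∫⁻ ω, k ω * ENNReal.ofReal (hit U l X n₀ i ω) ∂P =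
      ∫⁻ ω, k ω * ENNReal.ofReal (hitProb ν U (l ω)) ∂P := by
  have h := hs.lintegral_mul_comp hl hi hk (Φ := fun p => ENNReal.ofReal (U.indicator 1 p))
    ((measurable_one.indicator hU).ennreal_ofReal)
  unfold hit
  rw [h]
  refine lintegral_congr fun ω => ?_
  congr 1
  have hsec : MeasurableSet (Prod.mk (l ω) ⁻¹' U) := measurable_prodMk_left hU
  rw [hitProb, ofReal_measureReal, ← lintegral_indicator_one hsec]
  refine lintegral_congr fun x => ?_
  by_cases hx : (l ω, x) ∈ U
  · simp [hx]
  · simp [hx]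

lemma lintegral_noise_sq_mul_hit_le (hs : IsSampling P ν σ F N X η) (hl : Measurable[F n₀] l)
    (hU : MeasurableSet U) {i : ℕ} (hi : n₀ + i < N) {k : Ω → ENNReal}
    (hk : Measurable[F (n₀ + i)] k) :
    ∫⁻ ω, k ω * ENNReal.ofReal (hit U l X n₀ i ω * η (n₀ + i) ω ^ 2) ∂P ≤
      ENNReal.ofReal (σ ^ 2) * ∫⁻ ω, k ω * ENNReal.ofReal (hitProb ν U (l ω)) ∂P := by
  rw [← hs.lintegral_mul_hit hl hU hi hk]
  refine le_trans (le_of_eq (lintegral_congr fun ω => ?_))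
    (hs.noise_var _ hi (fun ω => k ω * ENNReal.ofReal (hit U l X n₀ i ω))
      ((measurable_sup_left hk).mul (ENNReal.measurable_ofReal.comp
        (hs.measurable_hit_sup hl hU hi))))
  rw [ENNReal.ofReal_mul (hit_nonneg ..)]
  ring

/-- The number of hits is exponentially unlikely to be small. -/
lemma lintegral_mul_exp_neg_hits_le (hs : IsSampling P ν σ F N X η) (hl : Measurable[F n₀] l)
    (hU : MeasurableSet U) {n : ℕ} (hn : n₀ + n ≤ N) {k : Ω → ENNReal} (hk : Measurable[F n₀] k) :
    ∫⁻ ω, k ω * ENNReal.ofReal (Real.exp (-∑ i ∈ Finset.range n, hit U l X n₀ i ω)) ∂P ≤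
      ∫⁻ ω, k ω * ENNReal.ofReal (Real.exp (-(0.6 * (n * hitProb ν U (l ω))))) ∂P := by
  -- The weight varies because the factor produced by the last sample is moved into it before the
  -- induction hypothesis is applied.
  induction n generalizing k with
  | zero => simp
  | succ n ih =>
    have hi : n₀ + n < N := by omega
    have hk' : Measurable[F (n₀ + n)] fun ω => k ω *
        ENNReal.ofReal (Real.exp (-∑ i ∈ Finset.range n, hit U l X n₀ i ω)) := by
      refine (hk.mono (hs.le_of_le (by omega) hi.le) le_rfl).mul (ENNReal.measurable_ofReal.comp
        (Real.measurable_exp.comp (Measurable.neg (Finset.measurable_sum _ fun i hi' => ?_))))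
      have := Finset.mem_range.1 hi'
      exact (hs.measurable_hit hl hU (by omega)).mono (hs.le_of_le (by omega) hi.le) le_rfl
    have h1 := hs.lintegral_mul_comp hl hi hk'
      (Φ := fun p => ENNReal.ofReal (Real.exp (-(U.indicator 1 p))))
      (by have := (measurable_one (α := ℝ)).indicator hU; fun_prop)
    have hq : Measurable[F n₀] fun ω => hitProb ν U (l ω) := (measurable_hitProb hU).comp hl
    have h2 : ∀ a : Λ, ∫⁻ x, ENNReal.ofReal (Real.exp (-(U.indicator 1 (a, x)))) ∂ν ≤
        ENNReal.ofReal (Real.exp (-(0.6 * hitProb ν U a))) := by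
      intro a
      have hsec : MeasurableSet (Prod.mk a ⁻¹' U) := measurable_prodMk_left hU
      have e1 : ∀ x, Real.exp (-(U.indicator 1 (a, x))) =
          1 - (1 - Real.exp (-1)) * (Prod.mk a ⁻¹' U).indicator 1 x := by
        intro x
        by_cases hx : (a, x) ∈ U
        · simp [hx]
        · simp [hx]
      have hint : Integrable (fun x => (Prod.mk a ⁻¹' U).indicator (1 : E → ℝ) x) ν :=
        (integrable_const (1 : ℝ)).indicator hsec
      have hint2 : Integrable
          (fun x => 1 - (1 - Real.exp (-1)) * (Prod.mk a ⁻¹' U).indicator (1 : E → ℝ) x) ν :=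
        (integrable_const _).sub (hint.const_mul _)
      have e2 : ∫ x, (1 - (1 - Real.exp (-1)) * (Prod.mk a ⁻¹' U).indicator (1 : E → ℝ) x) ∂ν =
          1 - (1 - Real.exp (-1)) * hitProb ν U a := by
        rw [integral_sub (integrable_const _) (hint.const_mul _), integral_const_mul,
          integral_indicator_one hsec]
        simp [hitProb]
      simp_rw [e1]
      rw [← ofReal_integral_eq_lintegral_ofReal hint2
        (Filter.Eventually.of_forall fun x => by
          simp only [← e1, Pi.zero_apply]
          exact (Real.exp_pos _).le), e2]
      refine ENNReal.ofReal_le_ofReal ?_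
      have h3 := Real.add_one_le_exp (-(0.6 * hitProb ν U a))
      -- Hence `1 - (1 - e⁻¹) q ≤ 1 - 0.6 q ≤ exp (-0.6 q)`. What matters later is that `0.6`
      -- exceeds `1/2`.
      have h4 : Real.exp (-1) ≤ 0.4 := by
        rw [Real.exp_neg]
        have := Real.exp_one_gt_d9
        rw [inv_le_comm₀ (by positivity) (by norm_num)]
        norm_num
        linarith
      nlinarith [hitProb_nonneg (ν := ν) (U := U) a]
    calc ∫⁻ ω, k ω * ENNReal.ofReal (Real.exp (-∑ i ∈ Finset.range (n + 1), hit U l X n₀ i ω)) ∂P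
        = ∫⁻ ω, k ω * ENNReal.ofReal (Real.exp (-∑ i ∈ Finset.range n, hit U l X n₀ i ω)) *
            ENNReal.ofReal (Real.exp (-(U.indicator 1 (l ω, X (n₀ + n) ω)))) ∂P := by
          refine lintegral_congr fun ω => ?_
          rw [mul_assoc, ← ENNReal.ofReal_mul (Real.exp_pos _).le, ← Real.exp_add,
            Finset.sum_range_succ, neg_add]
          rfl
      _ ≤ ∫⁻ ω, k ω * ENNReal.ofReal (Real.exp (-∑ i ∈ Finset.range n, hit U l X n₀ i ω)) *
            ENNReal.ofReal (Real.exp (-(0.6 * hitProb ν U (l ω)))) ∂P := by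
          rw [h1]
          exact lintegral_mono fun ω => by gcongr; exact h2 _
      _ = ∫⁻ ω, (k ω * ENNReal.ofReal (Real.exp (-(0.6 * hitProb ν U (l ω))))) *
            ENNReal.ofReal (Real.exp (-∑ i ∈ Finset.range n, hit U l X n₀ i ω)) ∂P :=
          lintegral_congr fun ω => by ring
      _ ≤ ∫⁻ ω, (k ω * ENNReal.ofReal (Real.exp (-(0.6 * hitProb ν U (l ω))))) *
            ENNReal.ofReal (Real.exp (-(0.6 * (n * hitProb ν U (l ω))))) ∂P :=
          ih (by omega) (hk.mul (ENNReal.measurable_ofReal.comp (Real.measurable_exp.comp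
            (hq.const_mul 0.6).neg)))
      _ = _ := by
          refine lintegral_congr fun ω => ?_
          rw [mul_assoc, ← ENNReal.ofReal_mul (Real.exp_pos _).le, ← Real.exp_add]
          push_cast
          ring_nf

/-- The local noise sums have orthogonal increments. -/
lemma lintegral_mul_sq_noise_sum_le (hs : IsSampling P ν σ F N X η) (hl : Measurable[F n₀] l)
    (hU : MeasurableSet U) {n : ℕ} (hn : n₀ + n ≤ N) {k : Ω → ENNReal} (hk : Measurable[F n₀] k) :
    ∫⁻ ω, k ω * ENNReal.ofReal
        ((∑ i ∈ Finset.range n, hit U l X n₀ i ω * η (n₀ + i) ω) ^ 2) ∂P ≤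
      ENNReal.ofReal (σ ^ 2) * ∫⁻ ω, k ω * ENNReal.ofReal (n * hitProb ν U (l ω)) ∂P := by
  set M : ℕ → Ω → ℝ := fun n ω => ∑ i ∈ Finset.range n, hit U l X n₀ i ω * η (n₀ + i) ω with hM
  have hn₀ : F n₀ ≤ mΩ := hs.le _ (by omega)
  have hq : Measurable fun ω => hitProb ν U (l ω) :=
    (measurable_hitProb hU).comp (hl.mono hn₀ le_rfl)
  have hterm : ∀ i, n₀ + i < N → MemLp (fun ω => hit U l X n₀ i ω * η (n₀ + i) ω) 2 P := by
    intro i hi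
    exact (hs.noise_memLp _ hi).of_le_mul (c := 1)
      ((hs.measurable_hit' hl hU hi).mul (hs.measurable_noise' hi)).aestronglyMeasurable
      (Filter.Eventually.of_forall fun ω => by
        rw [norm_mul]
        exact mul_le_mul_of_nonneg_right (abs_hit_le_one ..) (norm_nonneg _))
  have hML : ∀ n, n₀ + n ≤ N → MemLp (M n) 2 P := fun n hn =>
    memLp_finsetSum _ fun i hi => hterm i (by have := Finset.mem_range.1 hi; omega)
  have hMm : ∀ n, n₀ + n ≤ N → Measurable[F (n₀ + n)] (M n) := fun n hn => by
    refine Finset.measurable_sum _ fun i hi => ?_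
    have := Finset.mem_range.1 hi
    exact ((hs.measurable_hit hl hU (by omega)).mono (hs.le_of_le (by omega) hn) le_rfl).mul
      ((hs.measurable_noise _ (by omega)).mono (hs.le_of_le (by omega) hn) le_rfl)
  -- An arbitrary weight could destroy the integrability of the cross terms, so orthogonality is
  -- used on sets of `F n₀` only, and the resulting inequality is extended to weights afterwards.
  have hset : ∀ A, MeasurableSet[F n₀] A → ∀ n, n₀ + n ≤ N →
      ∫⁻ ω in A, ENNReal.ofReal (M n ω ^ 2) ∂P ≤
        ∫⁻ ω in A, ENNReal.ofReal (σ ^ 2) * ENNReal.ofReal (n * hitProb ν U (l ω)) ∂P := by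
    intro A hA n hn
    have hA' : MeasurableSet A := hn₀ A hA
    induction n with
    | zero => simp [hM]
    | succ n ih =>
      have hi : n₀ + n < N := by omega
      have ih := ih hi.le
      have hsq := (hML n hi.le).integrable_sq
      have htsq := (hterm n hi).integrable_sq
      have hcr : Integrable (fun ω => M n ω * (hit U l X n₀ n ω * η (n₀ + n) ω)) P :=
        (hML n hi.le).integrable_mul (hterm n hi)
      -- The event, the earlier noise sum and the new indicator are all determined by the past and
      -- the new design, given which the new noise is centered.
      have hzero : ∫ ω in A, M n ω * (hit U l X n₀ n ω * η (n₀ + n) ω) ∂P = 0 := by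
        rw [← integral_indicator hA']
        have hAm : Measurable[F (n₀ + n)] (A.indicator (M n)) :=
          (hMm n hi.le).indicator (hs.le_of_le (by omega) hi.le A hA)
        have e : ∀ ω, A.indicator (fun ω => M n ω * (hit U l X n₀ n ω * η (n₀ + n) ω)) ω =
            η (n₀ + n) ω * (A.indicator (M n) ω * hit U l X n₀ n ω) := by
          intro ω
          by_cases hω : ω ∈ A
          · simp only [Set.indicator_of_mem hω]; ring
          · simp [hω]
        simp_rw [e]
        refine hs.noise_mean _ hi _ ((measurable_sup_left hAm).mul
          (hs.measurable_hit_sup hl hU hi)) ?_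
        simp_rw [← e]
        exact hcr.indicator hA'
      have hexp : ∫⁻ ω in A, ENNReal.ofReal (M (n + 1) ω ^ 2) ∂P =
          ∫⁻ ω in A, ENNReal.ofReal (M n ω ^ 2) ∂P +
          ∫⁻ ω in A, ENNReal.ofReal ((hit U l X n₀ n ω * η (n₀ + n) ω) ^ 2) ∂P := by
        rw [← ofReal_integral_eq_lintegral_ofReal hsq.integrableOn
            (Filter.Eventually.of_forall fun ω => sq_nonneg _),
          ← ofReal_integral_eq_lintegral_ofReal htsq.integrableOn
            (Filter.Eventually.of_forall fun ω => sq_nonneg _),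
          ← ofReal_integral_eq_lintegral_ofReal (hML (n + 1) hn).integrable_sq.integrableOn
            (Filter.Eventually.of_forall fun ω => sq_nonneg _),
          ← ENNReal.ofReal_add (integral_nonneg fun ω => sq_nonneg _)
            (integral_nonneg fun ω => sq_nonneg _)]
        congr 1
        have e : ∀ ω, M (n + 1) ω ^ 2 = M n ω ^ 2 +
            2 * (M n ω * (hit U l X n₀ n ω * η (n₀ + n) ω)) +
            (hit U l X n₀ n ω * η (n₀ + n) ω) ^ 2 := fun ω => by
          simp only [hM, Finset.sum_range_succ]
          ring
        simp_rw [e]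
        rw [integral_add (hsq.fun_add (hcr.const_mul 2)).integrableOn htsq.integrableOn,
          integral_add hsq.integrableOn (hcr.const_mul 2).integrableOn, integral_const_mul,
          hzero]
        ring
      have hlast : ∫⁻ ω in A, ENNReal.ofReal ((hit U l X n₀ n ω * η (n₀ + n) ω) ^ 2) ∂P ≤
          ∫⁻ ω in A, ENNReal.ofReal (σ ^ 2) * ENNReal.ofReal (hitProb ν U (l ω)) ∂P := by
        have h1 := hs.lintegral_noise_sq_mul_hit_le hl hU hi (k := A.indicator 1)
          (Measurable.indicator (by exact measurable_const) (hs.le_of_le (by omega) hi.le A hA))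
        rw [← lintegral_indicator hA', ← lintegral_indicator hA']
        calc ∫⁻ ω, A.indicator (fun ω => ENNReal.ofReal
                ((hit U l X n₀ n ω * η (n₀ + n) ω) ^ 2)) ω ∂P
            = ∫⁻ ω, A.indicator 1 ω * ENNReal.ofReal
                (hit U l X n₀ n ω * η (n₀ + n) ω ^ 2) ∂P := by
              refine lintegral_congr fun ω => ?_
              have : (hit U l X n₀ n ω * η (n₀ + n) ω) ^ 2 =
                  hit U l X n₀ n ω * η (n₀ + n) ω ^ 2 := by
                rcases hit_eq_zero_or_one U l X n₀ n ω with h | h <;> simp [h]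
              rw [← this]
              by_cases hω : ω ∈ A <;> simp [hω]
          _ ≤ _ := h1
          _ = _ := by
              rw [← lintegral_const_mul _ (by
                have := (measurable_one (α := ENNReal) (β := Ω)).indicator hA'
                fun_prop)]
              refine lintegral_congr fun ω => ?_
              by_cases hω : ω ∈ A <;> simp [hω]
      rw [hexp]
      refine (add_le_add ih hlast).trans ?_
      rw [← lintegral_add_left (by fun_prop)]
      refine lintegral_mono fun ω => ?_
      rw [← mul_add, ← ENNReal.ofReal_add (mul_nonneg (Nat.cast_nonneg _) (hitProb_nonneg _))
        (hitProb_nonneg _)]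
      push_cast
      exact le_of_eq (by ring_nf)
  have h := lintegral_mul_le_of_setLIntegral_le hn₀
    (((hMm n hn).mono (hs.le _ hn) le_rfl).pow_const 2).ennreal_ofReal
    (g := fun ω => ENNReal.ofReal (σ ^ 2) * ENNReal.ofReal (n * hitProb ν U (l ω)))
    (by fun_prop) (fun A hA => hset A hA n hn) hk
  have hk' : Measurable k := hk.mono hn₀ le_rfl
  rw [← lintegral_const_mul _ (by fun_prop)]
  calc _ = _ := lintegral_congr fun ω => mul_comm _ _
    _ ≤ _ := h
    _ = _ := lintegral_congr fun ω => by ring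

end IsSampling

end LocalAverages

/-! ### Error of a local average at a fixed point. -/

section LocalRegression

/-- Deterministic error bound for a local average with `0`-`1` weights, where `r` stands for the
expected number of points in the window and `ρ` balances bias and noise. -/
lemma abs_local_average_sub_le {ι : Type*} {s : Finset ι} {w f η A : ι → ℝ} {L y a r ρ : ℝ}
    (hw : ∀ i ∈ s, w i = 0 ∨ w i = 1) (hf : ∀ i ∈ s, |f i| ≤ L) (hy : |y| ≤ L)
    (hA : ∀ i ∈ s, w i = 1 → |f i - y| ≤ a + A i) (ha : 0 ≤ a) (hA0 : ∀ i ∈ s, 0 ≤ A i)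
    (hr : 0 < r) (hρ : 0 < ρ) :
    |(∑ i ∈ s, w i * (f i + η i)) / (∑ i ∈ s, w i) - y| ≤
      (2 * L + r ^ 3 / (4 * ρ)) * Real.exp (r / 2) * Real.exp (-∑ i ∈ s, w i) + a +
        2 / r * ∑ i ∈ s, w i * A i + ρ / r ^ 2 * (∑ i ∈ s, w i * η i) ^ 2 + 1 / ρ +
        ρ / (2 * r ^ 2) * ∑ i ∈ s, w i * η i ^ 2 := by
  set n := ∑ i ∈ s, w i with hn
  set M := ∑ i ∈ s, w i * η i with hM
  have hw0 : ∀ i ∈ s, 0 ≤ w i := fun i hi => by rcases hw i hi with h | h <;> simp [h]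
  have hL : 0 ≤ L := (abs_nonneg y).trans hy
  have hn0 : 0 ≤ n := Finset.sum_nonneg hw0
  have hSA : 0 ≤ ∑ i ∈ s, w i * A i :=
    Finset.sum_nonneg fun i hi => mul_nonneg (hw0 i hi) (hA0 i hi)
  have hSη : 0 ≤ ∑ i ∈ s, w i * η i ^ 2 :=
    Finset.sum_nonneg fun i hi => mul_nonneg (hw0 i hi) (sq_nonneg _)
  have hexp : Real.exp (r / 2) * Real.exp (-n) = Real.exp (r / 2 - n) := by
    rw [← Real.exp_add, sub_eq_add_neg]
  rw [mul_assoc, hexp]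
  have t1 : 0 ≤ 2 * L * Real.exp (r / 2 - n) := by positivity
  have t2 : 0 ≤ r ^ 3 / (4 * ρ) * Real.exp (r / 2 - n) := by positivity
  have t3 : 0 ≤ 2 / r * ∑ i ∈ s, w i * A i := by positivity
  have t4 : 0 ≤ ρ / r ^ 2 * M ^ 2 := by positivity
  have t5 : 0 ≤ 1 / ρ := by positivity
  have t6 : 0 ≤ ρ / (2 * r ^ 2) * ∑ i ∈ s, w i * η i ^ 2 := by positivity
  rw [add_mul]
  -- In an empty window the quotient is `0 / 0 = 0`, with error `|y| ≤ L`; the exponential factor is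
  -- then at least `1` and pays for it.
  rcases hn0.eq_or_lt with hz | hpos
  · rw [← hz, div_zero, zero_sub, abs_neg]
    rw [← hz] at t2
    have : 1 ≤ Real.exp (r / 2 - 0) := Real.one_le_exp (by linarith)
    nlinarith
  have hdec : (∑ i ∈ s, w i * (f i + η i)) / n - y = (∑ i ∈ s, w i * (f i - y)) / n + M / n := by
    have : ∑ i ∈ s, w i * (f i + η i) = ∑ i ∈ s, w i * (f i - y) + M + n * y := by
      rw [hM, hn, Finset.sum_mul, ← Finset.sum_add_distrib, ← Finset.sum_add_distrib]
      exact Finset.sum_congr rfl fun i _ => by ring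
    rw [this]
    field_simp
    ring
  rw [hdec]
  refine (abs_add_le _ _).trans ?_
  rw [abs_div, abs_div, abs_of_pos hpos]
  have hb1 : |∑ i ∈ s, w i * (f i - y)| ≤ a * n + ∑ i ∈ s, w i * A i := by
    refine (Finset.abs_sum_le_sum_abs _ _).trans ?_
    rw [hn, Finset.mul_sum, ← Finset.sum_add_distrib]
    refine Finset.sum_le_sum fun i hi => ?_
    rcases hw i hi with h | h
    · simp [h]
    · simpa [h] using hA i hi h
  -- Either the window holds at least half its expected number of points, and `1/n` may be replaced
  -- by `2/r`, or `exp (r/2 - n) ≥ 1` and this factor absorbs a crude bound.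
  rcases le_or_gt (r / 2) n with hgood | hbad
  · have hinv : 1 / n ≤ 2 / r := by
      rw [div_le_div_iff₀ hpos hr]
      linarith
    have h1 : |∑ i ∈ s, w i * (f i - y)| / n ≤ a + 2 / r * ∑ i ∈ s, w i * A i := by
      calc |∑ i ∈ s, w i * (f i - y)| / n ≤ (a * n + ∑ i ∈ s, w i * A i) / n := by gcongr
        _ = a + 1 / n * ∑ i ∈ s, w i * A i := by field_simp
        _ ≤ _ := by gcongr
    -- The arithmetic-geometric mean inequality trades `|M|` for `M²`, whose expectation is
    -- accessible. The balance `ρ` stays free so that it can later depend on the evaluation point.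
    have h2 : |M| / n ≤ ρ / r ^ 2 * M ^ 2 + 1 / ρ := by
      calc |M| / n = 1 / n * |M| := by ring
        _ ≤ 2 / r * |M| := by gcongr
        _ ≤ ρ / r ^ 2 * M ^ 2 + 1 / ρ := by
          have : 0 ≤ ρ * (|M| / r - 1 / ρ) ^ 2 := by positivity
          have e : ρ * (|M| / r - 1 / ρ) ^ 2 =
              ρ / r ^ 2 * M ^ 2 + 1 / ρ - 2 / r * |M| := by
            rw [← sq_abs M]
            field_simp
            ring
          linarith
    linarith
  · have hone : 1 ≤ Real.exp (r / 2 - n) := Real.one_le_exp (by linarith)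
    have hn1 : 1 ≤ n := by
      obtain ⟨i, hi, hwi⟩ := Finset.exists_ne_zero_of_sum_ne_zero hpos.ne'
      have : w i = 1 := (hw i hi).resolve_left hwi
      rw [← this]
      exact Finset.single_le_sum hw0 hi
    have h1 : |∑ i ∈ s, w i * (f i - y)| / n ≤ 2 * L * Real.exp (r / 2 - n) := by
      have : |∑ i ∈ s, w i * (f i - y)| ≤ 2 * L * n := by
        refine (Finset.abs_sum_le_sum_abs _ _).trans ?_
        rw [hn, Finset.mul_sum]
        refine Finset.sum_le_sum fun i hi => ?_
        rw [abs_mul, abs_of_nonneg (hw0 i hi), mul_comm]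
        refine mul_le_mul_of_nonneg_right ?_ (hw0 i hi)
        have := abs_sub (f i) y
        linarith [hf i hi]
      rw [div_le_iff₀ hpos]
      nlinarith [mul_nonneg (mul_nonneg (by norm_num : (0:ℝ) ≤ 2) hL) hn0]
    have h2 : |M| / n ≤ r ^ 3 / (4 * ρ) * Real.exp (r / 2 - n) +
        ρ / (2 * r ^ 2) * ∑ i ∈ s, w i * η i ^ 2 := by
      calc |M| / n ≤ |M| := div_le_self (abs_nonneg _) hn1
        _ ≤ ∑ i ∈ s, w i * |η i| := by
          refine (Finset.abs_sum_le_sum_abs _ _).trans (le_of_eq ?_)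
          exact Finset.sum_congr rfl fun i hi => by rw [abs_mul, abs_of_nonneg (hw0 i hi)]
        _ ≤ ∑ i ∈ s, (r ^ 2 / (2 * ρ) * w i + ρ / (2 * r ^ 2) * (w i * η i ^ 2)) := by
          refine Finset.sum_le_sum fun i hi => ?_
          -- The constant part, summed over fewer than `r / 2` points, is at most `r³ / (4 ρ)`; the
          -- exponential factor makes it negligible on average.
          have h3 : |η i| ≤ r ^ 2 / (2 * ρ) + ρ / (2 * r ^ 2) * η i ^ 2 := by
            have : 0 ≤ ρ / (2 * r ^ 2) * (|η i| - r ^ 2 / ρ) ^ 2 := by positivity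
            have e : ρ / (2 * r ^ 2) * (|η i| - r ^ 2 / ρ) ^ 2 =
                r ^ 2 / (2 * ρ) + ρ / (2 * r ^ 2) * η i ^ 2 - |η i| := by
              rw [← sq_abs (η i)]
              field_simp
              ring
            linarith
          calc w i * |η i| ≤ w i * (r ^ 2 / (2 * ρ) + ρ / (2 * r ^ 2) * η i ^ 2) :=
                mul_le_mul_of_nonneg_left h3 (hw0 i hi)
            _ = _ := by ring
        _ = r ^ 2 / (2 * ρ) * n + ρ / (2 * r ^ 2) * ∑ i ∈ s, w i * η i ^ 2 := by
          rw [Finset.sum_add_distrib, ← Finset.mul_sum, ← Finset.mul_sum]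
        _ ≤ r ^ 2 / (2 * ρ) * (r / 2) + ρ / (2 * r ^ 2) * ∑ i ∈ s, w i * η i ^ 2 := by gcongr
        _ = r ^ 3 / (4 * ρ) + ρ / (2 * r ^ 2) * ∑ i ∈ s, w i * η i ^ 2 := by
          congr 1
          field_simp
          ring
        _ ≤ _ := by
          gcongr
          exact le_mul_of_one_le_right (by positivity) hone
    linarith

/-- Absorbs the probability of a sparse window into the noise bound for every balance: if `ρ ≤ 1`
the term `1/ρ` suffices, and otherwise `exp (-0.1 r) ≤ 10/r ≤ 10 ρ/r`. -/
lemma exp_neg_le_balance {r ρ : ℝ} (hr : 0 < r) (hρ : 0 < ρ) :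
    Real.exp (-(0.1 * r)) ≤ 10 * (1 / ρ + ρ / r) := by
  have h1 : Real.exp (-(0.1 * r)) ≤ 1 := Real.exp_le_one_iff.2 (by linarith)
  have h2 : Real.exp (-(0.1 * r)) ≤ 10 / r := by
    rw [Real.exp_neg]
    refine (inv_anti₀ (by positivity) ((by linarith : 0.1 * r ≤ 0.1 * r + 1).trans
      (Real.add_one_le_exp (0.1 * r)))).trans (le_of_eq ?_)
    field_simp
    norm_num
  rcases le_or_gt ρ 1 with h | h
  · have h3 : 1 ≤ 1 / ρ := by rw [le_div_iff₀ hρ]; linarith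
    have : 0 < ρ / r := by positivity
    linarith
  · have h3 : 1 / r ≤ ρ / r := by gcongr
    have h4 : 0 < 1 / ρ := by positivity
    have h5 : 10 / r = 10 * (1 / r) := by ring
    linarith

/-- The cubic term of the exponential series gives `(0.1 r)³ / 6 ≤ exp (0.1 r)`, whence `6000`. -/
lemma cube_mul_exp_neg_le {r : ℝ} (hr : 0 < r) : r ^ 3 * Real.exp (-(0.1 * r)) ≤ 6000 := by
  have h := Real.pow_div_factorial_le_exp (0.1 * r) (by positivity) 3
  rw [Real.exp_neg, ← div_eq_mul_inv, div_le_iff₀ (Real.exp_pos _)]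
  norm_num [Nat.factorial] at h
  nlinarith

variable {Ω E Λ : Type*} {mΩ : MeasurableSpace Ω} [MeasurableSpace E] [MeasurableSpace Λ]
  {P : Measure Ω} [IsProbabilityMeasure P] {ν : Measure E} [IsProbabilityMeasure ν] {σ : ℝ}
  {F : ℕ → MeasurableSpace Ω} {N : ℕ} {X : ℕ → Ω → E} {η : ℕ → Ω → ℝ} {l : Ω → Λ}
  {U : Set (Λ × E)} {n₀ : ℕ}

/-- Expected error at a fixed point of a local average over a window that depends on a parameter
estimated from earlier samples. -/
lemma IsSampling.lintegral_local_average_sub_le (hs : IsSampling P ν σ F N X η)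
    (hl : Measurable[F n₀] l) (hU : MeasurableSet U) {n : ℕ} (hn : n₀ + n ≤ N) (hn1 : 1 ≤ n)
    {f : E → ℝ} {L y : ℝ} (hf : ∀ x, |f x| ≤ L) (hy : |y| ≤ L)
    {a : Λ → ℝ} (ha : Measurable a) (ha0 : ∀ t, 0 ≤ a t)
    {A : Λ × E → ℝ} (hAm : Measurable A) (hA0 : ∀ t, 0 ≤ A t)
    (hA : ∀ t x, (t, x) ∈ U → |f x - y| ≤ a t + A (t, x))
    {ρ : Λ → ℝ} (hρm : Measurable ρ) (hρ : ∀ t, 0 < ρ t) :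
    ∫⁻ ω, ENNReal.ofReal |(∑ i ∈ Finset.range n,
        hit U l X n₀ i ω * (f (X (n₀ + i) ω) + η (n₀ + i) ω)) /
          (∑ i ∈ Finset.range n, hit U l X n₀ i ω) - y| ∂P ≤
      ∫⁻ ω, (ENNReal.ofReal (a (l ω)) + 2 * (ENNReal.ofReal (hitProb ν U (l ω)))⁻¹ *
          ∫⁻ x, ENNReal.ofReal (U.indicator A (l ω, x)) ∂ν +
        ENNReal.ofReal (20 * L + 1502 + 2 * σ ^ 2) * (ENNReal.ofReal (1 / ρ (l ω)) +
          ENNReal.ofReal (ρ (l ω)) * (ENNReal.ofReal (n * hitProb ν U (l ω)))⁻¹)) ∂P := by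
  have hL : 0 ≤ L := (abs_nonneg y).trans hy
  have hn₀ : F n₀ ≤ mΩ := hs.le _ (by omega)
  have hlm : Measurable l := hl.mono hn₀ le_rfl
  have hqm : Measurable (hitProb ν U) := measurable_hitProb hU
  set r : Λ → ℝ := fun t => n * hitProb ν U t with hr
  have hrm : Measurable r := by fun_prop
  have hr0 : ∀ t, 0 ≤ r t := fun t => mul_nonneg (Nat.cast_nonneg _) (hitProb_nonneg _)
  set kE : Λ → ENNReal := fun t =>
    ENNReal.ofReal ((2 * L + r t ^ 3 / (4 * ρ t)) * Real.exp (r t / 2)) with hkE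
  set kA : Λ → ENNReal := fun t => ENNReal.ofReal (2 / r t) with hkA
  set kM : Λ → ENNReal := fun t => ENNReal.ofReal (ρ t / r t ^ 2) with hkM
  set kN : Λ → ENNReal := fun t => ENNReal.ofReal (ρ t / (2 * r t ^ 2)) with hkN
  have hkEm : Measurable kE := by fun_prop
  have hkAm : Measurable kA := by fun_prop
  have hkMm : Measurable kM := by fun_prop
  have hkNm : Measurable kN := by fun_prop
  have hUA : Measurable (U.indicator A) := hAm.indicator hU
  have hUA0 : ∀ p, 0 ≤ U.indicator A p := fun p => Set.indicator_nonneg (fun _ _ => hA0 _) _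
  have hhit : ∀ i < n, Measurable (hit U l X n₀ i) := fun i hi =>
    hs.measurable_hit' hl hU (by omega)
  have hXm : ∀ i < n, Measurable (X (n₀ + i)) := fun i hi => hs.measurable_design' (by omega)
  have hηm : ∀ i < n, Measurable (η (n₀ + i)) := fun i hi => hs.measurable_noise' (by omega)
  have hsumhit : Measurable fun ω => ∑ i ∈ Finset.range n, hit U l X n₀ i ω :=
    Finset.measurable_sum _ fun i hi => hhit i (Finset.mem_range.1 hi)
  have hsumM : Measurable fun ω => ∑ i ∈ Finset.range n, hit U l X n₀ i ω * η (n₀ + i) ω :=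
    Finset.measurable_sum _ fun i hi => (hhit i (Finset.mem_range.1 hi)).mul
      (hηm i (Finset.mem_range.1 hi))
  -- pointwise bound
  have hpt : ∀ ω, ENNReal.ofReal |(∑ i ∈ Finset.range n,
        hit U l X n₀ i ω * (f (X (n₀ + i) ω) + η (n₀ + i) ω)) /
          (∑ i ∈ Finset.range n, hit U l X n₀ i ω) - y| ≤
      kE (l ω) * ENNReal.ofReal (Real.exp (-∑ i ∈ Finset.range n, hit U l X n₀ i ω)) +
      ENNReal.ofReal (a (l ω)) +
      ∑ i ∈ Finset.range n, kA (l ω) * ENNReal.ofReal (U.indicator A (l ω, X (n₀ + i) ω)) +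
      kM (l ω) * ENNReal.ofReal
        ((∑ i ∈ Finset.range n, hit U l X n₀ i ω * η (n₀ + i) ω) ^ 2) +
      ENNReal.ofReal (1 / ρ (l ω)) +
      ∑ i ∈ Finset.range n, kN (l ω) *
        ENNReal.ofReal (hit U l X n₀ i ω * η (n₀ + i) ω ^ 2) +
      ENNReal.ofReal (ρ (l ω)) * (ENNReal.ofReal (r (l ω)))⁻¹ := by
    intro ω
    -- For a window of mass zero the last summand is `∞`, since the inverse of `0` in `ENNReal` is
    -- `∞`. It was added to the bound to make this case trivial.
    rcases (hr0 (l ω)).eq_or_lt with h0 | hpos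
    · rw [← h0, ENNReal.ofReal_zero, ENNReal.inv_zero, ENNReal.mul_top
        (by simpa using hρ (l ω)), add_top]
      exact le_top
    have hρω := hρ (l ω)
    refine le_trans (ENNReal.ofReal_le_ofReal (abs_local_average_sub_le
      (A := fun i => A (l ω, X (n₀ + i) ω)) (a := a (l ω))
      (fun i _ => hit_eq_zero_or_one ..) (fun i _ => hf _) hy ?_ (ha0 _) (fun i _ => hA0 _)
      hpos hρω)) (le_trans ?_ le_self_add)
    · intro i _ hi
      refine hA _ _ ?_
      by_contra hmem
      simp [hit, hmem] at hi
    have e1 : ∑ i ∈ Finset.range n, kA (l ω) *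
        ENNReal.ofReal (U.indicator A (l ω, X (n₀ + i) ω)) =
        ENNReal.ofReal (2 / r (l ω) * ∑ i ∈ Finset.range n,
          hit U l X n₀ i ω * A (l ω, X (n₀ + i) ω)) := by
      rw [← Finset.mul_sum, ENNReal.ofReal_mul (by positivity), ENNReal.ofReal_sum_of_nonneg
        (fun i _ => mul_nonneg (hit_nonneg ..) (hA0 _))]
      congr 1
      refine Finset.sum_congr rfl fun i _ => ?_
      congr 1
      by_cases hmem : (l ω, X (n₀ + i) ω) ∈ U <;> simp [hit, hmem]
    have e2 : ∑ i ∈ Finset.range n, kN (l ω) *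
        ENNReal.ofReal (hit U l X n₀ i ω * η (n₀ + i) ω ^ 2) =
        ENNReal.ofReal (ρ (l ω) / (2 * r (l ω) ^ 2) * ∑ i ∈ Finset.range n,
          hit U l X n₀ i ω * η (n₀ + i) ω ^ 2) := by
      rw [← Finset.mul_sum, ENNReal.ofReal_mul (by positivity), ENNReal.ofReal_sum_of_nonneg
        (fun i _ => mul_nonneg (hit_nonneg ..) (sq_nonneg _))]
    rw [e1, e2, hkE, hkM, ← ENNReal.ofReal_mul (by positivity),
      ← ENNReal.ofReal_mul (by positivity)]
    refine ENNReal.ofReal_add_le.trans (add_le_add_left ?_ _)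
    refine ENNReal.ofReal_add_le.trans (add_le_add_left ?_ _)
    refine ENNReal.ofReal_add_le.trans (add_le_add_left ?_ _)
    refine ENNReal.ofReal_add_le.trans (add_le_add_left ?_ _)
    exact ENNReal.ofReal_add_le
  refine (lintegral_mono hpt).trans ?_
  have htA : ∀ i < n, Measurable fun ω =>
      kA (l ω) * ENNReal.ofReal (U.indicator A (l ω, X (n₀ + i) ω)) := fun i hi =>
    (hkAm.comp hlm).mul (hUA.comp (hlm.prodMk (hXm i hi))).ennreal_ofReal
  have htN : ∀ i < n, Measurable fun ω => kN (l ω) *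
      ENNReal.ofReal (hit U l X n₀ i ω * η (n₀ + i) ω ^ 2) := fun i hi =>
    (hkNm.comp hlm).mul ((hhit i hi).mul ((hηm i hi).pow_const 2)).ennreal_ofReal
  have hsumA : Measurable fun ω => ∑ i ∈ Finset.range n,
      kA (l ω) * ENNReal.ofReal (U.indicator A (l ω, X (n₀ + i) ω)) :=
    Finset.measurable_sum _ fun i hi => htA i (Finset.mem_range.1 hi)
  have hsumN : Measurable fun ω => ∑ i ∈ Finset.range n, kN (l ω) *
        ENNReal.ofReal (hit U l X n₀ i ω * η (n₀ + i) ω ^ 2) :=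
    Finset.measurable_sum _ fun i hi => htN i (Finset.mem_range.1 hi)
  have hI : Measurable fun ω => ∫⁻ x, ENNReal.ofReal (U.indicator A (l ω, x)) ∂ν :=
    (Measurable.lintegral_prod_right' hUA.ennreal_ofReal).comp hlm
  rw [lintegral_add_right _ (by fun_prop), lintegral_add_right _ hsumN,
    lintegral_add_right _ (by fun_prop), lintegral_add_right _ (by fun_prop),
    lintegral_add_right _ hsumA, lintegral_add_right _ (by fun_prop)]
  have b1 := hs.lintegral_mul_exp_neg_hits_le hl hU hn (k := fun ω => kE (l ω)) (hkEm.comp hl)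
  have b2 : ∫⁻ ω, ∑ i ∈ Finset.range n,
      kA (l ω) * ENNReal.ofReal (U.indicator A (l ω, X (n₀ + i) ω)) ∂P =
      ∫⁻ ω, n * (kA (l ω) * ∫⁻ x, ENNReal.ofReal (U.indicator A (l ω, x)) ∂ν) ∂P := by
    rw [lintegral_finsetSum' _ fun i hi => (htA i (Finset.mem_range.1 hi)).aemeasurable]
    rw [Finset.sum_congr rfl fun i hi => hs.lintegral_mul_comp hl
      (by have := Finset.mem_range.1 hi; omega) (k := fun ω => kA (l ω))
      ((hkAm.comp hl).mono (hs.le_of_le (by omega)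
        (by have := Finset.mem_range.1 hi; omega)) le_rfl)
      (Φ := fun p => ENNReal.ofReal (U.indicator A p)) hUA.ennreal_ofReal]
    rw [Finset.sum_const, Finset.card_range, nsmul_eq_mul, lintegral_const_mul _ (by fun_prop)]
  have b3 := hs.lintegral_mul_sq_noise_sum_le hl hU hn (k := fun ω => kM (l ω)) (hkMm.comp hl)
  have b4 : ∫⁻ ω, ∑ i ∈ Finset.range n, kN (l ω) *
        ENNReal.ofReal (hit U l X n₀ i ω * η (n₀ + i) ω ^ 2) ∂P ≤
      n * (ENNReal.ofReal (σ ^ 2) *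
        ∫⁻ ω, kN (l ω) * ENNReal.ofReal (hitProb ν U (l ω)) ∂P) := by
    rw [lintegral_finsetSum' _ fun i hi => (htN i (Finset.mem_range.1 hi)).aemeasurable]
    refine (Finset.sum_le_sum fun i hi => hs.lintegral_noise_sq_mul_hit_le hl hU
      (by have := Finset.mem_range.1 hi; omega) (k := fun ω => kN (l ω))
      ((hkNm.comp hl).mono (hs.le_of_le (by omega)
        (by have := Finset.mem_range.1 hi; omega)) le_rfl)).trans ?_
    rw [Finset.sum_const, Finset.card_range, nsmul_eq_mul]
  rw [b2]
  refine (add_le_add (add_le_add (add_le_add (add_le_add (add_le_add (add_le_add b1 le_rfl)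
    le_rfl) b3) le_rfl) b4) le_rfl).trans ?_
  rw [← lintegral_const_mul _ (by fun_prop), ← lintegral_const_mul _ (by fun_prop),
    ← lintegral_const_mul _ (by fun_prop), ← lintegral_add_right _ (by fun_prop),
    ← lintegral_add_right _ (by fun_prop), ← lintegral_add_right _ (by fun_prop),
    ← lintegral_add_right _ (by fun_prop), ← lintegral_add_right _ (by fun_prop),
    ← lintegral_add_right _ (by fun_prop)]
  refine lintegral_mono fun ω => ?_
  set t := l ω with ht
  set J := ∫⁻ x, ENNReal.ofReal (U.indicator A (t, x)) ∂ν with hJ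
  have hC : 0 < 20 * L + 1502 + 2 * σ ^ 2 := by positivity
  have hρt := hρ t
  rcases (hr0 t).eq_or_lt with h0 | hpos
  · have : (n : ℝ) * hitProb ν U t = 0 := h0.symm
    rw [this, ENNReal.ofReal_zero, ENNReal.inv_zero, ENNReal.mul_top (by simpa using hρt),
      add_top, ENNReal.mul_top (by simpa using hC), add_top]
    exact le_top
  change _ ≤ ENNReal.ofReal (a t) + 2 * (ENNReal.ofReal (hitProb ν U t))⁻¹ * J +
    ENNReal.ofReal (20 * L + 1502 + 2 * σ ^ 2) * (ENNReal.ofReal (1 / ρ t) +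
      ENNReal.ofReal (ρ t) * (ENNReal.ofReal (r t))⁻¹)
  have hq : 0 < hitProb ν U t := by
    rcases (hitProb_nonneg (ν := ν) (U := U) t).eq_or_lt with h | h
    · simp [hr, ← h] at hpos
    · exact h
  have hnpos : (0 : ℝ) < n := by exact_mod_cast hn1
  -- Here `exp (r/2)` from the dichotomy meets `exp (-0.6 r)` from the hit count, and `exp (-0.1 r)`
  -- remains.
  have c1 : kE t * ENNReal.ofReal (Real.exp (-(0.6 * (n * hitProb ν U t)))) =
      ENNReal.ofReal ((2 * L + r t ^ 3 / (4 * ρ t)) * Real.exp (-(0.1 * r t))) := by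
    rw [hkE, ← ENNReal.ofReal_mul (by positivity), mul_assoc, ← Real.exp_add]
    congr 3
    simp only [hr]
    ring
  have c2 : (n : ENNReal) * (kA t * J) = 2 * (ENNReal.ofReal (hitProb ν U t))⁻¹ * J := by
    rw [← mul_assoc]
    congr 1
    rw [hkA, ← ENNReal.ofReal_natCast, ← ENNReal.ofReal_mul (by positivity),
      ← ENNReal.ofReal_inv_of_pos hq, ← ENNReal.ofReal_ofNat, ← ENNReal.ofReal_mul (by positivity)]
    congr 1
    simp only [hr]
    field_simp
  have c3 : ENNReal.ofReal (σ ^ 2) * (kM t * ENNReal.ofReal (n * hitProb ν U t)) =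
      ENNReal.ofReal (σ ^ 2 * (ρ t / r t)) := by
    rw [hkM, ← ENNReal.ofReal_mul (by positivity), ← ENNReal.ofReal_mul (by positivity)]
    congr 2
    change ρ t / r t ^ 2 * r t = _
    field_simp
  have c4 : (n : ENNReal) * (ENNReal.ofReal (σ ^ 2) * (kN t * ENNReal.ofReal (hitProb ν U t))) =
      ENNReal.ofReal (σ ^ 2 * (ρ t / (2 * r t))) := by
    rw [hkN, ← ENNReal.ofReal_mul (by positivity), ← ENNReal.ofReal_mul (by positivity),
      ← ENNReal.ofReal_natCast, ← ENNReal.ofReal_mul (by positivity)]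
    congr 1
    simp only [hr]
    field_simp
  have c5 : ENNReal.ofReal (ρ t) * (ENNReal.ofReal (r t))⁻¹ = ENNReal.ofReal (ρ t / r t) := by
    rw [← ENNReal.ofReal_inv_of_pos hpos, ← ENNReal.ofReal_mul hρt.le, div_eq_mul_inv]
  rw [c1, c2, c3, c4, c5, ← ENNReal.ofReal_add (p := 1 / ρ t) (q := ρ t / r t) (by positivity)
    (by positivity), ← ENNReal.ofReal_mul hC.le]
  have hfin : (2 * L + r t ^ 3 / (4 * ρ t)) * Real.exp (-(0.1 * r t)) + σ ^ 2 * (ρ t / r t) +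
      1 / ρ t + σ ^ 2 * (ρ t / (2 * r t)) + ρ t / r t ≤
      (20 * L + 1502 + 2 * σ ^ 2) * (1 / ρ t + ρ t / r t) := by
    -- The constants: `20 L = 10 · 2 L`, `1500 = 6000 / 4`, and the two noise terms give `3σ²/2`;
    -- the rest is rounded up.
    have f1 := exp_neg_le_balance hpos hρt
    have f2 := cube_mul_exp_neg_le hpos
    have f3 : r t ^ 3 / (4 * ρ t) * Real.exp (-(0.1 * r t)) ≤ 1500 * (1 / ρ t) := by
      calc r t ^ 3 / (4 * ρ t) * Real.exp (-(0.1 * r t))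
          = (r t ^ 3 * Real.exp (-(0.1 * r t))) * (1 / (4 * ρ t)) := by field_simp
        _ ≤ 6000 * (1 / (4 * ρ t)) := by gcongr
        _ = _ := by field_simp; norm_num
    have f4 : ρ t / (2 * r t) = 1 / 2 * (ρ t / r t) := by field_simp
    have f5 : 0 < 1 / ρ t := by positivity
    have f6 : 0 < ρ t / r t := by positivity
    rw [f4, add_mul]
    have f7 := mul_le_mul_of_nonneg_left f1 (by positivity : 0 ≤ 2 * L)
    nlinarith [mul_nonneg (sq_nonneg σ) f5.le, mul_nonneg (sq_nonneg σ) f6.le]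
  calc _ = (ENNReal.ofReal (a t) + 2 * (ENNReal.ofReal (hitProb ν U t))⁻¹ * J) +
        (ENNReal.ofReal ((2 * L + r t ^ 3 / (4 * ρ t)) * Real.exp (-(0.1 * r t))) +
          ENNReal.ofReal (σ ^ 2 * (ρ t / r t)) + ENNReal.ofReal (1 / ρ t) +
          ENNReal.ofReal (σ ^ 2 * (ρ t / (2 * r t))) + ENNReal.ofReal (ρ t / r t)) := by ring
    _ ≤ _ := by
      rw [← ENNReal.ofReal_add (by positivity) (by positivity),
        ← ENNReal.ofReal_add (by positivity) (by positivity),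
        ← ENNReal.ofReal_add (by positivity) (by positivity),
        ← ENNReal.ofReal_add (by positivity) (by positivity)]
      gcongr

end LocalRegression

/-! ### Reciprocal window masses of an arbitrary measure on the line. -/

section Windows

variable {m : Measure ℝ} {h : ℝ}

lemma measurable_measure_closedBall [SFinite m] (h : ℝ) :
    Measurable fun z : ℝ => m (Metric.closedBall z h) := by
  have hU : MeasurableSet {p : ℝ × ℝ | |p.2 - p.1| ≤ h} :=
    measurableSet_le (by fun_prop) measurable_const
  exact measurable_measure_prodMk_left hU

/-- On a set of diameter at most `h`, the reciprocal window mass integrates to at most one. -/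
lemma setLIntegral_inv_window_le_one {s : Set ℝ} (hs : MeasurableSet s)
    (hdiam : ∀ u ∈ s, ∀ v ∈ s, |u - v| ≤ h) :
    ∫⁻ z in s, (m (Metric.closedBall z h))⁻¹ ∂m ≤ 1 := by
  -- Each window centered in `s` contains `s`, so the integrand is at most `(m s)⁻¹` on `s`.
  calc ∫⁻ z in s, (m (Metric.closedBall z h))⁻¹ ∂m ≤ ∫⁻ _z in s, (m s)⁻¹ ∂m := by
        refine setLIntegral_mono' hs fun z hz => ?_
        refine ENNReal.inv_le_inv.2 (measure_mono fun u hu => ?_)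
        rw [Metric.mem_closedBall, Real.dist_eq]
        exact hdiam u hu z hz
    _ = (m s)⁻¹ * m s := by rw [setLIntegral_const]
    _ ≤ 1 := ENNReal.inv_mul_le_one _

/-- The ball has diameter `2 h`; each of its halves has diameter `h` and contributes at most `1`. -/
lemma setLIntegral_inv_window_closedBall_le_two (u : ℝ) :
    ∫⁻ z in Metric.closedBall u h, (m (Metric.closedBall z h))⁻¹ ∂m ≤ 2 := by
  have hsub : Metric.closedBall u h ⊆ Set.Icc (u - h) u ∪ Set.Icc u (u + h) := by
    intro z hz
    rw [Real.closedBall_eq_Icc] at hz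
    rcases le_total z u with hzu | hzu
    · exact Or.inl ⟨hz.1, hzu⟩
    · exact Or.inr ⟨hzu, hz.2⟩
  refine (lintegral_mono_set hsub).trans ((lintegral_union_le _ _ _).trans ?_)
  rw [← one_add_one_eq_two]
  refine add_le_add (setLIntegral_inv_window_le_one measurableSet_Icc ?_)
    (setLIntegral_inv_window_le_one measurableSet_Icc ?_)
  all_goals
    intro a ha b hb
    rw [Set.mem_Icc] at ha hb
    rw [abs_le]
    constructor <;> linarith

/-- The weight at `z` is dominated, up to the factor `2/h`, by its own integral over `|u - z| ≤
h/2`. After exchanging the integrals, the points `z` belonging to a given `u` form a set of diameter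
`h`, on which the reciprocal mass integrates to at most `1`. What is left is `(2/h) ∫ 1/(1+u²) =
2π/h`. -/
lemma lintegral_inv_one_add_sq_mul_inv_window_le [SFinite m] (hh : 0 < h) (hh1 : h ≤ 1) :
    ∫⁻ z, ENNReal.ofReal (1 / (1 + z ^ 2)) * (m (Metric.closedBall z h))⁻¹ ∂m ≤
      ENNReal.ofReal (2 * Real.pi / h) := by
  set I : ℝ → ENNReal := fun z => (m (Metric.closedBall z h))⁻¹ with hI
  have hIm : Measurable I := (measurable_measure_closedBall h).inv
  set B : ℝ × ℝ → ENNReal :=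
    {p : ℝ × ℝ | |p.1 - p.2| ≤ h / 2}.indicator fun p => ENNReal.ofReal (1 / (1 + p.2 ^ 2)) with hB
  have hBm : Measurable B := Measurable.indicator (by fun_prop)
    (measurableSet_le (by fun_prop) measurable_const)
  have hpt : ∀ z, ENNReal.ofReal (1 / (1 + z ^ 2)) ≤
      ENNReal.ofReal (2 / h) * ∫⁻ u, B (z, u) := by
    intro z
    have h1 : ∫⁻ u in Metric.closedBall z (h / 2), ENNReal.ofReal (1 / (2 * (1 + z ^ 2))) ≤
        ∫⁻ u, B (z, u) := by
      rw [← lintegral_indicator Metric.isClosed_closedBall.measurableSet]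
      refine lintegral_mono fun u => ?_
      by_cases hu : u ∈ Metric.closedBall z (h / 2)
      · have hu' : |z - u| ≤ h / 2 := by
          rwa [Metric.mem_closedBall, Real.dist_eq, abs_sub_comm] at hu
        rw [Set.indicator_of_mem hu, hB, Set.indicator_of_mem (by exact hu')]
        refine ENNReal.ofReal_le_ofReal (one_div_le_one_div_of_le (by positivity) ?_)
        have := abs_le.1 hu'
        -- The claim is `1 + u² ≤ 2 (1 + z²)` for `|z - u| ≤ h/2 ≤ 1/2`; this is where `h ≤ 1` is
        -- needed.
        nlinarith [sq_nonneg (u - 2 * z), sq_nonneg (z - u)]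
      · rw [Set.indicator_of_notMem hu]
        exact zero_le
    rw [setLIntegral_const, Real.volume_closedBall, ← ENNReal.ofReal_mul (by positivity)] at h1
    calc ENNReal.ofReal (1 / (1 + z ^ 2))
        = ENNReal.ofReal (2 / h) * ENNReal.ofReal (1 / (2 * (1 + z ^ 2)) * (2 * (h / 2))) := by
          rw [← ENNReal.ofReal_mul (by positivity)]
          congr 1
          field_simp
      _ ≤ _ := by gcongr
  calc ∫⁻ z, ENNReal.ofReal (1 / (1 + z ^ 2)) * I z ∂m
      ≤ ∫⁻ z, ENNReal.ofReal (2 / h) * ∫⁻ u, B (z, u) * I z ∂volume ∂m := by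
        refine lintegral_mono fun z => ?_
        rw [lintegral_mul_const _ (by fun_prop), ← mul_assoc]
        gcongr
        exact hpt z
    _ = ENNReal.ofReal (2 / h) * ∫⁻ u, ∫⁻ z, B (z, u) * I z ∂m := by
        rw [lintegral_const_mul _ (Measurable.lintegral_prod_right'
          (f := fun p : ℝ × ℝ => B p * I p.1) (by fun_prop)),
          lintegral_lintegral_swap (f := fun z u => B (z, u) * I z)
          (by simp only [Function.uncurry_def]; fun_prop)]
    _ ≤ ENNReal.ofReal (2 / h) * ∫⁻ u, ENNReal.ofReal (1 / (1 + u ^ 2)) := by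
        gcongr with u
        calc ∫⁻ z, B (z, u) * I z ∂m
            = ∫⁻ z in Metric.closedBall u (h / 2), ENNReal.ofReal (1 / (1 + u ^ 2)) * I z ∂m := by
              rw [← lintegral_indicator Metric.isClosed_closedBall.measurableSet]
              refine lintegral_congr fun z => ?_
              by_cases hz : |z - u| ≤ h / 2
              · rw [hB, Set.indicator_of_mem (by exact hz), Set.indicator_of_mem
                  (by rwa [Metric.mem_closedBall, Real.dist_eq])]
              · rw [hB, Set.indicator_of_notMem (by exact hz), Set.indicator_of_notMem
                  (by rwa [Metric.mem_closedBall, Real.dist_eq]), zero_mul]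
          _ = ENNReal.ofReal (1 / (1 + u ^ 2)) * ∫⁻ z in Metric.closedBall u (h / 2), I z ∂m :=
              lintegral_const_mul _ hIm
          _ ≤ ENNReal.ofReal (1 / (1 + u ^ 2)) * 1 := by
              gcongr
              refine setLIntegral_inv_window_le_one Metric.isClosed_closedBall.measurableSet ?_
              intro a ha b hb
              rw [Real.closedBall_eq_Icc, Set.mem_Icc] at ha hb
              rw [abs_le]
              constructor <;> linarith
          _ = _ := mul_one _
    _ = ENNReal.ofReal (2 / h) * ENNReal.ofReal Real.pi := by
        rw [← integral_univ_inv_one_add_sq, ofReal_integral_eq_lintegral_ofReal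
          integrable_inv_one_add_sq (Filter.Eventually.of_forall fun u => by positivity)]
        simp only [one_div]
    _ = _ := by
        rw [← ENNReal.ofReal_mul (by positivity)]
        congr 1
        ring

end Windows

/-! ### Moments and tails of the index. -/

section GaussianMoments

variable {d : ℕ} {S : Matrix (Fin d) (Fin d) ℝ} {μ : Vec d}

lemma lintegral_inner_sq_multivariateGaussian (v : Vec d) :
    ∫⁻ x, ENNReal.ofReal (inner ℝ (x - μ) v ^ 2) ∂(multivariateGaussian μ S) =
      ENNReal.ofReal (‖sqrtMul S v‖ ^ 2) := by
  have h1 : ∫⁻ x, ENNReal.ofReal (inner ℝ (x - μ) v ^ 2) ∂(multivariateGaussian μ S) =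
      ∫⁻ z, ENNReal.ofReal (z ^ 2) ∂((multivariateGaussian μ S).map
        (fun x => inner ℝ (x - μ) v)) := by
    rw [lintegral_map (by fun_prop) (by fun_prop)]
  rw [h1, map_inner_multivariateGaussian, ← ofReal_integral_eq_lintegral_ofReal
    (f := fun z : ℝ => z ^ 2) (memLp_id_gaussianReal 2).integrable_sq
    (Filter.Eventually.of_forall fun z => sq_nonneg z)]
  have h2 := variance_fun_id_gaussianReal (μ := 0) (v := (‖sqrtMul S v‖ ^ 2).toNNReal)
  rw [variance_eq_integral (by fun_prop), integral_id_gaussianReal] at h2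
  simp only [sub_zero, Real.coe_toNNReal _ (sq_nonneg ‖sqrtMul S v‖)] at h2
  rw [h2]

lemma lintegral_abs_inner_multivariateGaussian_le (v : Vec d) :
    ∫⁻ x, ENNReal.ofReal |inner ℝ (x - μ) v| ∂(multivariateGaussian μ S) ≤
      ENNReal.ofReal ‖sqrtMul S v‖ := by
  have hm : MemLp (fun x => inner ℝ (x - μ) v) 2 (multivariateGaussian μ S) := by
    refine (memLp_two_iff_integrable_sq (Measurable.aestronglyMeasurable (by fun_prop))).2
      ⟨Measurable.aestronglyMeasurable (by fun_prop), (hasFiniteIntegral_iff_ofReal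
        (Filter.Eventually.of_forall fun x => sq_nonneg _)).2 ?_⟩
    rw [lintegral_inner_sq_multivariateGaussian]
    exact ENNReal.ofReal_lt_top
  have h1 := hm.integrable_sq
  have h2 := lintegral_inner_sq_multivariateGaussian (μ := μ) (S := S) v
  rw [← ofReal_integral_eq_lintegral_ofReal h1 (Filter.Eventually.of_forall fun x => sq_nonneg _),
    ENNReal.ofReal_eq_ofReal_iff (integral_nonneg fun _ => sq_nonneg _) (sq_nonneg _)] at h2
  rw [← ofReal_integral_eq_lintegral_ofReal (hm.integrable one_le_two).abs
    (Filter.Eventually.of_forall fun x => abs_nonneg _)]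
  refine ENNReal.ofReal_le_ofReal (abs_le_of_sq_le_sq' ?_ (norm_nonneg _)).2
  refine (sq_integral_le_integral_sq (hm.integrable one_le_two).abs (by simpa using h1)).trans ?_
  simp only [sq_abs]
  exact h2.le

/-- Chernoff's bound with the fixed exponents `±1/2`, uniform over variances at most `1`, zero
included. Decay linear in `W` is enough, as `W` will be `2 log T₁`. -/
lemma measure_lt_abs_inner_multivariateGaussian_le {v : Vec d} (hv : ‖sqrtMul S v‖ ≤ 1) (W : ℝ) :
    multivariateGaussian μ S {x | W < |inner ℝ (x - μ) v|} ≤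
      ENNReal.ofReal (4 * Real.exp (-(W / 2))) := by
  set s := (‖sqrtMul S v‖ ^ 2).toNNReal with hs
  have hs1 : (s : ℝ) ≤ 1 := by
    rw [hs, Real.coe_toNNReal _ (sq_nonneg _)]
    exact pow_le_one₀ (norm_nonneg _) hv
  have h1 : multivariateGaussian μ S {x | W < |inner ℝ (x - μ) v|} =
      gaussianReal 0 s {z | W < |z|} := by
    rw [← map_inner_multivariateGaussian μ, Measure.map_apply (by fun_prop)
      (measurableSet_lt measurable_const (by fun_prop))]
    rfl
  rw [h1, ← lintegral_indicator_one (measurableSet_lt measurable_const (by fun_prop))]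
  have hint : Integrable (fun z : ℝ => Real.exp (-(W / 2)) *
      (Real.exp (1 / 2 * z) + Real.exp (-(1 / 2) * z))) (gaussianReal 0 s) :=
    ((integrable_exp_mul_gaussianReal (1 / 2)).add
      (integrable_exp_mul_gaussianReal (-(1 / 2)))).const_mul _
  calc ∫⁻ z, {z : ℝ | W < |z|}.indicator 1 z ∂(gaussianReal 0 s)
      ≤ ∫⁻ z, ENNReal.ofReal (Real.exp (-(W / 2)) *
          (Real.exp (1 / 2 * z) + Real.exp (-(1 / 2) * z))) ∂(gaussianReal 0 s) := by
        refine lintegral_mono fun z => ?_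
        by_cases hz : W < |z|
        · rw [Set.indicator_of_mem (by exact hz), Pi.one_apply, ← ENNReal.ofReal_one]
          refine ENNReal.ofReal_le_ofReal ?_
          have h2 : Real.exp (|z| / 2) ≤ Real.exp (1 / 2 * z) + Real.exp (-(1 / 2) * z) := by
            rcases abs_cases z with ⟨h, _⟩ | ⟨h, _⟩ <;> rw [h]
            · have := Real.exp_pos (-(1 / 2) * z)
              rw [show z / 2 = 1 / 2 * z by ring]
              linarith
            · have := Real.exp_pos (1 / 2 * z)
              rw [show -z / 2 = -(1 / 2) * z by ring]
              linarith
          calc (1 : ℝ) ≤ Real.exp (-(W / 2)) * Real.exp (|z| / 2) := by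
                rw [← Real.exp_add]
                exact Real.one_le_exp (by linarith)
            _ ≤ _ := by gcongr
        · rw [Set.indicator_of_notMem (by exact hz)]
          exact zero_le
    _ = ENNReal.ofReal (Real.exp (-(W / 2)) * (Real.exp (s / 8) + Real.exp (s / 8))) := by
        rw [← ofReal_integral_eq_lintegral_ofReal hint (Filter.Eventually.of_forall fun z => by
          positivity), integral_const_mul, integral_add (integrable_exp_mul_gaussianReal _)
          (integrable_exp_mul_gaussianReal _)]
        have hmgf : ∀ t : ℝ, ∫ z, Real.exp (t * z) ∂(gaussianReal 0 s) =
            Real.exp (s * t ^ 2 / 2) := fun t => by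
          have := congrFun (mgf_fun_id_gaussianReal (μ := 0) (v := s)) t
          simpa [mgf] using this
        rw [hmgf, hmgf]
        congr 4 <;> ring
    _ ≤ _ := by
        refine ENNReal.ofReal_le_ofReal ?_
        have : Real.exp (s / 8) ≤ 2 := by
          refine (Real.exp_le_exp.2 (by linarith : (s : ℝ) / 8 ≤ 1 / 2)).trans ?_
          have h3 := Real.exp_one_lt_d9
          have h4 : Real.exp (1 / 2) ^ 2 = Real.exp 1 := by
            rw [← Real.exp_nat_mul]; norm_num
          nlinarith [Real.exp_pos (1 / 2)]
        nlinarith [Real.exp_pos (-(W / 2))]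

end GaussianMoments

/-! ### Averaging the local risk over the evaluation point. -/

section IntegratedBound

variable {d : ℕ} {S : Matrix (Fin d) (Fin d) ℝ} {μ : Vec d}

/-- The pairs `(v, x')` for which `x'` lies in the window of width `h` around `x` along `v`. -/
def window (h : ℝ) (x : Vec d) : Set (Vec d × Vec d) :=
  {p | |inner ℝ x p.1 - inner ℝ p.2 p.1| ≤ h}

lemma measurableSet_window (h : ℝ) (x : Vec d) : MeasurableSet (window h x) :=
  measurableSet_le (by fun_prop) measurable_const

lemma ofReal_hitProb_window (h : ℝ) (x v : Vec d) :
    ENNReal.ofReal (hitProb (multivariateGaussian μ S) (window h x) v) =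
      ((multivariateGaussian μ S).map fun x' => inner ℝ (x' - μ) v)
        (Metric.closedBall (inner ℝ (x - μ) v) h) := by
  rw [hitProb, ofReal_measureReal, Measure.map_apply (by fun_prop)
    Metric.isClosed_closedBall.measurableSet]
  congr 1
  ext x'
  simp only [window, Set.mem_preimage, Set.mem_ofPred_eq, Metric.mem_closedBall, Real.dist_eq,
    inner_sub_left, sub_sub_sub_cancel_right]
  rw [abs_sub_comm]

/-- The pointwise risk bound of local averages, averaged over the evaluation point. -/
lemma lintegral_local_risk_le {v θ : Vec d} (hv : ‖sqrtMul S v‖ ≤ 1) {h κ C M : ℝ} {n : ℕ}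
    (hh : 0 < h) (hh1 : h ≤ 1) (hκ : 0 < κ) (hC : 0 ≤ C) (hM : 0 ≤ M) (hn : 1 ≤ n) :
    ∫⁻ x, (ENNReal.ofReal (M * (h + |inner ℝ (x - μ) (θ - v)|)) +
        2 * (ENNReal.ofReal (hitProb (multivariateGaussian μ S) (window h x) v))⁻¹ *
          ∫⁻ x', ENNReal.ofReal ((window h x).indicator
            (fun p => M * |inner ℝ (p.2 - μ) (θ - p.1)|) (v, x')) ∂(multivariateGaussian μ S) +
        ENNReal.ofReal C * (ENNReal.ofReal (1 / (κ / (1 + inner ℝ (x - μ) v ^ 2))) +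
          ENNReal.ofReal (κ / (1 + inner ℝ (x - μ) v ^ 2)) *
            (ENNReal.ofReal (n * hitProb (multivariateGaussian μ S) (window h x) v))⁻¹))
        ∂(multivariateGaussian μ S) ≤
      ENNReal.ofReal (M * h + 5 * M * ‖sqrtMul S (θ - v)‖ +
        C * (2 / κ + κ / n * (2 * Real.pi / h))) := by
  set ν := multivariateGaussian μ S with hν
  set Z : Vec d → ℝ := fun x => inner ℝ (x - μ) v with hZ
  have hZm : Measurable Z := by fun_prop
  set m := ν.map Z with hm
  have hmp : IsProbabilityMeasure m := Measure.isProbabilityMeasure_map hZm.aemeasurable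
  set I : ℝ → ENNReal := fun z => (m (Metric.closedBall z h))⁻¹ with hI
  have hIm : Measurable I := (measurable_measure_closedBall h).inv
  have hq : ∀ x, ENNReal.ofReal (hitProb ν (window h x) v) = m (Metric.closedBall (Z x) h) :=
    fun x => ofReal_hitProb_window h x v
  have hn0 : (0 : ℝ) < n := by exact_mod_cast hn
  set D : Vec d → ENNReal := fun x => ENNReal.ofReal |inner ℝ (x - μ) (θ - v)| with hD
  have hDm : Measurable D := by fun_prop
  have hDle : ∫⁻ x, D x ∂ν ≤ ENNReal.ofReal ‖sqrtMul S (θ - v)‖ :=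
    lintegral_abs_inner_multivariateGaussian_le _
  set B : Vec d × Vec d → ENNReal :=
    {p : Vec d × Vec d | |Z p.1 - Z p.2| ≤ h}.indicator fun p => I (Z p.1) * D p.2 with hB
  have hBm : Measurable B := Measurable.indicator (by fun_prop)
    (measurableSet_le (by fun_prop) measurable_const)
  have hinner : ∀ x, 2 * (ENNReal.ofReal (hitProb ν (window h x) v))⁻¹ *
      ∫⁻ x', ENNReal.ofReal ((window h x).indicator
        (fun p => M * |inner ℝ (p.2 - μ) (θ - p.1)|) (v, x')) ∂ν =
      ENNReal.ofReal (2 * M) * ∫⁻ x', B (x, x') ∂ν := by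
    intro x
    rw [hq, mul_assoc, ENNReal.ofReal_mul two_pos.le, mul_assoc, ENNReal.ofReal_ofNat]
    congr 1
    have hmeas : Measurable fun x' => ENNReal.ofReal ((window h x).indicator
        (fun p => M * |inner ℝ (p.2 - μ) (θ - p.1)|) (v, x')) :=
      ((Measurable.indicator (by fun_prop) (measurableSet_window h x)).comp
        measurable_prodMk_left).ennreal_ofReal
    rw [← lintegral_const_mul _ hmeas, ← lintegral_const_mul _ (by fun_prop)]
    refine lintegral_congr fun x' => ?_
    have hmem : ((v, x') ∈ window h x) ↔
        (x, x') ∈ {p : Vec d × Vec d | |Z p.1 - Z p.2| ≤ h} := by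
      simp only [window, hZ, Set.mem_ofPred_eq, inner_sub_left, sub_sub_sub_cancel_right]
    by_cases hx : (v, x') ∈ window h x
    · rw [Set.indicator_of_mem hx, hB, Set.indicator_of_mem (hmem.1 hx), ENNReal.ofReal_mul hM]
      simp only [hI, hD]
      ring
    · rw [Set.indicator_of_notMem hx, hB, Set.indicator_of_notMem (fun hx' => hx (hmem.2 hx'))]
      simp
  -- The exchange is the point: for fixed `x'` the discrepancy `D x'` factors out, and the
  -- reciprocal mass is integrated over the window around `Z x'`, giving at most `2`. With the
  -- direct term this makes `M + 2M · 2 = 5M`.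
  have hBle : ∫⁻ x, ∫⁻ x', B (x, x') ∂ν ∂ν ≤ 2 * ENNReal.ofReal ‖sqrtMul S (θ - v)‖ := by
    rw [lintegral_lintegral_swap (f := fun x x' => B (x, x')) hBm.aemeasurable]
    calc ∫⁻ x', ∫⁻ x, B (x, x') ∂ν ∂ν ≤ ∫⁻ x', 2 * D x' ∂ν := by
          refine lintegral_mono fun x' => ?_
          have e : ∀ x, B (x, x') =
              (Metric.closedBall (Z x') h).indicator (fun z => I z) (Z x) * D x' := by
            intro x
            by_cases hx : |Z x - Z x'| ≤ h
            · rw [hB, Set.indicator_of_mem (by exact hx), Set.indicator_of_mem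
                (by rwa [Metric.mem_closedBall, Real.dist_eq])]
            · rw [hB, Set.indicator_of_notMem (by exact hx), Set.indicator_of_notMem
                (by rwa [Metric.mem_closedBall, Real.dist_eq]), zero_mul]
          have hind : Measurable ((Metric.closedBall (Z x') h).indicator fun z => I z) :=
            hIm.indicator Metric.isClosed_closedBall.measurableSet
          simp_rw [e]
          rw [lintegral_mul_const _ (by fun_prop), ← lintegral_map hind hZm,
            lintegral_indicator Metric.isClosed_closedBall.measurableSet]
          gcongr
          exact setLIntegral_inv_window_closedBall_le_two _
      _ = 2 * ∫⁻ x', D x' ∂ν := lintegral_const_mul _ hDm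
      _ ≤ _ := by gcongr
  -- The term `1/ρ = (1 + Z²)/κ` thus has mean at most `2/κ`.
  have hsq : ∫⁻ x, ENNReal.ofReal (Z x ^ 2) ∂ν ≤ 1 := by
    rw [hZ, hν, lintegral_inner_sq_multivariateGaussian]
    exact ENNReal.ofReal_le_one.2 (pow_le_one₀ (norm_nonneg _) hv)
  have hT : ∫⁻ x, ENNReal.ofReal (1 / (1 + Z x ^ 2)) * I (Z x) ∂ν ≤
      ENNReal.ofReal (2 * Real.pi / h) := by
    rw [← lintegral_map (f := fun z => ENNReal.ofReal (1 / (1 + z ^ 2)) * I z) (by fun_prop) hZm]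
    exact lintegral_inv_one_add_sq_mul_inv_window_le hh hh1
  have hpt : ∀ x, ENNReal.ofReal (M * (h + |inner ℝ (x - μ) (θ - v)|)) +
        2 * (ENNReal.ofReal (hitProb ν (window h x) v))⁻¹ *
          ∫⁻ x', ENNReal.ofReal ((window h x).indicator
            (fun p => M * |inner ℝ (p.2 - μ) (θ - p.1)|) (v, x')) ∂ν +
        ENNReal.ofReal C * (ENNReal.ofReal (1 / (κ / (1 + inner ℝ (x - μ) v ^ 2))) +
          ENNReal.ofReal (κ / (1 + inner ℝ (x - μ) v ^ 2)) *
            (ENNReal.ofReal (n * hitProb ν (window h x) v))⁻¹) =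
      ENNReal.ofReal (M * h) + ENNReal.ofReal M * D x +
        ENNReal.ofReal (2 * M) * ∫⁻ x', B (x, x') ∂ν +
        (ENNReal.ofReal (C / κ) + ENNReal.ofReal (C / κ) * ENNReal.ofReal (Z x ^ 2) +
          ENNReal.ofReal (C * (κ / n)) *
            (ENNReal.ofReal (1 / (1 + Z x ^ 2)) * I (Z x))) := by
    intro x
    rw [hinner x]
    congr 1
    · congr 1
      rw [mul_add, ENNReal.ofReal_add (by positivity) (by positivity), ENNReal.ofReal_mul hM]
      rw [ENNReal.ofReal_mul hM]
    · rw [mul_add]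
      congr 1
      · rw [← ENNReal.ofReal_mul hC, ← ENNReal.ofReal_mul (by positivity),
          ← ENNReal.ofReal_add (by positivity) (by positivity)]
        congr 1
        simp only [hZ]
        field_simp
      · rw [ENNReal.ofReal_mul hn0.le, hq, ENNReal.mul_inv
          (Or.inl (by simpa using hn0.ne')) (Or.inl ENNReal.ofReal_ne_top),
          ← ENNReal.ofReal_inv_of_pos hn0, ← mul_assoc, ← mul_assoc, ← mul_assoc,
          ← ENNReal.ofReal_mul hC, ← ENNReal.ofReal_mul (by positivity),
          ← ENNReal.ofReal_mul (by positivity)]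
        congr 2
        simp only [hZ]
        field_simp
  simp_rw [hpt]
  have hBi : Measurable fun x => ∫⁻ x', B (x, x') ∂ν := hBm.lintegral_prod_right'
  rw [lintegral_add_right _ (by fun_prop), lintegral_add_right _ (by fun_prop),
    lintegral_add_right _ (by fun_prop), lintegral_add_right _ (by fun_prop),
    lintegral_add_right _ (by fun_prop), lintegral_const_mul _ hDm, lintegral_const_mul _ hBi,
    lintegral_const_mul _ (by fun_prop), lintegral_const_mul _ (by fun_prop),
    lintegral_const, lintegral_const, measure_univ, mul_one, mul_one]
  calc _ ≤ ENNReal.ofReal (M * h) + ENNReal.ofReal M * ENNReal.ofReal ‖sqrtMul S (θ - v)‖ +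
        ENNReal.ofReal (2 * M) * (2 * ENNReal.ofReal ‖sqrtMul S (θ - v)‖) +
        (ENNReal.ofReal (C / κ) + ENNReal.ofReal (C / κ) * 1 +
          ENNReal.ofReal (C * (κ / n)) * ENNReal.ofReal (2 * Real.pi / h)) := by gcongr
    _ = _ := by
      have hpi := Real.pi_pos
      have ht := norm_nonneg (sqrtMul S (θ - v))
      generalize ‖sqrtMul S (θ - v)‖ = t at ht
      rw [mul_one, ← ENNReal.ofReal_ofNat 2, ← ENNReal.ofReal_mul two_pos.le,
        ← ENNReal.ofReal_mul hM, ← ENNReal.ofReal_mul (by positivity),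
        ← ENNReal.ofReal_mul (by positivity), ← ENNReal.ofReal_add (by positivity) (by positivity),
        ← ENNReal.ofReal_add (by positivity) (by positivity),
        ← ENNReal.ofReal_add (by positivity) (by positivity),
        ← ENNReal.ofReal_add (by positivity) (by positivity),
        ← ENNReal.ofReal_add (by positivity) (by positivity)]
      congr 1
      ring

end IntegratedBound

/-! ### The exploration rounds as a stream of samples. -/

section Environment

variable {Ω : Type*} {d K : ℕ} {x : ℕ → Fin K → Ω → Vec d} {a : ℕ → Ω → Fin K} {η : ℕ → Ω → ℝ}

/-- The σ-algebra generated by the history before round `t`. -/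
abbrev past (x : ℕ → Fin K → Ω → Vec d) (a : ℕ → Ω → Fin K) (η : ℕ → Ω → ℝ) (t : ℕ) :
    MeasurableSpace Ω :=
  MeasurableSpace.comap (history x a η t) inferInstance

lemma measurable_history_apply_past {s t : ℕ} (hst : s < t) :
    Measurable[past x a η t] fun ω => (arms x s ω, a s ω, η s ω) :=
  (measurable_pi_apply (⟨s, hst⟩ : Fin t)).comp (comap_measurable (history x a η t))

lemma measurable_arms_past {s t : ℕ} (hst : s < t) : Measurable[past x a η t] (arms x s) :=
  measurable_fst.comp (measurable_history_apply_past hst)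

lemma measurable_action_past {s t : ℕ} (hst : s < t) : Measurable[past x a η t] (a s) :=
  (measurable_fst.comp measurable_snd).comp (measurable_history_apply_past hst)

lemma measurable_noise_past {s t : ℕ} (hst : s < t) : Measurable[past x a η t] (η s) :=
  (measurable_snd.comp measurable_snd).comp (measurable_history_apply_past hst)

lemma past_le_succ (t : ℕ) : past x a η t ≤ past x a η (t + 1) := by
  refine Measurable.comap_le ?_
  rw [@measurable_pi_iff]
  intro s
  exact measurable_history_apply_past (by omega)

lemma past_mono {s t : ℕ} (hst : s ≤ t) : past x a η s ≤ past x a η t :=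
  monotone_nat_of_le_succ (f := past x a η) past_le_succ hst

lemma measurable_eval_fin : Measurable fun p : (Fin K → Vec d) × Fin K => p.1 p.2 :=
  measurable_from_prod_countable_left fun k => measurable_pi_apply k

lemma measurable_played_of {m : MeasurableSpace Ω} {t : ℕ} (h1 : Measurable[m] (arms x t))
    (h2 : Measurable[m] (a t)) : Measurable[m] (played x a t) :=
  measurable_eval_fin.comp (h1.prodMk h2)

lemma measurable_played_past {s t : ℕ} (hst : s < t) : Measurable[past x a η t] (played x a s) :=
  measurable_played_of (measurable_arms_past hst) (measurable_action_past hst)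

/-- The noise assumptions are conditional on all arms and the chosen index. Weights that only use
the past and the played arm are measurable for that finer σ-algebra. -/
lemma past_sup_played_le (t : ℕ) :
    past x a η t ⊔ MeasurableSpace.comap (played x a t) inferInstance ≤ preReward x a η t := by
  have h : Measurable[preReward x a η t] (fun ω => (history x a η t ω, arms x t ω, a t ω)) :=
    comap_measurable (fun ω => (history x a η t ω, arms x t ω, a t ω))
  refine sup_le (Measurable.comap_le (measurable_fst.comp h)) (Measurable.comap_le ?_)
  exact measurable_played_of ((measurable_fst.comp measurable_snd).comp h)
    ((measurable_snd.comp measurable_snd).comp h)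

variable {mΩ : MeasurableSpace Ω} {I : Problem d} {σ : ℝ} {T : ℕ} {P : Measure Ω}

namespace IsEnvironment

lemma measurable_arms (he : IsEnvironment I σ T P x a η) {t : ℕ} (ht : t < T) :
    Measurable (arms x t) :=
  measurable_pi_lambda _ fun k => he.measurable_arm t ht k

lemma measurable_history (he : IsEnvironment I σ T P x a η) {t : ℕ} (ht : t ≤ T) :
    Measurable (history x a η t) := by
  refine measurable_pi_lambda _ fun s => ?_
  have hs : (s : ℕ) < T := s.2.trans_le ht
  exact (he.measurable_arms hs).prodMk ((he.measurable_action s hs).prodMk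
    (he.measurable_noise s hs))

lemma past_le (he : IsEnvironment I σ T P x a η) {t : ℕ} (ht : t ≤ T) : past x a η t ≤ mΩ :=
  (he.measurable_history ht).comap_le

lemma measurable_played (he : IsEnvironment I σ T P x a η) {t : ℕ} (ht : t < T) :
    Measurable (played x a t) :=
  measurable_played_of (he.measurable_arms ht) (he.measurable_action t ht)

lemma preReward_le (he : IsEnvironment I σ T P x a η) {t : ℕ} (ht : t < T) :
    preReward x a η t ≤ mΩ :=
  ((he.measurable_history ht.le).prodMk ((he.measurable_arms ht).prodMk
    (he.measurable_action t ht))).comap_le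

instance isProbabilityMeasure_law : IsProbabilityMeasure I.law := by
  unfold Problem.law
  infer_instance

lemma map_arm (he : IsEnvironment I σ T P x a η) {t : ℕ} (ht : t < T) (k : Fin K) :
    P.map (x t k) = I.law := by
  have h : x t k = (fun v : Fin K → Vec d => v k) ∘ arms x t := rfl
  rw [h, ← Measure.map_map (by fun_prop) (he.measurable_arms ht), he.arms_law t ht]
  exact (measurePreserving_eval (fun _ : Fin K => I.law) k).map_eq

lemma indep_arm (he : IsEnvironment I σ T P x a η) {t : ℕ} (ht : t < T) (k : Fin K) :
    Indep (MeasurableSpace.comap (x t k) inferInstance) (past x a η t) P :=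
  (he.arms_indep t ht).comp (measurable_pi_apply k) measurable_id

variable [IsProbabilityMeasure P] {T₁ : ℕ} {lam τ W h : ℝ} {θhat : Ω → Vec d}

/-- Split by the index played. The index is uniform and independent of history and arms, and the
arms are independent of the history, so each of the `K` pieces has probability `K⁻¹` times the
product. -/
lemma measure_played_inter (he : IsEnvironment I σ T P x a η)
    (hg : IsGSTOR I T T₁ lam τ W h P x a η θhat) {t : ℕ} (ht : t < T) (ht' : t < 2 * T₁)
    {A : Set (Vec d)} (hA : MeasurableSet A)
    {B : Set (Fin t → (Fin K → Vec d) × Fin K × ℝ)} (hB : MeasurableSet B) :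
    P (played x a t ⁻¹' A ∩ history x a η t ⁻¹' B) = I.law A * P (history x a η t ⁻¹' B) := by
  have hat := he.measurable_action t ht
  have hK : (K : ENNReal) ≠ 0 := by
    obtain ⟨ω⟩ : Nonempty Ω := nonempty_of_isProbabilityMeasure P
    have := (a t ω).pos
    exact_mod_cast this.ne'
  have hdec : played x a t ⁻¹' A ∩ history x a η t ⁻¹' B =
      ⋃ k : Fin K, (a t ⁻¹' {k} ∩ ((fun ω => (history x a η t ω, arms x t ω)) ⁻¹'
        (B ×ˢ ((fun v : Fin K → Vec d => v k) ⁻¹' A)))) := by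
    ext ω
    simp only [played, arms, Set.mem_inter_iff, Set.mem_preimage, Set.mem_iUnion,
      Set.mem_singleton_iff, Set.mem_prod]
    constructor
    · rintro ⟨h1, h2⟩
      exact ⟨a t ω, rfl, h2, h1⟩
    · rintro ⟨k, rfl, h2, h1⟩
      exact ⟨h1, h2⟩
  have hmeas : ∀ k : Fin K, MeasurableSet (B ×ˢ ((fun v : Fin K → Vec d => v k) ⁻¹' A)) :=
    fun k => hB.prod (measurable_pi_apply k hA)
  have hpair : Measurable fun ω => (history x a η t ω, arms x t ω) :=
    (he.measurable_history ht.le).prodMk (he.measurable_arms ht)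
  rw [hdec, measure_iUnion]
  · have hk : ∀ k : Fin K, P (a t ⁻¹' {k} ∩ ((fun ω => (history x a η t ω, arms x t ω)) ⁻¹'
        (B ×ˢ ((fun v : Fin K → Vec d => v k) ⁻¹' A)))) =
        (K : ENNReal)⁻¹ * (I.law A * P (history x a η t ⁻¹' B)) := by
      intro k
      rw [(hg.explore_indep t ht ht').measure_inter_preimage_eq_mul _ _ (measurableSet_singleton k)
        (hmeas k)]
      congr 1
      · exact hg.explore_uniform t ht ht' k
      · have h2 := (he.arms_indep t ht).measure_inter_preimage_eq_mul
          ((fun v : Fin K → Vec d => v k) ⁻¹' A) B (measurable_pi_apply k hA) hB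
        have h3 : P (arms x t ⁻¹' ((fun v : Fin K → Vec d => v k) ⁻¹' A)) = I.law A := by
          rw [← he.map_arm ht k, Measure.map_apply (he.measurable_arm t ht k) hA]
          rfl
        rw [h3] at h2
        rw [← h2, Set.inter_comm]
        rfl
    simp_rw [hk]
    rw [tsum_fintype, Finset.sum_const, Finset.card_univ, Fintype.card_fin, nsmul_eq_mul,
      ← mul_assoc, ENNReal.mul_inv_cancel hK (ENNReal.natCast_ne_top K), one_mul]
  · intro i j hij
    refine Set.disjoint_left.2 fun ω h1 h2 => hij ?_
    rw [← (show a t ω = i from h1.1), ← (show a t ω = j from h2.1)]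
  · intro k
    exact (hat (measurableSet_singleton k)).inter (hpair (hmeas k))

lemma map_played (he : IsEnvironment I σ T P x a η)
    (hg : IsGSTOR I T T₁ lam τ W h P x a η θhat) {t : ℕ} (ht : t < T) (ht' : t < 2 * T₁) :
    P.map (played x a t) = I.law := by
  refine Measure.ext fun A hA => ?_
  rw [Measure.map_apply (he.measurable_played ht) hA]
  simpa using he.measure_played_inter hg ht ht' hA MeasurableSet.univ

lemma indep_played (he : IsEnvironment I σ T P x a η)
    (hg : IsGSTOR I T T₁ lam τ W h P x a η θhat) {t : ℕ} (ht : t < T) (ht' : t < 2 * T₁) :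
    Indep (MeasurableSpace.comap (played x a t) inferInstance) (past x a η t) P := by
  refine indepFun_iff_measure_inter_preimage_eq_mul.2 fun A B hA hB => ?_
  rw [he.measure_played_inter hg ht ht' hA hB, ← he.map_played hg ht ht',
    Measure.map_apply (he.measurable_played ht) hA]

/-- The exploration rounds form a stream of samples. -/
lemma isSampling (he : IsEnvironment I σ T P x a η)
    (hg : IsGSTOR I T T₁ lam τ W h P x a η θhat) (hT : 2 * T₁ ≤ T) :
    IsSampling P I.law σ (past x a η) (2 * T₁) (played x a) η where
  le i hi := he.past_le (hi.trans hT)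
  mono i _ := past_le_succ i
  measurable_design i _ := measurable_played_past (Nat.lt_succ_self i)
  measurable_noise i _ := measurable_noise_past (Nat.lt_succ_self i)
  law i hi := he.map_played hg (by omega) hi
  indep i hi := he.indep_played hg (by omega) hi
  noise_memLp i hi := he.noise_memLp i (by omega)
  noise_mean i hi G hG hint :=
    integral_mul_eq_zero_of_condExp_eq_zero (he.preReward_le (by omega))
      ((he.noise_memLp i (by omega)).integrable one_le_two) (he.noise_mean i (by omega))
      (hG.mono (past_sup_played_le i) le_rfl) hint
  noise_var i hi G hG :=
    lintegral_sq_mul_le_of_condExp_le (he.preReward_le (by omega))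
      (he.measurable_noise i (by omega)) (he.noise_memLp i (by omega)) (he.noise_var i (by omega))
      (hG.mono (past_sup_played_le i) le_rfl)

end IsEnvironment

end Environment

/-! ### The closed form of the estimator and its normalization. -/

section Estimator

variable {d : ℕ}

/-- Without regularization, the Stein estimator is the average of the truncated terms. -/
lemma eq_smul_sum_of_isMinOn_steinObjective {n : ℕ} {Sc : Vec d → Vec d} {τ : ℝ}
    {xs : Fin n → Vec d} {ys : Fin n → ℝ} {θ : Vec d}
    (h : IsMinOn (steinObjective Sc τ 0 xs ys) Set.univ θ) :
    θ = (1 / (n : ℝ)) • ∑ i, truncate τ (ys i • Sc (xs i)) := by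
  set w := (1 / (n : ℝ)) • ∑ i, truncate τ (ys i • Sc (xs i)) with hw
  have hobj : ∀ v, steinObjective Sc τ 0 xs ys v = ‖v - w‖ ^ 2 - ‖w‖ ^ 2 := by
    intro v
    have : 2 / (n : ℝ) * ∑ i, inner ℝ (truncate τ (ys i • Sc (xs i))) v = 2 * inner ℝ v w := by
      rw [hw, inner_smul_right, inner_sum, ← mul_assoc]
      congr 1
      · ring
      · exact Finset.sum_congr rfl fun i _ => real_inner_comm _ _
    rw [steinObjective, this, norm_sub_sq_real]
    ring
  have h1 := isMinOn_iff.1 h w (Set.mem_univ _)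
  rw [hobj, hobj, sub_self, norm_zero] at h1
  have h2 : ‖θ - w‖ ^ 2 ≤ 0 := by linarith
  have h3 : ‖θ - w‖ = 0 := by nlinarith [norm_nonneg (θ - w)]
  exact sub_eq_zero.1 (norm_eq_zero.1 h3)

lemma l1Norm_nonneg (v : Vec d) : 0 ≤ l1Norm v := Finset.sum_nonneg fun _ _ => abs_nonneg _

lemma norm_le_l1Norm (v : Vec d) : ‖v‖ ≤ l1Norm v := by
  refine abs_le_of_sq_le_sq' ?_ (l1Norm_nonneg v) |>.2
  rw [EuclideanSpace.real_norm_sq_eq, l1Norm]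
  simp_rw [← sq_abs (v _)]
  exact Finset.sum_sq_le_sq_sum_of_nonneg fun i _ => abs_nonneg _

lemma l1Norm_le_sqrt_mul_norm (v : Vec d) : l1Norm v ≤ Real.sqrt d * ‖v‖ := by
  refine abs_le_of_sq_le_sq' ?_ (by positivity) |>.2
  rw [mul_pow, Real.sq_sqrt (Nat.cast_nonneg d), EuclideanSpace.real_norm_sq_eq, l1Norm]
  have := sq_sum_le_card_mul_sum_sq (s := Finset.univ) (f := fun j => |v j|)
  simpa using this

lemma abs_l1Norm_sub_le (v w : Vec d) : |l1Norm v - l1Norm w| ≤ l1Norm (v - w) := by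
  simp only [l1Norm, ← Finset.sum_sub_distrib]
  refine (Finset.abs_sum_le_sum_abs _ _).trans (Finset.sum_le_sum fun j _ => ?_)
  exact abs_abs_sub_abs_le_abs_sub _ _

lemma l1Norm_smul (c : ℝ) (v : Vec d) : l1Norm (c • v) = |c| * l1Norm v := by
  simp [l1Norm, abs_mul, Finset.mul_sum]

lemma sqrtMul_smul (S : Matrix (Fin d) (Fin d) ℝ) (c : ℝ) (v : Vec d) :
    sqrtMul S (c • v) = c • sqrtMul S v := map_smul _ _ _

lemma sqrtMul_sub (S : Matrix (Fin d) (Fin d) ℝ) (v w : Vec d) :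
    sqrtMul S (v - w) = sqrtMul S v - sqrtMul S w := map_sub _ _ _

/-- Normalizing in `ℓ¹` costs a factor `√d`. -/
lemma norm_sub_inv_l1Norm_smul_le {u w : Vec d} {s : ℝ} (hs : 0 < s) (hw : l1Norm w = 1) :
    ‖w - (l1Norm u)⁻¹ • u‖ ≤ 2 * Real.sqrt d / s * ‖u - s • w‖ := by
  have hd : 1 ≤ Real.sqrt d := by
    rcases Nat.eq_zero_or_pos d with rfl | hd
    · simp [l1Norm] at hw
    · exact Real.one_le_sqrt.2 (by exact_mod_cast hd)
  set e := ‖u - s • w‖ with he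
  have he0 : 0 ≤ e := norm_nonneg _
  have h1 : ‖w - s⁻¹ • u‖ = s⁻¹ * e := by
    have : w - s⁻¹ • u = -(s⁻¹ • (u - s • w)) := by
      rw [smul_sub, smul_smul, inv_mul_cancel₀ hs.ne', one_smul]
      abel
    rw [this, norm_neg, norm_smul, Real.norm_of_nonneg (by positivity)]
  -- The factor `(l1Norm u)⁻¹` is cancelled by `‖u‖ ≤ l1Norm u`, so no lower bound on `l1Norm u` is
  -- required; for `u = 0` both scaled vectors vanish.
  have h2 : ‖s⁻¹ • u - (l1Norm u)⁻¹ • u‖ ≤ s⁻¹ * (Real.sqrt d * e) := by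
    rcases (l1Norm_nonneg u).eq_or_lt with h0 | hpos
    · have : u = 0 := norm_le_zero_iff.1 ((norm_le_l1Norm u).trans h0.symm.le)
      rw [this]
      simp only [smul_zero, sub_zero, norm_zero]
      positivity
    · rw [← sub_smul, norm_smul, Real.norm_eq_abs]
      have e1 : s⁻¹ - (l1Norm u)⁻¹ = s⁻¹ * (l1Norm u)⁻¹ * (l1Norm u - s) := by field_simp
      rw [e1, abs_mul, abs_of_pos (by positivity)]
      have h3 : |l1Norm u - s| ≤ Real.sqrt d * e := by
        have := abs_l1Norm_sub_le u (s • w)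
        rw [l1Norm_smul, hw, abs_of_pos hs, mul_one] at this
        exact this.trans (l1Norm_le_sqrt_mul_norm _)
      calc s⁻¹ * (l1Norm u)⁻¹ * |l1Norm u - s| * ‖u‖
          ≤ s⁻¹ * (l1Norm u)⁻¹ * (Real.sqrt d * e) * l1Norm u := by
            gcongr
            exact norm_le_l1Norm u
        _ = _ := by field_simp
  calc ‖w - (l1Norm u)⁻¹ • u‖ = ‖(w - s⁻¹ • u) + (s⁻¹ • u - (l1Norm u)⁻¹ • u)‖ := by
        congr 1; abel
    _ ≤ s⁻¹ * e + s⁻¹ * (Real.sqrt d * e) := (norm_add_le _ _).trans (by rw [h1]; gcongr)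
    _ ≤ s⁻¹ * (Real.sqrt d * e) + s⁻¹ * (Real.sqrt d * e) := by
        gcongr
        exact le_mul_of_one_le_left he0 hd
    _ = _ := by ring

/-- The Euclidean norm is below the `ℓ¹` norm, so the estimated index always has variance at most
`1`, however bad the estimate is. -/
lemma norm_sqrtMul_normalizedEstimator_le (I : Problem d) (v : Vec d) :
    ‖sqrtMul I.SX (normalizedEstimator I v)‖ ≤ 1 := by
  rw [normalizedEstimator, sqrtMul_smul, norm_smul, Real.norm_of_nonneg
    (inv_nonneg.2 (l1Norm_nonneg _))]
  rcases (l1Norm_nonneg (sqrtMul I.SX v)).eq_or_lt with h0 | hpos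
  · simp [← h0]
  · rw [inv_mul_le_iff₀ hpos, mul_one]
    exact norm_le_l1Norm _

end Estimator

/-! ### Expected error of the estimated direction. -/

section EstimatorError

variable {Ω : Type*} {d K : ℕ} {x : ℕ → Fin K → Ω → Vec d} {a : ℕ → Ω → Fin K} {η : ℕ → Ω → ℝ}
  {mΩ : MeasurableSpace Ω} {I : Problem d} {σ : ℝ} {T : ℕ} {P : Measure Ω}
  {T₁ : ℕ} {τ W h : ℝ} {θhat : Ω → Vec d} {Lf Lf' m cmin cmax : ℝ}

namespace Problem.Admissible

lemma measurable_link (ha : I.Admissible Lf Lf' m cmin cmax) : Measurable I.f :=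
  ha.smooth.continuous.measurable

lemma abs_link_sub_le (ha : I.Admissible Lf Lf' m cmin cmax) (u v : ℝ) :
    |I.f u - I.f v| ≤ Lf' * |u - v| := by
  have := Convex.norm_image_sub_le_of_norm_deriv_le (f := I.f) (s := Set.univ) (C := Lf')
    (fun z _ => (ha.smooth.differentiable one_ne_zero) z) (fun z _ => ha.deriv_bdd z) convex_univ
    (Set.mem_univ v) (Set.mem_univ u)
  simpa using this

lemma norm_sqrtMul_le (ha : I.Admissible Lf Lf' m cmin cmax) (v : Vec d) :
    ‖sqrtMul I.SX v‖ ≤ Real.sqrt cmax * ‖v‖ := by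
  have h1 : ‖sqrtMul I.SX v‖ ^ 2 ≤ cmax * ‖v‖ ^ 2 := by
    rw [norm_sqrtMul_sq ha.posDef.posSemidef]
    refine (ha.eig_upper _).trans (le_of_eq ?_)
    rw [EuclideanSpace.real_norm_sq_eq, dotProduct]
    simp [sq]
  refine (Real.le_sqrt_of_sq_le h1).trans ?_
  rw [Real.sqrt_mul' _ (sq_nonneg _), Real.sqrt_sq (norm_nonneg _)]

lemma sqrtMul_index_ne_zero (ha : I.Admissible Lf Lf' m cmin cmax) : sqrtMul I.SX I.θ ≠ 0 := by
  intro h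
  have := ha.normalized
  rw [h] at this
  simp [l1Norm] at this

end Problem.Admissible

/-- The unregularized estimator, coordinatewise. -/
lemma IsGSTOR.estimator_apply (hg : IsGSTOR I T T₁ 0 τ W h P x a η θhat) (hS : I.SX.PosDef)
    (ω : Ω) (j : Fin d) :
    θhat ω j = 1 / (T₁ : ℝ) * ∑ i ∈ Finset.range T₁,
      (Real.sign ((I.f (inner ℝ (played x a i ω) I.θ) + η i ω) *
          inner ℝ (played x a i ω - I.μX) (scoreDirection I.SX j)) *
        min |(I.f (inner ℝ (played x a i ω) I.θ) + η i ω) *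
          inner ℝ (played x a i ω - I.μX) (scoreDirection I.SX j)| τ) := by
  rw [eq_smul_sum_of_isMinOn_steinObjective (hg.estimator ω), Finset.sum_range]
  simp [truncate, reward, score_apply hS]

/-- The estimator is only given as a minimizer at each outcome; its closed form shows that it is a
measurable function of the first `T₁` rounds. -/
lemma IsGSTOR.measurable_estimator (hg : IsGSTOR I T T₁ 0 τ W h P x a η θhat)
    (ha : I.Admissible Lf Lf' m cmin cmax) : Measurable[past x a η T₁] θhat := by
  have hfm := ha.measurable_link
  have : Measurable[past x a η T₁] fun ω => (θhat ω).ofLp := by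
    refine @measurable_pi_lambda _ _ _ (past x a η T₁) _ _ fun j => ?_
    simp_rw [hg.estimator_apply ha.posDef]
    refine (Finset.measurable_sum _ fun i hi => ?_).const_mul _
    have hi' : i < T₁ := Finset.mem_range.1 hi
    have h1 : Measurable[past x a η T₁] (played x a i) := measurable_played_past hi'
    have h2 : Measurable[past x a η T₁] (η i) := measurable_noise_past hi'
    refine (measurable_sign_mul_min τ).comp (Measurable.mul (Measurable.add ?_ h2) ?_)
    · exact (show Measurable fun z : Vec d => I.f (inner ℝ z I.θ) by fun_prop).comp h1
    · exact (show Measurable fun z : Vec d => inner ℝ (z - I.μX) (scoreDirection I.SX j) by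
        fun_prop).comp h1
  exact (WithLp.measurable_toLp 2 (Fin d → ℝ)).comp this

lemma measurable_normalizedEstimator (I : Problem d) : Measurable (normalizedEstimator I) := by
  have h : Measurable fun v : Vec d => l1Norm (sqrtMul I.SX v) := by
    unfold l1Norm
    refine Finset.measurable_sum _ fun j _ => ?_
    have : Continuous fun v : Vec d => |(sqrtMul I.SX v) j| := by fun_prop
    exact this.measurable
  exact h.inv.smul measurable_id

variable [IsProbabilityMeasure P]

/-- By Stein's identity the estimator targets `meanSlope • θ`, whose normalization is `θ`. The
factor `d` is `√d` from summing squared coordinate errors times `√d` from the `ℓ¹` normalization. -/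
lemma lintegral_normalizedEstimator_error_le (he : IsEnvironment I σ T P x a η)
    (hg : IsGSTOR I T T₁ 0 τ W h P x a η θhat) (ha : I.Admissible Lf Lf' m cmin cmax)
    (hm : 0 < m) (hcmin : 0 < cmin) (hτ : 0 < τ) (hT₁ : 1 ≤ T₁) (hT : 2 * T₁ ≤ T) :
    ∫⁻ ω, ENNReal.ofReal ‖sqrtMul I.SX (I.θ - normalizedEstimator I (θhat ω))‖ ∂P ≤
      ENNReal.ofReal (2 * Real.sqrt cmax / m * d *
        (2 * (Lf ^ 2 + σ ^ 2) * (1 / cmin) / τ +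
          Real.sqrt (4 * (2 * (Lf ^ 2 + σ ^ 2) * (1 / cmin)) / T₁))) := by
  have hs := he.isSampling hg hT
  have hn : (0 : ℝ) < T₁ := by exact_mod_cast hT₁
  have hfm := ha.measurable_link
  set C₀ := 2 * (Lf ^ 2 + σ ^ 2) * (1 / cmin) with hC₀
  have hC₀0 : 0 ≤ C₀ := by positivity
  set R := C₀ / τ + Real.sqrt (4 * C₀ / T₁) with hR
  have hR0 : 0 ≤ R := by positivity
  set s := I.meanSlope with hsdef
  have hs0 : 0 < s := hm.trans_le ha.slope
  have hθm : Measurable θhat :=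
    (hg.measurable_estimator ha).mono (he.past_le (by omega)) le_rfl
  have hcoord : ∀ j : Fin d, Integrable (fun ω => (θhat ω j - s * I.θ j) ^ 2) P ∧
      ∫ ω, (θhat ω j - s * I.θ j) ^ 2 ∂P ≤ R ^ 2 := by
    intro j
    have hb : ∫ z, I.f (inner ℝ z I.θ) * inner ℝ (z - I.μX) (scoreDirection I.SX j) ∂I.law =
        s * I.θ j := by
      rw [mul_comm, hsdef, Problem.meanSlope, Problem.law]
      exact integral_mul_score ha.smooth ha.f_bdd ha.deriv_bdd ha.posDef _ _
        ha.sqrtMul_index_ne_zero j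
    have hV : ∫⁻ z, ENNReal.ofReal (inner ℝ (z - I.μX) (scoreDirection I.SX j) ^ 2) ∂I.law ≤
        ENNReal.ofReal (1 / cmin) := by
      rw [Problem.law, lintegral_inner_sq_multivariateGaussian]
      exact ENNReal.ofReal_le_ofReal
        (norm_sqrtMul_scoreDirection_sq_le ha.posDef hcmin ha.eig_lower j)
    have key := hs.integral_sq_sum_truncated_le (g := fun z => I.f (inner ℝ z I.θ))
      (s := fun z => inner ℝ (z - I.μX) (scoreDirection I.SX j)) (by fun_prop) (by fun_prop)
      (fun z => ha.f_bdd _) (by positivity) hV hτ (k := T₁) (by omega)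
    rw [hb] at key
    have e : ∀ ω, (θhat ω j - s * I.θ j) ^ 2 = (1 / (T₁ : ℝ)) ^ 2 *
        (∑ i ∈ Finset.range T₁,
      (Real.sign ((I.f (inner ℝ (played x a i ω) I.θ) + η i ω) *
          inner ℝ (played x a i ω - I.μX) (scoreDirection I.SX j)) *
        min |(I.f (inner ℝ (played x a i ω) I.θ) + η i ω) *
          inner ℝ (played x a i ω - I.μX) (scoreDirection I.SX j)| τ - s * I.θ j)) ^ 2 := by
      intro ω
      rw [hg.estimator_apply ha.posDef, Finset.sum_sub_distrib, Finset.sum_const,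
        Finset.card_range, nsmul_eq_mul]
      field_simp
    constructor
    · refine Integrable.of_bound (C := (τ + |s * I.θ j|) ^ 2)
        (Measurable.aestronglyMeasurable (by fun_prop)) (Filter.Eventually.of_forall fun ω => ?_)
      rw [Real.norm_eq_abs, abs_pow]
      refine pow_le_pow_left₀ (abs_nonneg _) ((abs_sub _ _).trans ?_) 2
      gcongr
      rw [hg.estimator_apply ha.posDef, abs_mul, abs_of_pos (by positivity), one_div,
        inv_mul_le_iff₀ hn]
      refine (Finset.abs_sum_le_sum_abs _ _).trans ?_
      refine (Finset.sum_le_card_nsmul _ _ τ fun i _ => abs_sign_mul_min_le hτ _).trans ?_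
      rw [Finset.card_range, nsmul_eq_mul]
    · simp_rw [e]
      rw [integral_const_mul]
      calc _ ≤ (1 / (T₁ : ℝ)) ^ 2 * (T₁ * (C₀ / τ) + Real.sqrt (4 * C₀ * T₁)) ^ 2 := by gcongr
        _ = R ^ 2 := by
          rw [← mul_pow, hR, mul_add]
          congr 2
          · field_simp
          · rw [show 4 * C₀ * (T₁ : ℝ) = 4 * C₀ / T₁ * (T₁ : ℝ) ^ 2 by field_simp,
              Real.sqrt_mul' _ (sq_nonneg _), Real.sqrt_sq hn.le]
            field_simp
  have hnormsq : ∀ ω, ‖θhat ω - s • I.θ‖ ^ 2 = ∑ j, (θhat ω j - s * I.θ j) ^ 2 := by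
    intro ω
    rw [EuclideanSpace.real_norm_sq_eq]
    simp
  have hint2 : Integrable (fun ω => ‖θhat ω - s • I.θ‖ ^ 2) P := by
    simp_rw [hnormsq]
    exact integrable_finsetSum _ fun j _ => (hcoord j).1
  have hsq : ∫ ω, ‖θhat ω - s • I.θ‖ ^ 2 ∂P ≤ d * R ^ 2 := by
    simp_rw [hnormsq]
    rw [integral_finsetSum _ fun j _ => (hcoord j).1]
    refine (Finset.sum_le_card_nsmul _ _ (R ^ 2) fun j _ => (hcoord j).2).trans ?_
    simp
  have hint1 : Integrable (fun ω => ‖θhat ω - s • I.θ‖) P :=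
    ((memLp_two_iff_integrable_sq (Measurable.aestronglyMeasurable (by fun_prop))).2
      hint2).integrable one_le_two
  have hmean : ∫ ω, ‖θhat ω - s • I.θ‖ ∂P ≤ Real.sqrt d * R := by
    refine (abs_le_of_sq_le_sq' ?_ (by positivity)).2
    rw [mul_pow, Real.sq_sqrt (Nat.cast_nonneg d)]
    exact (sq_integral_le_integral_sq hint1 hint2).trans hsq
  have hpt : ∀ ω, ‖sqrtMul I.SX (I.θ - normalizedEstimator I (θhat ω))‖ ≤
      2 * Real.sqrt d / m * Real.sqrt cmax * ‖θhat ω - s • I.θ‖ := by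
    intro ω
    rw [sqrtMul_sub, normalizedEstimator, sqrtMul_smul]
    refine (norm_sub_inv_l1Norm_smul_le hs0 ha.normalized).trans ?_
    rw [← sqrtMul_smul, ← sqrtMul_sub, mul_assoc]
    gcongr
    · exact ha.slope
    · exact ha.norm_sqrtMul_le _
  calc ∫⁻ ω, ENNReal.ofReal ‖sqrtMul I.SX (I.θ - normalizedEstimator I (θhat ω))‖ ∂P
      ≤ ∫⁻ ω, ENNReal.ofReal
          (2 * Real.sqrt d / m * Real.sqrt cmax * ‖θhat ω - s • I.θ‖) ∂P :=
        lintegral_mono fun ω => ENNReal.ofReal_le_ofReal (hpt ω)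
    _ = ENNReal.ofReal (2 * Real.sqrt d / m * Real.sqrt cmax *
          ∫ ω, ‖θhat ω - s • I.θ‖ ∂P) := by
        rw [← ofReal_integral_eq_lintegral_ofReal (hint1.const_mul _)
          (Filter.Eventually.of_forall fun ω => by positivity), integral_const_mul]
    _ ≤ _ := by
        refine ENNReal.ofReal_le_ofReal ?_
        calc 2 * Real.sqrt d / m * Real.sqrt cmax * ∫ ω, ‖θhat ω - s • I.θ‖ ∂P
            ≤ 2 * Real.sqrt d / m * Real.sqrt cmax * (Real.sqrt d * R) := by gcongr
          _ = 2 * Real.sqrt cmax / m * (Real.sqrt d * Real.sqrt d) * R := by ring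
          _ = _ := by rw [Real.mul_self_sqrt (Nat.cast_nonneg d)]

end EstimatorError

/-! ### Joint measurability of the local risk. -/

section LocalRisk

variable {d : ℕ}

/-- The bound for the risk at `x` of a local average along the direction `v`. -/
noncomputable def localRisk (μ : Vec d) (S : Matrix (Fin d) (Fin d) ℝ) (θ : Vec d) (M h κ C : ℝ)
    (n : ℕ) (v x : Vec d) : ENNReal :=
  ENNReal.ofReal (M * (h + |inner ℝ (x - μ) (θ - v)|)) +
    2 * (ENNReal.ofReal (hitProb (multivariateGaussian μ S) (window h x) v))⁻¹ *
      ∫⁻ x', ENNReal.ofReal ((window h x).indicator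
        (fun p => M * |inner ℝ (p.2 - μ) (θ - p.1)|) (v, x')) ∂(multivariateGaussian μ S) +
    ENNReal.ofReal C * (ENNReal.ofReal (1 / (κ / (1 + inner ℝ (x - μ) v ^ 2))) +
      ENNReal.ofReal (κ / (1 + inner ℝ (x - μ) v ^ 2)) *
        (ENNReal.ofReal (n * hitProb (multivariateGaussian μ S) (window h x) v))⁻¹)

/-- Joint measurability in the direction and the point is what Tonelli's theorem needs; it comes
from a single measurable set of triples whose sections are the windows. -/
lemma measurable_localRisk (μ : Vec d) (S : Matrix (Fin d) (Fin d) ℝ) (θ : Vec d) (M h κ C : ℝ)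
    (n : ℕ) : Measurable fun p : Vec d × Vec d => localRisk μ S θ M h κ C n p.1 p.2 := by
  have hU : MeasurableSet {q : (Vec d × Vec d) × Vec d |
      |inner ℝ q.1.2 q.1.1 - inner ℝ q.2 q.1.1| ≤ h} :=
    measurableSet_le (by fun_prop) measurable_const
  have h1 : Measurable fun p : Vec d × Vec d =>
      hitProb (multivariateGaussian μ S) (window h p.2) p.1 :=
    (measurable_measure_prodMk_left (ν := multivariateGaussian μ S) hU).ennreal_toReal
  have h2 : Measurable fun p : Vec d × Vec d =>
      ∫⁻ x', ENNReal.ofReal ((window h p.2).indicator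
        (fun p => M * |inner ℝ (p.2 - μ) (θ - p.1)|) (p.1, x')) ∂(multivariateGaussian μ S) := by
    have h3 : Measurable fun q : (Vec d × Vec d) × Vec d => ENNReal.ofReal
        ({q : (Vec d × Vec d) × Vec d | |inner ℝ q.1.2 q.1.1 - inner ℝ q.2 q.1.1| ≤ h}.indicator
          (fun q => M * |inner ℝ (q.2 - μ) (θ - q.1.1)|) q) :=
      (Measurable.indicator (by fun_prop) hU).ennreal_ofReal
    exact h3.lintegral_prod_right' (ν := multivariateGaussian μ S)
  unfold localRisk
  fun_prop

lemma measurable_localRisk_comp {α : Type*} {mα : MeasurableSpace α} {l : α → Vec d}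
    (hl : Measurable l) {μ : Vec d} {S : Matrix (Fin d) (Fin d) ℝ} {θ : Vec d} {M h κ C : ℝ}
    {n : ℕ} : Measurable fun p : α × Vec d => localRisk μ S θ M h κ C n (l p.1) p.2 :=
  Measurable.comp (g := fun p : Vec d × Vec d => localRisk μ S θ M h κ C n p.1 p.2)
    (f := fun p : α × Vec d => (l p.1, p.2)) (measurable_localRisk μ S θ M h κ C n)
    ((hl.comp measurable_fst).prodMk measurable_snd)

end LocalRisk

/-! ### Expected error of the estimated link at a fresh arm. -/

section RoundError

variable {Ω : Type*} {d K : ℕ} {x : ℕ → Fin K → Ω → Vec d} {a : ℕ → Ω → Fin K} {η : ℕ → Ω → ℝ}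
  {mΩ : MeasurableSpace Ω} {I : Problem d} {σ : ℝ} {T : ℕ} {P : Measure Ω}
  {T₁ : ℕ} {τ W h : ℝ} {θhat : Ω → Vec d} {Lf Lf' m cmin cmax : ℝ}

lemma measurable_kernelRegression {n : ℕ} (μ : Vec d) (W h : ℝ) :
    Measurable fun p : (Vec d × (Fin n → Vec d) × (Fin n → ℝ)) × Vec d =>
      kernelRegression μ W h p.1.1 p.1.2.1 p.1.2.2 (inner ℝ p.2 p.1.1) := by
  have hK : Measurable (uniformKernel h) :=
    Measurable.indicator measurable_const (measurableSet_le (by fun_prop) measurable_const)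
  have hKi : ∀ i : Fin n, Measurable fun p : (Vec d × (Fin n → Vec d) × (Fin n → ℝ)) × Vec d =>
      uniformKernel h (inner ℝ p.2 p.1.1 - inner ℝ (p.1.2.1 i) p.1.1) := fun i => by
    refine hK.comp ?_
    fun_prop
  unfold kernelRegression
  refine Measurable.ite (measurableSet_le (by fun_prop) measurable_const) ?_ measurable_const
  refine Measurable.div (Finset.measurable_sum _ fun i _ => ?_)
    (Finset.measurable_sum _ fun i _ => hKi i)
  exact Measurable.mul (by fun_prop) (hKi i)

lemma kernelRegression_eq_of_abs_le {n₀ n : ℕ} {μ : Vec d} {W h : ℝ} (hh : 0 < h) {l : Ω → Vec d}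
    {X : ℕ → Ω → Vec d} {y : ℕ → Ω → ℝ} {ω : Ω} {z : Vec d}
    (hW : |inner ℝ z (l ω) - inner ℝ μ (l ω)| ≤ W) :
    kernelRegression (n := n) μ W h (l ω) (fun i => X (n₀ + i) ω) (fun i => y (n₀ + i) ω)
        (inner ℝ z (l ω)) =
      (∑ i ∈ Finset.range n, hit (window h z) l X n₀ i ω * y (n₀ + i) ω) /
        ∑ i ∈ Finset.range n, hit (window h z) l X n₀ i ω := by
  have hk : ∀ i : ℕ, uniformKernel h (inner ℝ z (l ω) - inner ℝ (X (n₀ + i) ω) (l ω)) =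
      1 / h * hit (window h z) l X n₀ i ω := by
    intro i
    unfold uniformKernel hit window
    by_cases hi : |inner ℝ z (l ω) - inner ℝ (X (n₀ + i) ω) (l ω)| ≤ h
    · rw [Set.indicator_of_mem (by exact hi), Set.indicator_of_mem (by exact hi)]
      simp
    · rw [Set.indicator_of_notMem (by exact hi), Set.indicator_of_notMem (by exact hi)]
      simp
  unfold kernelRegression
  rw [if_pos hW, Finset.sum_range, Finset.sum_range]
  simp_rw [hk]
  rw [← Finset.mul_sum]
  have e : ∑ i : Fin n, y (n₀ + i) ω * (1 / h * hit (window h z) l X n₀ i ω) =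
      1 / h * ∑ i : Fin n, hit (window h z) l X n₀ i ω * y (n₀ + i) ω := by
    rw [Finset.mul_sum]
    exact Finset.sum_congr rfl fun i _ => by ring
  rw [e, mul_div_mul_left _ _ (by positivity)]

lemma measurable_prodMk_pi {α : Type*} {mα : MeasurableSpace α} {n : ℕ} {l : α → Vec d}
    {u : Fin n → α → Vec d} {v : Fin n → α → ℝ} (hl : Measurable l) (hu : ∀ i, Measurable (u i))
    (hv : ∀ i, Measurable (v i)) :
    Measurable fun b => (l b, (fun i => u i b), fun i => v i b) :=
  hl.prodMk ((measurable_pi_lambda _ hu).prodMk (measurable_pi_lambda _ hv))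

/-- The estimated direction with the samples from which the link is estimated. -/
noncomputable def linkData (I : Problem d) (T₁ : ℕ) (x : ℕ → Fin K → Ω → Vec d)
    (a : ℕ → Ω → Fin K) (η : ℕ → Ω → ℝ) (θhat : Ω → Vec d) (ω : Ω) :
    Vec d × (Fin T₁ → Vec d) × (Fin T₁ → ℝ) :=
  (normalizedEstimator I (θhat ω), fun i => played x a (T₁ + i) ω,
    fun i => reward I x a η (T₁ + i) ω)

lemma measurable_linkData (hg : IsGSTOR I T T₁ 0 τ W h P x a η θhat)
    (ha : I.Admissible Lf Lf' m cmin cmax) {t : ℕ} (ht : 2 * T₁ ≤ t) :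
    Measurable[past x a η t] (linkData I T₁ x a η θhat) := by
  have h0 : Measurable[past x a η t] fun ω => normalizedEstimator I (θhat ω) :=
    ((measurable_normalizedEstimator I).comp (hg.measurable_estimator ha)).mono
      (past_mono (by omega)) le_rfl
  have h1 : ∀ i : Fin T₁, Measurable[past x a η t] (played x a (T₁ + i)) := fun i =>
    measurable_played_past (by omega)
  have h2 : ∀ i : Fin T₁, Measurable[past x a η t] (reward I x a η (T₁ + i)) := fun i =>
    (ha.measurable_link.comp ((h1 i).inner_const (c := I.θ))).add
      (measurable_noise_past (by omega))
  exact measurable_prodMk_pi h0 h1 h2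

lemma measurable_kernelRegression_error (ha : I.Admissible Lf Lf' m cmin cmax) (n : ℕ) (W h : ℝ) :
    Measurable fun p : (Vec d × (Fin n → Vec d) × (Fin n → ℝ)) × Vec d =>
      ENNReal.ofReal |kernelRegression I.μX W h p.1.1 p.1.2.1 p.1.2.2 (inner ℝ p.2 p.1.1) -
        I.f (inner ℝ p.2 I.θ)| := by
  have h1 : Measurable fun p : (Vec d × (Fin n → Vec d) × (Fin n → ℝ)) × Vec d =>
      (inner ℝ p.2 I.θ : ℝ) := measurable_snd.inner_const
  exact (continuous_abs.measurable.comp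
    ((measurable_kernelRegression I.μX W h).sub (ha.measurable_link.comp h1))).ennreal_ofReal

lemma measurable_linkEstimate_error (he : IsEnvironment I σ T P x a η)
    (hg : IsGSTOR I T T₁ 0 τ W h P x a η θhat) (ha : I.Admissible Lf Lf' m cmin cmax)
    {t : ℕ} (htT : t < T) (ht : 2 * T₁ ≤ t) (k : Fin K) :
    Measurable fun ω => ENNReal.ofReal |linkEstimate I T₁ W h x a η θhat ω
        (inner ℝ (x t k ω) (normalizedEstimator I (θhat ω))) - I.f (inner ℝ (x t k ω) I.θ)| := by
  have h1 : Measurable (linkData I T₁ x a η θhat) :=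
    (measurable_linkData hg ha ht).mono (he.past_le htT.le) le_rfl
  have h2 := (measurable_kernelRegression_error ha T₁ W h).comp
    (h1.prodMk (he.measurable_arm t htT k))
  exact h2

variable [IsProbabilityMeasure P]

/-- Expected error of the kernel regression estimate at a fixed point. -/
lemma lintegral_kernelRegression_error_le (he : IsEnvironment I σ T P x a η)
    (hg : IsGSTOR I T T₁ 0 τ W h P x a η θhat) (ha : I.Admissible Lf Lf' m cmin cmax)
    (hT₁ : 1 ≤ T₁) (hT : 2 * T₁ ≤ T) (hh : 0 < h) {κ : ℝ} (hκ : 0 < κ) {l : Ω → Vec d}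
    (hlm : Measurable[past x a η T₁] l) (z : Vec d) :
    ∫⁻ ω, ENNReal.ofReal |kernelRegression (n := T₁) I.μX W h (l ω)
        (fun i => played x a (T₁ + i) ω) (fun i => reward I x a η (T₁ + i) ω) (inner ℝ z (l ω)) -
          I.f (inner ℝ z I.θ)| ∂P ≤
      ∫⁻ ω, (localRisk I.μX I.SX I.θ Lf' h κ (20 * Lf + 1502 + 2 * σ ^ 2) T₁ (l ω) z +
        ENNReal.ofReal Lf *
          {p : Ω × Vec d | W < |inner ℝ (p.2 - I.μX) (l p.1)|}.indicator 1 (ω, z)) ∂P := by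
  have hs := he.isSampling hg hT
  have hfm := ha.measurable_link
  have hLf' : 0 ≤ Lf' := (abs_nonneg _).trans (ha.deriv_bdd 0)
  have hlm' : Measurable l := hlm.mono (he.past_le (by omega)) le_rfl
  set V : Set (Ω × Vec d) := {p | W < |inner ℝ (p.2 - I.μX) (l p.1)|} with hV
  have hVm : MeasurableSet V := measurableSet_lt measurable_const (by fun_prop)
  have hVz : Measurable fun ω => ENNReal.ofReal Lf * V.indicator 1 (ω, z) :=
    ((measurable_one.indicator hVm).comp measurable_prodMk_right).const_mul _
  rw [lintegral_add_right _ hVz]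
  set avg : Ω → ℝ := fun ω => (∑ i ∈ Finset.range T₁, hit (window h z) l (played x a) T₁ i ω *
    (I.f (inner ℝ (played x a (T₁ + i) ω) I.θ) + η (T₁ + i) ω)) /
      ∑ i ∈ Finset.range T₁, hit (window h z) l (played x a) T₁ i ω with havg
  have hle : ∀ ω, ENNReal.ofReal |kernelRegression (n := T₁) I.μX W h (l ω)
        (fun i => played x a (T₁ + i) ω) (fun i => reward I x a η (T₁ + i) ω) (inner ℝ z (l ω)) -
          I.f (inner ℝ z I.θ)| ≤ ENNReal.ofReal |avg ω - I.f (inner ℝ z I.θ)| +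
      ENNReal.ofReal Lf * V.indicator 1 (ω, z) := by
    intro ω
    by_cases hW : |inner ℝ z (l ω) - inner ℝ I.μX (l ω)| ≤ W
    · have := kernelRegression_eq_of_abs_le (n₀ := T₁) (n := T₁) hh (X := played x a)
        (y := reward I x a η) hW
      rw [this]
      exact le_self_add
    -- Beyond the cutoff the estimate is `0` and the error is at most `Lf`.
    · have hmem : (ω, z) ∈ V := by
        have : W < |inner ℝ (z - I.μX) (l ω)| := by
          rw [inner_sub_left]
          exact not_le.1 hW
        exact this
      rw [Set.indicator_of_mem hmem, Pi.one_apply, mul_one]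
      simp only [kernelRegression, if_neg hW, zero_sub, abs_neg]
      exact le_add_left (ENNReal.ofReal_le_ofReal (ha.f_bdd _))
  refine (lintegral_mono hle).trans ?_
  rw [lintegral_add_right _ hVz]
  refine add_le_add ?_ le_rfl
  have key := hs.lintegral_local_average_sub_le (n₀ := T₁) (n := T₁) hlm
    (measurableSet_window h z) (by omega) hT₁ (f := fun z' => I.f (inner ℝ z' I.θ))
    (y := I.f (inner ℝ z I.θ)) (fun z' => ha.f_bdd _) (ha.f_bdd _)
    (a := fun v => Lf' * (h + |inner ℝ (z - I.μX) (I.θ - v)|)) (by fun_prop)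
    (fun v => by positivity)
    (A := fun p => Lf' * |inner ℝ (p.2 - I.μX) (I.θ - p.1)|) (by fun_prop)
    (fun p => by positivity) ?_ (ρ := fun v => κ / (1 + inner ℝ (z - I.μX) v ^ 2))
    (by fun_prop) (fun v => by positivity)
  · exact key
  · intro v z' hmem
    refine (ha.abs_link_sub_le _ _).trans ?_
    rw [← mul_add]
    gcongr
    have hmem' : |inner ℝ z v - inner ℝ z' v| ≤ h := hmem
    -- The difference of the true indices is that along `v`, at most `h`, corrected by the
    -- components along `θ - v` of both points, centered at the mean.
    have e : inner ℝ z' I.θ - inner ℝ z I.θ = -(inner ℝ z v - inner ℝ z' v) +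
        inner ℝ (z' - I.μX) (I.θ - v) - inner ℝ (z - I.μX) (I.θ - v) := by
      simp only [inner_sub_left, inner_sub_right]
      ring
    rw [e]
    refine (abs_sub _ _).trans ?_
    have h3 := abs_add_le (-(inner ℝ z v - inner ℝ z' v)) (inner ℝ (z' - I.μX) (I.θ - v))
    rw [abs_neg] at h3
    linarith

/-- Expected error of the estimated link at a fresh arm. -/
lemma lintegral_linkEstimate_error_le (he : IsEnvironment I σ T P x a η)
    (hg : IsGSTOR I T T₁ 0 τ W h P x a η θhat) (ha : I.Admissible Lf Lf' m cmin cmax)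
    (hT₁ : 1 ≤ T₁) (hh : 0 < h) (hh1 : h ≤ 1) {κ : ℝ} (hκ : 0 < κ)
    {t : ℕ} (htT : t < T) (ht : 2 * T₁ ≤ t) (k : Fin K) :
    ∫⁻ ω, ENNReal.ofReal |linkEstimate I T₁ W h x a η θhat ω
        (inner ℝ (x t k ω) (normalizedEstimator I (θhat ω))) - I.f (inner ℝ (x t k ω) I.θ)| ∂P ≤
      ENNReal.ofReal (Lf' * h + (20 * Lf + 1502 + 2 * σ ^ 2) *
        (2 / κ + κ / T₁ * (2 * Real.pi / h)) + Lf * (4 * Real.exp (-(W / 2)))) +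
      ENNReal.ofReal (5 * Lf') *
        ∫⁻ ω, ENNReal.ofReal ‖sqrtMul I.SX (I.θ - normalizedEstimator I (θhat ω))‖ ∂P := by
  have hLf : 0 ≤ Lf := (abs_nonneg _).trans (ha.f_bdd 0)
  have hLf' : 0 ≤ Lf' := (abs_nonneg _).trans (ha.deriv_bdd 0)
  set C := 20 * Lf + 1502 + 2 * σ ^ 2 with hC
  have hC0 : 0 ≤ C := by positivity
  set l : Ω → Vec d := fun ω => normalizedEstimator I (θhat ω) with hl
  have hlm : Measurable[past x a η T₁] l :=
    (measurable_normalizedEstimator I).comp (hg.measurable_estimator ha)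
  have hlm' : Measurable l := hlm.mono (he.past_le (by omega)) le_rfl
  set V : Set (Ω × Vec d) := {p | W < |inner ℝ (p.2 - I.μX) (l p.1)|} with hV
  have hVm : MeasurableSet V := measurableSet_lt measurable_const
    (continuous_abs.measurable.comp
      ((measurable_snd.sub_const I.μX).inner (hlm'.comp measurable_fst)))
  set Z := linkData I T₁ x a η θhat with hZ
  have hZm : Measurable[past x a η t] Z := measurable_linkData hg ha ht
  set Φ : (Vec d × (Fin T₁ → Vec d) × (Fin T₁ → ℝ)) × Vec d → ENNReal := fun p =>
    ENNReal.ofReal |kernelRegression I.μX W h p.1.1 p.1.2.1 p.1.2.2 (inner ℝ p.2 p.1.1) -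
      I.f (inner ℝ p.2 I.θ)| with hΦ
  have hΦm : Measurable Φ := measurable_kernelRegression_error ha T₁ W h
  -- A single arm of round `t` is independent of all earlier data; the played arm is not, since it
  -- is selected by means of the estimate.
  have hind := lintegral_comp_of_indep (he.past_le htT.le) (he.measurable_arm t htT k)
    (he.indep_arm htT k) hZm hΦm
  rw [he.map_arm htT k] at hind
  have hZm' : Measurable Z := hZm.mono (he.past_le htT.le) le_rfl
  have hfix : ∀ z : Vec d, ∫⁻ ω, Φ (Z ω, z) ∂P ≤
      ∫⁻ ω, (localRisk I.μX I.SX I.θ Lf' h κ C T₁ (l ω) z +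
        ENNReal.ofReal Lf * V.indicator 1 (ω, z)) ∂P := fun z =>
    lintegral_kernelRegression_error_le he hg ha hT₁ (by omega) hh hκ hlm z
  have hRm : Measurable fun p : Ω × Vec d => localRisk I.μX I.SX I.θ Lf' h κ C T₁ (l p.1) p.2 :=
    measurable_localRisk_comp hlm'
  have hVi : Measurable fun p : Ω × Vec d => ENNReal.ofReal Lf * V.indicator 1 p :=
    (measurable_one.indicator hVm).const_mul _
  have hnorm : Measurable fun ω => ENNReal.ofReal ‖sqrtMul I.SX (I.θ - l ω)‖ := by
    exact ((continuous_sqrtMul I.SX).measurable.comp (hlm'.const_sub I.θ)).norm.ennreal_ofReal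
  have hpi := Real.pi_pos
  calc _ = ∫⁻ ω, ∫⁻ z, Φ (Z ω, z) ∂I.law ∂P := hind
    -- The regression bound averages over the data at a fixed point, whereas the window bounds
    -- average over the point along a fixed direction; hence one exchange here and another back.
    _ = ∫⁻ z, ∫⁻ ω, Φ (Z ω, z) ∂P ∂I.law :=
        lintegral_lintegral_swap (f := fun ω z => Φ (Z ω, z))
          (hΦm.comp ((hZm'.comp measurable_fst).prodMk measurable_snd)).aemeasurable
    _ ≤ ∫⁻ z, ∫⁻ ω, (localRisk I.μX I.SX I.θ Lf' h κ C T₁ (l ω) z +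
          ENNReal.ofReal Lf * V.indicator 1 (ω, z)) ∂P ∂I.law := lintegral_mono hfix
    _ = ∫⁻ ω, ∫⁻ z, (localRisk I.μX I.SX I.θ Lf' h κ C T₁ (l ω) z +
          ENNReal.ofReal Lf * V.indicator 1 (ω, z)) ∂I.law ∂P :=
        (lintegral_lintegral_swap (f := fun ω z => localRisk I.μX I.SX I.θ Lf' h κ C T₁ (l ω) z +
          ENNReal.ofReal Lf * V.indicator 1 (ω, z)) (hRm.add hVi).aemeasurable).symm
    _ ≤ ∫⁻ ω, (ENNReal.ofReal (Lf' * h + C * (2 / κ + κ / T₁ * (2 * Real.pi / h)) +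
          Lf * (4 * Real.exp (-(W / 2)))) +
          ENNReal.ofReal (5 * Lf') * ENNReal.ofReal ‖sqrtMul I.SX (I.θ - l ω)‖) ∂P := by
        refine lintegral_mono fun ω => ?_
        have hVω : Measurable fun z => ENNReal.ofReal Lf * V.indicator 1 (ω, z) :=
          hVi.comp measurable_prodMk_left
        rw [lintegral_add_right _ hVω]
        have h1 := lintegral_local_risk_le (μ := I.μX) (θ := I.θ)
          (norm_sqrtMul_normalizedEstimator_le I (θhat ω)) (n := T₁) hh hh1 hκ hC0 hLf' hT₁
        have h2 : ∫⁻ z, ENNReal.ofReal Lf * V.indicator 1 (ω, z) ∂I.law ≤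
            ENNReal.ofReal (Lf * (4 * Real.exp (-(W / 2)))) := by
          have hVω' : Measurable fun z => V.indicator (1 : Ω × Vec d → ENNReal) (ω, z) :=
            (measurable_one.indicator hVm).comp measurable_prodMk_left
          rw [lintegral_const_mul _ hVω', ENNReal.ofReal_mul hLf]
          gcongr
          have h3 : ∫⁻ z, V.indicator 1 (ω, z) ∂I.law = I.law (Prod.mk ω ⁻¹' V) := by
            rw [← lintegral_indicator_one (measurable_prodMk_left hVm)]
            rfl
          rw [h3]
          exact measure_lt_abs_inner_multivariateGaussian_le
            (norm_sqrtMul_normalizedEstimator_le I (θhat ω)) W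
        refine (add_le_add h1 h2).trans (le_of_eq ?_)
        have hb := norm_nonneg (sqrtMul I.SX (I.θ - l ω))
        change ENNReal.ofReal (Lf' * h + 5 * Lf' * ‖sqrtMul I.SX (I.θ - l ω)‖ +
          C * (2 / κ + κ / T₁ * (2 * Real.pi / h))) + _ = _
        rw [← ENNReal.ofReal_mul (by positivity), ← ENNReal.ofReal_add (by positivity)
          (by positivity), ← ENNReal.ofReal_add (by positivity) (by positivity)]
        congr 1
        ring
    _ = _ := by
        rw [lintegral_add_right _ (hnorm.const_mul _), lintegral_const, measure_univ, mul_one,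
          lintegral_const_mul _ hnorm]

end RoundError

/-! ### From estimation error to the regret of a round. -/

section Regret

variable {Ω : Type*} {d K : ℕ} {x : ℕ → Fin K → Ω → Vec d} {a : ℕ → Ω → Fin K} {η : ℕ → Ω → ℝ}
  {mΩ : MeasurableSpace Ω} {I : Problem d} {σ : ℝ} {T : ℕ} {P : Measure Ω}
  {T₁ : ℕ} {τ W h : ℝ} {θhat : Ω → Vec d} {Lf Lf' m cmin cmax : ℝ}

/-- The regret of a single round. -/
noncomputable def roundRegret (I : Problem d) (x : ℕ → Fin K → Ω → Vec d) (a : ℕ → Ω → Fin K)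
    (t : ℕ) (ω : Ω) : ℝ :=
  (⨆ k, I.f (inner ℝ (x t k ω) I.θ)) - I.f (inner ℝ (played x a t ω) I.θ)

lemma roundRegret_nonneg (t : ℕ) (ω : Ω) : 0 ≤ roundRegret I x a t ω :=
  sub_nonneg.2 (le_ciSup (f := fun k => I.f (inner ℝ (x t k ω) I.θ))
    (Set.finite_range _).bddAbove (a t ω))

lemma roundRegret_le (ha : I.Admissible Lf Lf' m cmin cmax) (t : ℕ) (ω : Ω) :
    roundRegret I x a t ω ≤ 2 * Lf := by
  have : Nonempty (Fin K) := ⟨a t ω⟩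
  have h1 : ⨆ k, I.f (inner ℝ (x t k ω) I.θ) ≤ Lf := ciSup_le fun k => (abs_le.1 (ha.f_bdd _)).2
  have h2 := (abs_le.1 (ha.f_bdd (inner ℝ (played x a t ω) I.θ))).1
  unfold roundRegret
  linarith

lemma measurable_roundRegret (he : IsEnvironment I σ T P x a η)
    (ha : I.Admissible Lf Lf' m cmin cmax) {t : ℕ} (ht : t < T) :
    Measurable (roundRegret I x a t) := by
  have hf := ha.measurable_link
  refine Measurable.sub (Measurable.iSup fun k => ?_) ?_
  · exact hf.comp ((he.measurable_arm t ht k).inner_const)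
  · exact hf.comp ((he.measurable_played ht).inner_const)

lemma integrable_roundRegret [IsProbabilityMeasure P] (he : IsEnvironment I σ T P x a η)
    (ha : I.Admissible Lf Lf' m cmin cmax) {t : ℕ} (ht : t < T) :
    Integrable (roundRegret I x a t) P :=
  Integrable.of_bound (measurable_roundRegret he ha ht).aestronglyMeasurable (2 * Lf)
    (Filter.Eventually.of_forall fun ω => by
      rw [Real.norm_of_nonneg (roundRegret_nonneg t ω)]
      exact roundRegret_le ha t ω)

/-- A greedy round costs at most twice the total error of the estimated rewards. -/
lemma roundRegret_le_of_greedy (hg : IsGSTOR I T T₁ 0 τ W h P x a η θhat) {t : ℕ} (htT : t < T)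
    (ht : 2 * T₁ ≤ t) (ω : Ω) :
    roundRegret I x a t ω ≤ 2 * ∑ k, |linkEstimate I T₁ W h x a η θhat ω
      (inner ℝ (x t k ω) (normalizedEstimator I (θhat ω))) - I.f (inner ℝ (x t k ω) I.θ)| := by
  have : Nonempty (Fin K) := ⟨a t ω⟩
  set e : Fin K → ℝ := fun k => |linkEstimate I T₁ W h x a η θhat ω
      (inner ℝ (x t k ω) (normalizedEstimator I (θhat ω))) - I.f (inner ℝ (x t k ω) I.θ)| with he
  -- The sum covers both the optimal and the played arm, whose indices are random.
  have hle : ∀ k, e k ≤ ∑ k, e k := fun k =>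
    Finset.single_le_sum (fun i _ => abs_nonneg _) (Finset.mem_univ k)
  refine sub_le_iff_le_add.2 (ciSup_le fun k => ?_)
  have h1 := hg.greedy t htT ht ω k
  have h2 := (abs_le.1 ((le_refl (e k)).trans (hle k))).1
  have h3 := (abs_le.1 ((le_refl (e (a t ω))).trans (hle (a t ω)))).2
  unfold played at h1 ⊢
  linarith

/-- Expected regret of a round in the exploitation phase. -/
lemma integral_roundRegret_le [IsProbabilityMeasure P] (he : IsEnvironment I σ T P x a η)
    (hg : IsGSTOR I T T₁ 0 τ W h P x a η θhat) (ha : I.Admissible Lf Lf' m cmin cmax)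
    (hm : 0 < m) (hcmin : 0 < cmin) (hτ : 0 < τ) (hT₁ : 1 ≤ T₁) (hh : 0 < h) (hh1 : h ≤ 1)
    {κ : ℝ} (hκ : 0 < κ) {t : ℕ} (htT : t < T) (ht : 2 * T₁ ≤ t) :
    ∫ ω, roundRegret I x a t ω ∂P ≤ 2 * (K * (Lf' * h + (20 * Lf + 1502 + 2 * σ ^ 2) *
        (2 / κ + κ / T₁ * (2 * Real.pi / h)) + Lf * (4 * Real.exp (-(W / 2))) +
      5 * Lf' * (2 * √cmax / m * d * (2 * (Lf ^ 2 + σ ^ 2) * (1 / cmin) / τ +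
        √(4 * (2 * (Lf ^ 2 + σ ^ 2) * (1 / cmin)) / T₁))))) := by
  have hLf : 0 ≤ Lf := (abs_nonneg _).trans (ha.f_bdd 0)
  have hLf' : 0 ≤ Lf' := (abs_nonneg _).trans (ha.deriv_bdd 0)
  have hpi := Real.pi_pos
  have hest := lintegral_normalizedEstimator_error_le he hg ha hm hcmin hτ hT₁ (by omega)
  set B₁ := Lf' * h + (20 * Lf + 1502 + 2 * σ ^ 2) *
        (2 / κ + κ / T₁ * (2 * Real.pi / h)) + Lf * (4 * Real.exp (-(W / 2))) with hB₁
  set B₂ := 2 * √cmax / m * d * (2 * (Lf ^ 2 + σ ^ 2) * (1 / cmin) / τ +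
        √(4 * (2 * (Lf ^ 2 + σ ^ 2) * (1 / cmin)) / T₁)) with hB₂
  have hB₁0 : 0 ≤ B₁ := by positivity
  have hB₂0 : 0 ≤ B₂ := by positivity
  rw [integral_eq_lintegral_of_nonneg_ae (Filter.Eventually.of_forall (roundRegret_nonneg t))
    (measurable_roundRegret he ha htT).aestronglyMeasurable]
  refine ENNReal.toReal_le_of_le_ofReal (by positivity) ?_
  set e : Fin K → Ω → ℝ := fun k ω => |linkEstimate I T₁ W h x a η θhat ω
      (inner ℝ (x t k ω) (normalizedEstimator I (θhat ω))) - I.f (inner ℝ (x t k ω) I.θ)| with he'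
  have hem : ∀ k, Measurable fun ω => ENNReal.ofReal (e k ω) := fun k =>
    measurable_linkEstimate_error he hg ha htT ht k
  calc ∫⁻ ω, ENNReal.ofReal (roundRegret I x a t ω) ∂P
      ≤ ∫⁻ ω, 2 * ∑ k, ENNReal.ofReal (e k ω) ∂P := by
        refine lintegral_mono fun ω => ?_
        refine (ENNReal.ofReal_le_ofReal (roundRegret_le_of_greedy hg htT ht ω)).trans (le_of_eq ?_)
        rw [ENNReal.ofReal_mul zero_le_two, ENNReal.ofReal_ofNat,
          ENNReal.ofReal_sum_of_nonneg fun k _ => abs_nonneg _]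
    _ = 2 * ∑ k, ∫⁻ ω, ENNReal.ofReal (e k ω) ∂P := by
        rw [lintegral_const_mul' _ _ ENNReal.ofNat_ne_top, lintegral_finsetSum _ fun k _ => hem k]
    _ ≤ 2 * ∑ _k : Fin K, ENNReal.ofReal (B₁ + 5 * Lf' * B₂) := by
        gcongr with k
        refine (lintegral_linkEstimate_error_le he hg ha hT₁ hh hh1 hκ htT ht k).trans ?_
        rw [ENNReal.ofReal_add hB₁0 (by positivity),
          ENNReal.ofReal_mul (by positivity : 0 ≤ 5 * Lf')]
        gcongr
    _ = ENNReal.ofReal (2 * (K * (B₁ + 5 * Lf' * B₂))) := by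
        rw [Finset.sum_const, Finset.card_univ, Fintype.card_fin, nsmul_eq_mul,
          ENNReal.ofReal_mul zero_le_two, ENNReal.ofReal_mul (by positivity),
          ENNReal.ofReal_natCast, ENNReal.ofReal_ofNat]

end Regret

/-! ### Arithmetic of the tuning. -/

section Rates

/-- The logarithmic factor is negligible for the prescribed length of the exploration phase. -/
lemma dim_mul_one_add_log_le {c δ₀ p : ℝ} (hδ₀ : 0 < δ₀) {d T : ℕ} {δ : ℝ} (hd : 1 ≤ d)
    (hT : 1 ≤ T) (hdT : (d : ℝ) ^ 15 ≤ c * (T : ℝ) ^ 2) (hδ : 0 < δ)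
    (hδT : δ₀ * (T : ℝ) ^ (-p) ≤ δ) :
    d * (1 + Real.log (2 * d / δ)) ≤
      |c| ^ (1 / 15 : ℝ) * (11 * (4 + |p| + |Real.log c| + |Real.log δ₀|)) *
        (T : ℝ) ^ (1 / 4 : ℝ) := by
  have hd' : (1 : ℝ) ≤ d := by exact_mod_cast hd
  have hT' : (1 : ℝ) ≤ T := by exact_mod_cast hT
  have hT0 : (0 : ℝ) < T := by linarith
  have hd0 : (0 : ℝ) < d := by linarith
  -- Forced by `d ≥ 1`; the absolute values in the bound only make the constant meaningful for every
  -- `c`.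
  have hc : 0 < c := by
    have h1 : 0 < c * (T : ℝ) ^ 2 := lt_of_lt_of_le (by positivity) hdT
    exact pos_of_mul_pos_left h1 (by positivity)
  have hlogT : 0 ≤ Real.log T := Real.log_nonneg hT'
  have hdim : (d : ℝ) ≤ |c| ^ (1 / 15 : ℝ) * (T : ℝ) ^ (2 / 15 : ℝ) := by
    rw [abs_of_pos hc]
    have h1 := Real.rpow_le_rpow (by positivity) hdT (by norm_num : (0 : ℝ) ≤ 1 / 15)
    rw [Real.mul_rpow hc.le (by positivity), ← Real.rpow_natCast, ← Real.rpow_natCast,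
      ← Real.rpow_mul hd0.le, ← Real.rpow_mul hT0.le] at h1
    norm_num at h1 ⊢
    exact h1
  have hlogd : 15 * Real.log d ≤ Real.log c + 2 * Real.log T := by
    have h1 := Real.log_le_log (by positivity) hdT
    rw [Real.log_mul hc.ne' (by positivity), Real.log_pow, Real.log_pow] at h1
    exact_mod_cast h1
  have hlogδ : Real.log δ₀ - p * Real.log T ≤ Real.log δ := by
    have h1 := Real.log_le_log (by positivity) hδT
    rw [Real.log_mul hδ₀.ne' (by positivity), Real.log_rpow hT0] at h1
    linarith
  have hlog : Real.log (2 * d / δ) = Real.log 2 + Real.log d - Real.log δ := by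
    rw [Real.log_div (by positivity) hδ.ne', Real.log_mul two_ne_zero hd0.ne']
  have hlog2 : Real.log 2 ≤ 1 := by linarith [Real.log_two_lt_d9]
  have hone : (1 : ℝ) ≤ (T : ℝ) ^ (1 / 10 : ℝ) := Real.one_le_rpow hT' (by norm_num)
  have hlogT' : Real.log T ≤ 10 * (T : ℝ) ^ (1 / 10 : ℝ) := by
    have h1 := Real.log_le_rpow_div hT0.le (by norm_num : (0 : ℝ) < 1 / 10)
    linarith
  have hpT : p * Real.log T ≤ |p| * Real.log T :=
    mul_le_mul_of_nonneg_right (le_abs_self p) hlogT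
  set A := 4 + |p| + |Real.log c| + |Real.log δ₀| with hA
  have hfac : 1 + Real.log (2 * d / δ) ≤ 11 * A * (T : ℝ) ^ (1 / 10 : ℝ) := by
    have h1 : 1 + Real.log (2 * d / δ) ≤ A * (1 + Real.log T) := by
      have h2 := le_abs_self (Real.log c)
      have h3 := neg_abs_le (Real.log δ₀)
      have h4 : 0 ≤ |Real.log c| * Real.log T := by positivity
      have h5 : 0 ≤ |Real.log δ₀| * Real.log T := by positivity
      have h6 := abs_nonneg p
      have h7 := abs_nonneg (Real.log c)
      rw [hlog, hA]
      linarith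
    have hA0 : 0 ≤ A := by positivity
    calc 1 + Real.log (2 * d / δ) ≤ A * (1 + Real.log T) := h1
      _ ≤ A * (11 * (T : ℝ) ^ (1 / 10 : ℝ)) := by gcongr; linarith
      _ = _ := by ring
  have hA0 : 0 ≤ 11 * A * (T : ℝ) ^ (1 / 10 : ℝ) := by positivity
  calc d * (1 + Real.log (2 * d / δ))
      ≤ d * (11 * A * (T : ℝ) ^ (1 / 10 : ℝ)) := by gcongr
    _ ≤ (|c| ^ (1 / 15 : ℝ) * (T : ℝ) ^ (2 / 15 : ℝ)) * (11 * A * (T : ℝ) ^ (1 / 10 : ℝ)) := by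
        gcongr
    -- The dimension contributes `T^(2/15)` and the logarithm `T^(1/10)`; their exponents sum to
    -- `7/30`, just below `1/4`.
    _ = |c| ^ (1 / 15 : ℝ) * (11 * A) * (T : ℝ) ^ (7 / 30 : ℝ) := by
        have : (T : ℝ) ^ (7 / 30 : ℝ) = (T : ℝ) ^ (2 / 15 : ℝ) * (T : ℝ) ^ (1 / 10 : ℝ) := by
          rw [← Real.rpow_add hT0]; norm_num
        rw [this]; ring
    _ ≤ _ := mul_le_mul_of_nonneg_left
        (Real.rpow_le_rpow_of_exponent_le hT' (by norm_num)) (by positivity)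

/-- The statistical error of the direction, in terms of the bandwidth `h = n ^ (-1/3)`. -/
lemma dim_mul_estimator_rate_le {D A d ℓ n h : ℝ} (hD : 0 ≤ D) (hA : 0 ≤ A) (hd : 0 < d)
    (hℓ : 0 < ℓ) (hn : 0 < n) (hh : 0 < h) (hnh : n * h ^ 3 = 1) (hle : d * (1 + ℓ) ≤ A * (1 / h)) :
    d * (D / √(3 * n / ℓ) + √(4 * D / n)) ≤ (D + 2 * √D) * √A * (√d * h) := by
  -- After squaring, and with `1/n = h³`, this is the hypothesis `hle` times `d h³`.
  have hroot : d * √((1 + ℓ) / n) ≤ √A * (√d * h) := by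
    have h1 : d * √((1 + ℓ) / n) = √(d ^ 2 * ((1 + ℓ) / n)) := by
      rw [Real.sqrt_mul (by positivity), Real.sqrt_sq hd.le]
    have h2 : √A * (√d * h) = √(A * (d * h ^ 2)) := by
      rw [Real.sqrt_mul hA, Real.sqrt_mul hd.le, Real.sqrt_sq hh.le]
    rw [h1, h2]
    apply Real.sqrt_le_sqrt
    have h3 : 1 / n = h ^ 3 := by field_simp; linarith
    calc d ^ 2 * ((1 + ℓ) / n) = d * (d * (1 + ℓ)) * (1 / n) := by ring
      _ ≤ d * (A * (1 / h)) * (1 / n) := by gcongr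
      _ = A * (d * h ^ 2) := by rw [h3]; field_simp
  have h1 : D / √(3 * n / ℓ) ≤ D * √((1 + ℓ) / n) := by
    rw [div_eq_mul_inv, ← Real.sqrt_inv]
    gcongr
    rw [inv_div]
    gcongr <;> linarith
  have h2 : √(4 * D / n) ≤ 2 * √D * √((1 + ℓ) / n) := by
    have h3 : 2 * √D * √((1 + ℓ) / n) = √(4 * D * ((1 + ℓ) / n)) := by
      rw [Real.sqrt_mul (by positivity), Real.sqrt_mul (by norm_num),
        show (4 : ℝ) = 2 ^ 2 by norm_num, Real.sqrt_sq zero_le_two]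
    rw [h3]
    apply Real.sqrt_le_sqrt
    rw [div_eq_mul_one_div]
    gcongr
    linarith
  calc d * (D / √(3 * n / ℓ) + √(4 * D / n))
      ≤ d * (D * √((1 + ℓ) / n) + 2 * √D * √((1 + ℓ) / n)) := by gcongr
    _ = (D + 2 * √D) * (d * √((1 + ℓ) / n)) := by ring
    _ ≤ (D + 2 * √D) * (√A * (√d * h)) := by gcongr
    _ = _ := by ring

end Rates

/-! ### Assembling the bound. -/

section Main

variable {Ω : Type*} {d K : ℕ} {x : ℕ → Fin K → Ω → Vec d} {a : ℕ → Ω → Fin K} {η : ℕ → Ω → ℝ}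
  {mΩ : MeasurableSpace Ω} {I : Problem d} {σ : ℝ} {T : ℕ} {P : Measure Ω}
  {T₁ : ℕ} {Lf Lf' m cmin cmax : ℝ}

lemma Problem.Admissible.one_le_dim (ha : I.Admissible Lf Lf' m cmin cmax) : 1 ≤ d := by
  rcases Nat.eq_zero_or_pos d with rfl | h
  · have := ha.normalized
    simp [l1Norm] at this
  · exact h

/-- The regret of an explore-then-commit policy whose committed rounds cost at most `B` each. -/
lemma integral_regret_le [IsProbabilityMeasure P] (he : IsEnvironment I σ T P x a η)
    (ha : I.Admissible Lf Lf' m cmin cmax) {n : ℕ} {B : ℝ} (hB : 0 ≤ B)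
    (hle : ∀ t < T, n ≤ t → ∫ ω, roundRegret I x a t ω ∂P ≤ B) :
    ∫ ω, regret I x a T ω ∂P ≤ n * (2 * Lf) + T * B := by
  have hLf : 0 ≤ Lf := (abs_nonneg _).trans (ha.f_bdd 0)
  have h1 : ∫ ω, regret I x a T ω ∂P =
      ∑ t ∈ Finset.range T, ∫ ω, roundRegret I x a t ω ∂P :=
    integral_finsetSum _ fun t ht => integrable_roundRegret he ha (Finset.mem_range.1 ht)
  rw [h1]
  calc ∑ t ∈ Finset.range T, ∫ ω, roundRegret I x a t ω ∂P
      ≤ ∑ t ∈ Finset.range T, ((if t < n then 2 * Lf else 0) + B) := by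
        refine Finset.sum_le_sum fun t ht => ?_
        have htT := Finset.mem_range.1 ht
        split_ifs with htn
        · have h2 : ∫ ω, roundRegret I x a t ω ∂P ≤ ∫ _ω, 2 * Lf ∂P :=
            integral_mono (integrable_roundRegret he ha htT) (integrable_const _)
              fun ω => roundRegret_le ha t ω
          rw [integral_const, probReal_univ, one_smul] at h2
          linarith
        · rw [zero_add]
          exact hle t htT (not_lt.1 htn)
    _ ≤ n * (2 * Lf) + T * B := by
        rw [Finset.sum_add_distrib, Finset.sum_const, Finset.card_range, nsmul_eq_mul,
          ← Finset.sum_filter, Finset.sum_const, nsmul_eq_mul]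
        gcongr
        calc ((Finset.range T).filter (· < n)).card ≤ (Finset.range n).card :=
              Finset.card_le_card fun t ht => by simp at ht ⊢; exact ht.2
          _ = n := Finset.card_range n

/-- The constant in the bound for the regret of an exploitation round. -/
noncomputable def exploitConst (Lf Lf' σ m cmin cmax A : ℝ) : ℝ :=
  Lf' + (20 * Lf + 1502 + 2 * σ ^ 2) * (2 + 2 * Real.pi) + 4 * Lf +
    5 * Lf' * (2 * √cmax / m) * ((2 * (Lf ^ 2 + σ ^ 2) * (1 / cmin) +
      2 * √(2 * (Lf ^ 2 + σ ^ 2) * (1 / cmin))) * √A)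

/-- Expected regret of an exploitation round for the prescribed tuning. -/
lemma integral_roundRegret_le_of_tuning [IsProbabilityMeasure P] {θhat : Ω → Vec d} {δ A : ℝ}
    (he : IsEnvironment I σ T P x a η) (ha : I.Admissible Lf Lf' m cmin cmax)
    (hm : 0 < m) (hcmin : 0 < cmin) (hδ : 0 < δ) (hδ1 : δ < 1) (hT₁ : 1 ≤ T₁)
    (hg : IsGSTOR I T T₁ 0 √(3 * T₁ / Real.log (2 * d / δ)) (2 * Real.log T₁)
      ((T₁ : ℝ) ^ (-(1 / 3) : ℝ)) P x a η θhat) (hA : 0 ≤ A)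
    (hle : d * (1 + Real.log (2 * d / δ)) ≤ A * (T₁ : ℝ) ^ (1 / 3 : ℝ))
    {t : ℕ} (htT : t < T) (ht : 2 * T₁ ≤ t) :
    ∫ ω, roundRegret I x a t ω ∂P ≤
      2 * (K * (exploitConst Lf Lf' σ m cmin cmax A * (√d * (T₁ : ℝ) ^ (-(1 / 3) : ℝ)))) := by
  have hLf : 0 ≤ Lf := (abs_nonneg _).trans (ha.f_bdd 0)
  have hLf' : 0 ≤ Lf' := (abs_nonneg _).trans (ha.deriv_bdd 0)
  have hpi := Real.pi_pos
  have hn : (1 : ℝ) ≤ T₁ := by exact_mod_cast hT₁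
  have hn0 : (0 : ℝ) < T₁ := by linarith
  have hd : (1 : ℝ) ≤ d := by exact_mod_cast ha.one_le_dim
  have hℓ : 0 < Real.log (2 * d / δ) := Real.log_pos (by rw [lt_div_iff₀ hδ]; linarith)
  set h : ℝ := (T₁ : ℝ) ^ (-(1 / 3) : ℝ) with hh
  have hh0 : 0 < h := by positivity
  have hh1 : h ≤ 1 := Real.rpow_le_one_of_one_le_of_nonpos hn (by norm_num)
  have hinv : (T₁ : ℝ) ^ (1 / 3 : ℝ) = 1 / h := by rw [hh, Real.rpow_neg hn0.le]; simp
  have hnh : T₁ * h ^ 3 = 1 := by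
    rw [hh, ← Real.rpow_natCast, ← Real.rpow_mul hn0.le]
    norm_num
    rw [Real.rpow_neg_one, mul_inv_cancel₀ hn0.ne']
  rw [hinv] at hle
  -- The choice `κ = 1/h` balances `2/κ` against `2πκ/(T₁ h)`: since `T₁ h³ = 1`, both are multiples
  -- of `h`.
  have hκ : 0 < 1 / h := by positivity
  have hround := integral_roundRegret_le he hg ha hm hcmin (by positivity) hT₁ hh0 hh1 hκ htT ht
  have hsd : 1 ≤ √(d : ℝ) := Real.one_le_sqrt.2 hd
  set D := 2 * (Lf ^ 2 + σ ^ 2) * (1 / cmin) with hD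
  have hD0 : 0 ≤ D := by positivity
  have hrate := dim_mul_estimator_rate_le hD0 hA (by linarith) hℓ hn0 hh0 hnh hle
  -- The cutoff costs `exp (-W/2) = 1/T₁ = h³ ≤ h`.
  have hexp : Real.exp (-(2 * Real.log T₁ / 2)) ≤ h := by
    rw [mul_div_cancel_left₀ _ two_ne_zero, Real.exp_neg, Real.exp_log hn0,
      inv_eq_of_mul_eq_one_right hnh]
    exact pow_le_of_le_one hh0.le hh1 (by norm_num)
  have hmid : 2 / (1 / h) + 1 / h / T₁ * (2 * Real.pi / h) = (2 + 2 * Real.pi) * h := by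
    have : 1 / (T₁ : ℝ) = h ^ 3 := by rw [one_div, inv_eq_of_mul_eq_one_right hnh]
    rw [show 1 / h / (T₁ : ℝ) = 1 / h * (1 / T₁) by ring, this]
    field_simp
  have hh' : h ≤ √d * h := le_mul_of_one_le_left hh0.le hsd
  refine hround.trans ?_
  rw [hmid]
  gcongr
  calc Lf' * h + (20 * Lf + 1502 + 2 * σ ^ 2) * ((2 + 2 * Real.pi) * h) +
        Lf * (4 * Real.exp (-(2 * Real.log T₁ / 2))) +
        5 * Lf' * (2 * √cmax / m * d * (D / √(3 * T₁ / Real.log (2 * d / δ)) + √(4 * D / T₁)))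
      = Lf' * h + (20 * Lf + 1502 + 2 * σ ^ 2) * ((2 + 2 * Real.pi) * h) +
        Lf * (4 * Real.exp (-(2 * Real.log T₁ / 2))) + 5 * Lf' * (2 * √cmax / m) *
          (d * (D / √(3 * T₁ / Real.log (2 * d / δ)) + √(4 * D / T₁))) := by ring
    _ ≤ Lf' * (√d * h) + (20 * Lf + 1502 + 2 * σ ^ 2) * ((2 + 2 * Real.pi) * (√d * h)) +
        Lf * (4 * (√d * h)) + 5 * Lf' * (2 * √cmax / m) *
          ((D + 2 * √D) * √A * (√d * h)) := by
        have := hexp.trans hh'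
        gcongr
    _ = _ := by rw [exploitConst]; ring

end Main

end SingleIndexBandit

theorem theorem5 (K : ℕ) (Lf Lf' σ m cmin cmax c δ₀ p : ℝ)
    (hm : 0 < m) (hcmin : 0 < cmin) (hδ₀ : 0 < δ₀) :
    ∃ C : ℝ, 0 < C ∧
      ∀ (d T T₁ : ℕ) (δ : ℝ) (I : SingleIndexBandit.Problem d)
        (Ω : Type*) [MeasurableSpace Ω] (P : Measure Ω) [IsProbabilityMeasure P]
        (x : ℕ → Fin K → Ω → SingleIndexBandit.Vec d) (a : ℕ → Ω → Fin K) (η : ℕ → Ω → ℝ)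
        (θhat : Ω → SingleIndexBandit.Vec d),
        I.Admissible Lf Lf' m cmin cmax →
        (d : ℝ) ^ 15 ≤ c * (T : ℝ) ^ 2 →
        0 < δ → δ < 1 → δ₀ * (T : ℝ) ^ (-p) ≤ δ →
        T₁ = ⌈(d : ℝ) ^ (3 / 8 : ℝ) * (T : ℝ) ^ (3 / 4 : ℝ)⌉₊ →
        SingleIndexBandit.IsEnvironment I σ T P x a η →
        SingleIndexBandit.IsGSTOR I T T₁ 0
          (Real.sqrt (3 * T₁ / Real.log (2 * d / δ)))
          (2 * Real.log T₁) ((T₁ : ℝ) ^ (-(1 / 3) : ℝ)) P x a η θhat →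
        Integrable (SingleIndexBandit.regret I x a T) P ∧
        ∫ ω, SingleIndexBandit.regret I x a T ω ∂P
          ≤ C * ((d : ℝ) ^ (3 / 8 : ℝ) * (T : ℝ) ^ (3 / 4 : ℝ)) := by
  open SingleIndexBandit in
  set A := |c| ^ (1 / 15 : ℝ) * (11 * (4 + |p| + |Real.log c| + |Real.log δ₀|)) with hA
  have hA0 : 0 ≤ A := by positivity
  set B := exploitConst Lf Lf' σ m cmin cmax A with hB
  -- There are at most `2 T₁ ≤ 4 N` exploration rounds at `2 Lf` each, hence `8 Lf`. The absolute
  -- value and the `1` ensure positivity, as the sign of `Lf` is unknown before an admissible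
  -- problem is given.
  refine ⟨|8 * Lf + 2 * (K * B)| + 1, by positivity, ?_⟩
  intro d T T₁ δ I Ω _ P _ x a η θhat ha hdT hδ hδ1 hδT hT₁ he hg
  have hLf : 0 ≤ Lf := (abs_nonneg _).trans (ha.f_bdd 0)
  have hLf' : 0 ≤ Lf' := (abs_nonneg _).trans (ha.deriv_bdd 0)
  have hd : (1 : ℝ) ≤ d := by exact_mod_cast ha.one_le_dim
  have hd0 : (0 : ℝ) < d := by linarith
  have hT : 1 ≤ T := by
    rcases Nat.eq_zero_or_pos T with rfl | h
    · have : 0 < (d : ℝ) ^ 15 := by positivity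
      norm_num at hdT
      linarith
    · exact h
  have hT' : (1 : ℝ) ≤ T := by exact_mod_cast hT
  have hT0 : (0 : ℝ) < T := by linarith
  set N : ℝ := (d : ℝ) ^ (3 / 8 : ℝ) * (T : ℝ) ^ (3 / 4 : ℝ) with hN
  have hN1 : 1 ≤ N := one_le_mul_of_one_le_of_one_le (Real.one_le_rpow hd (by norm_num))
    (Real.one_le_rpow hT' (by norm_num))
  have hNT : N ≤ T₁ := hT₁ ▸ Nat.le_ceil N
  -- Rounding up adds less than `1 ≤ N`.
  have hTN : (T₁ : ℝ) ≤ 2 * N := by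
    have := Nat.ceil_lt_add_one (zero_le_one.trans hN1)
    rw [← hT₁] at this
    linarith
  have hn : 1 ≤ T₁ := by
    have : (1 : ℝ) ≤ T₁ := hN1.trans hNT
    exact_mod_cast this
  have hB0 : 0 ≤ B := by
    have := Real.pi_pos
    rw [hB, exploitConst]
    positivity
  refine ⟨integrable_finsetSum _ fun t ht =>
    integrable_roundRegret he ha (Finset.mem_range.1 ht), ?_⟩
  have hNpow : ∀ r : ℝ, N ^ r = (d : ℝ) ^ (3 / 8 * r) * (T : ℝ) ^ (3 / 4 * r) := fun r => by
    rw [hN, Real.mul_rpow (by positivity) (by positivity), ← Real.rpow_mul hd0.le,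
      ← Real.rpow_mul hT0.le]
  have hle : d * (1 + Real.log (2 * d / δ)) ≤ A * (T₁ : ℝ) ^ (1 / 3 : ℝ) := by
    refine (dim_mul_one_add_log_le hδ₀ ha.one_le_dim hT hdT hδ hδT).trans ?_
    refine mul_le_mul_of_nonneg_left ?_ hA0
    calc (T : ℝ) ^ (1 / 4 : ℝ) ≤ N ^ (1 / 3 : ℝ) := by
          rw [hNpow, show (3 / 4 * (1 / 3) : ℝ) = 1 / 4 by norm_num]
          exact le_mul_of_one_le_left (by positivity) (Real.one_le_rpow hd (by norm_num))
      _ ≤ _ := Real.rpow_le_rpow (by positivity) hNT (by norm_num)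
  -- The exponents are `1/2 - 1/8 = 3/8` for `d` and `1 - 1/4 = 3/4` for `T`, those of the
  -- exploration cost.
  have hexploit : T * (√d * (T₁ : ℝ) ^ (-(1 / 3) : ℝ)) ≤ N := by
    have hpow : (T₁ : ℝ) ^ (-(1 / 3) : ℝ) ≤ N ^ (-(1 / 3) : ℝ) :=
      Real.rpow_le_rpow_of_nonpos (by linarith) hNT (by norm_num)
    calc T * (√d * (T₁ : ℝ) ^ (-(1 / 3) : ℝ)) ≤ T * (√d * N ^ (-(1 / 3) : ℝ)) :=
          mul_le_mul_of_nonneg_left (mul_le_mul_of_nonneg_left hpow (by positivity)) hT0.le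
      _ = ((d : ℝ) ^ (1 / 2 : ℝ) * (d : ℝ) ^ (3 / 8 * -(1 / 3) : ℝ)) *
            ((T : ℝ) ^ (1 : ℝ) * (T : ℝ) ^ (3 / 4 * -(1 / 3) : ℝ)) := by
          rw [hNpow, Real.sqrt_eq_rpow, Real.rpow_one]
          ring
      _ = N := by
          rw [← Real.rpow_add hd0, ← Real.rpow_add hT0, hN]
          norm_num
  have hmain := integral_regret_le he ha (n := 2 * T₁)
    (B := 2 * (K * (B * (√d * (T₁ : ℝ) ^ (-(1 / 3) : ℝ))))) (by positivity)
    fun t htT ht => integral_roundRegret_le_of_tuning he ha hm hcmin hδ hδ1 hn hg hA0 hle htT ht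
  refine hmain.trans ?_
  push_cast
  calc 2 * (T₁ : ℝ) * (2 * Lf) + T * (2 * (K * (B * (√d * (T₁ : ℝ) ^ (-(1 / 3) : ℝ)))))
      = 4 * Lf * T₁ + 2 * (K * B) * (T * (√d * (T₁ : ℝ) ^ (-(1 / 3) : ℝ))) := by ring
    _ ≤ 4 * Lf * (2 * N) + 2 * (K * B) * N := by gcongr
    _ = (8 * Lf + 2 * (K * B)) * N := by ring
    _ ≤ _ := by
        refine mul_le_mul_of_nonneg_right ?_ (by linarith)
        linarith [le_abs_self (8 * Lf + 2 * (K * B))]
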